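/- Let $\|A\|$ denote the area of $A\subseteq\mathbb{R}^2$. For $n\ge 3$ let $P_n$ be a fixed regular $n$-gon (a closed, filled polygon) of area $1$, and for $m \ge 1$ let $P_n^m$ be the convex hull of $m$ consecutive corners of $P_n$ (with $P_n^m=P_n$ if $m\ge n$). Put $$s(n)=\begin{cases}\|P_n^{n/2+2}\| & n\equiv 0 \pmod 4\\ \|P_n^{\lceil n/2\rceil+1}\| & n\equiv 1 \pmod 4\\ \|P_n^{n/2+1}\| & n\equiv 2 \pmod 4\\ \|P_n^{\lceil n/2\rceil+2}\| & n\equiv 3 \pmod 4.\end{cases}$$ A finite collection $\mathcal{C}=\{S_v\}_{v\in V}$ of homothetic copies of $P_n$ (obtained from $P_n$ by positive scaling and translation) is $\alpha$-free if $\|S_v\setminus\bigcup_{u\ne v}S_u\|\ge\alpha\|S_v\|$ for all $v\in V$. Its intersection graph $G=(V,E)$ has an edge $uv$ whenever $u\neq v$ and $S_u\cap S_v\ne\emptyset$; $\mathcal{G}(P_n,\alpha)$ is the class of all intersection graphs of $\alpha$-free collections. Let $c_v$ be the center of $S_v$ and let $\varepsilon>0$. A canonical drawing of $G$ (from $\mathcal{C}$,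 with parameter $\varepsilon$) is a drawing obtained as follows. Each vertex $v$ is a point of the $\varepsilon$-ball $B_\varepsilon(c_v)$. For each edge $uv$, scale $S_u$ and $S_v$ down at their centers to $S_u'$ and $S_v'$ such that $B_\varepsilon(c_u)\subseteq S'_u$, $B_\varepsilon(c_v)\subseteq S'_v$, and $S'_u$, $S'_v$ touch but share no positive area; let $p_{uv}$ be the point of $S_u'\cap S_v'$ on the segment $\overline{c_uc_v}$ if there is one, and otherwise the single point of $S'_u\cap S'_v$; the edge $uv$ is drawn as a polyline from $u$ to $v$ whose single bend point is at distance less than $\varepsilon$ from $p_{uv}$. All vertices and bend points are pairwise distinct, no three of them are collinear, and two edges $e,f$ with a common endpoint and $p_e=p_f$ do not cross. Two edges cross if they have a common point that is not a common endpoint. A drawing is $k$-independent crossing if no edge is crossed by more than $k$ pairwise independent (vertex-disjoint) edges. We say that the canonical drawings of all graphs in $\mathcal{G}(P_n,\alpha)$ are $k$-independent crossing if for every $\alpha$-free finite collection of homothetic copies of $P_n$ and all sufficiently small $\varepsilon>0$ (depending on the collection), every canonical drawing with parameter $\varepsilon$ is $k$-independent crossing. Theorem. Let $n\ge 3$ and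 $\alpha\in[0,1]$. 1. There is a constant $k$ such that the canonical drawings of all graphs in $\mathcal{G}(P_n,\alpha)$ are $k$-independent crossing if and only if $\alpha\ge s(n)$. 2. If $\alpha\ge s(n)$, then the canonical drawings of all graphs in $\mathcal{G}(P_n,\alpha)$ are $26(n+1)$-independent crossing (so the constant can be chosen to depend only on $n$). 3. If $\alpha<s(n)$, then for every $k$ there are an $\alpha$-free finite collection of homothetic copies of $P_n$ and an edge $uv$ of its intersection graph such that for all sufficiently small $\varepsilon>0$ a canonical drawing with parameter $\varepsilon$ exists, and in every such drawing the edge $uv$ is crossed by $k$ pairwise independent edges. -/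

import Mathlib

open MeasureTheory Filter Topology

noncomputable section

/- The plane is `ℂ`, with its Euclidean metric and Lebesgue measure. -/

/-- The area of a set in the plane. -/
def area (A : Set ℂ) : ℝ := (volume A).toReal

/-- The `k`-th corner of the regular `n`-gon inscribed in the unit circle. -/
def unitCorner (n k : ℕ) : ℂ := Complex.exp (2 * Real.pi * Complex.I * k / n)

/-- The circumradius of the regular `n`-gon of area `1`
(see `area_regularPolygon` below). -/
def circumradius (n : ℕ) : ℝ :=
  (Real.sqrt (area (convexHull ℝ (Set.range (unitCorner n)))))⁻¹

/-- The `k`-th corner of the regular `n`-gon of area `1`, in cyclic order (periodic in `k`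
with period `n`). -/
def corner (n k : ℕ) : ℂ := circumradius n • unitCorner n k

/-- The regular `n`-gon of area `1`, centred at the origin. -/
def regularPolygon (n : ℕ) : Set ℂ := convexHull ℝ (Set.range (corner n))

theorem unitCorner_eq_pow (n k : ℕ) :
    unitCorner n k = Complex.exp (2 * Real.pi * Complex.I / n) ^ k := by
  rw [unitCorner, ← Complex.exp_nat_mul]
  congr 1
  ring

theorem unitCorner_ne {n i j : ℕ} (hi : i < n) (hj : j < n) (hij : i ≠ j) :
    unitCorner n i ≠ unitCorner n j := by
  have hn : n ≠ 0 := by omega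
  rw [unitCorner_eq_pow, unitCorner_eq_pow]
  exact fun h => hij ((Complex.isPrimitiveRoot_exp n hn).pow_inj hi hj h)

theorem norm_unitCorner (n k : ℕ) : ‖unitCorner n k‖ = 1 := by
  have : (2 * Real.pi * Complex.I * k / n : ℂ) = ((2 * Real.pi * k / n : ℝ) : ℂ) * Complex.I := by
    push_cast
    ring
  rw [unitCorner, this, Complex.norm_exp_ofReal_mul_I]

theorem area_unit_pos {n : ℕ} (hn : 3 ≤ n) :
    0 < area (convexHull ℝ (Set.range (unitCorner n))) := by
  set P := convexHull ℝ (Set.range (unitCorner n)) with hP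
  have hind : AffineIndependent ℝ ![unitCorner n 0, unitCorner n 1, unitCorner n 2] := by
    have hco : EuclideanGeometry.Cospherical (Set.range (unitCorner n)) :=
      ⟨0, 1, by rintro _ ⟨k, rfl⟩; simp [norm_unitCorner]⟩
    exact hco.affineIndependent_of_mem_of_ne ⟨0, rfl⟩ ⟨1, rfl⟩ ⟨2, rfl⟩
      (unitCorner_ne (by omega) (by omega) (by omega))
      (unitCorner_ne (by omega) (by omega) (by omega))
      (unitCorner_ne (by omega) (by omega) (by omega))
  have htop : affineSpan ℝ (Set.range (unitCorner n)) = ⊤ := by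
    have h := (hind.affineSpan_eq_top_iff_card_eq_finrank_add_one).2
      (by simp [Complex.finrank_real_complex])
    refine top_le_iff.1 (h ▸ affineSpan_mono ℝ ?_)
    rintro _ ⟨i, rfl⟩
    fin_cases i
    exacts [⟨0, rfl⟩, ⟨1, rfl⟩, ⟨2, rfl⟩]
  have hint : (interior P).Nonempty := interior_convexHull_nonempty_iff_affineSpan_eq_top.2 htop
  have hbd : Bornology.IsBounded P := isBounded_convexHull.2
    (Metric.isBounded_closedBall (x := (0 : ℂ)) (r := 1) |>.subset (by
      rintro _ ⟨k, rfl⟩; simp [norm_unitCorner]))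
  exact ENNReal.toReal_pos
    (Measure.measure_pos_of_nonempty_interior volume hint).ne' hbd.measure_lt_top.ne

open scoped Pointwise in
theorem area_regularPolygon {n : ℕ} (hn : 3 ≤ n) : area (regularPolygon n) = 1 := by
  have hpos := area_unit_pos hn
  have hP : regularPolygon n =
      circumradius n • convexHull ℝ (Set.range (unitCorner n)) := by
    have h : corner n = fun k => circumradius n • unitCorner n k := rfl
    rw [regularPolygon, ← convexHull_smul, ← Set.range_smul, h]
  rw [hP, area, Measure.addHaar_smul, Complex.finrank_real_complex, ENNReal.toReal_mul,
    ENNReal.toReal_ofReal (abs_nonneg _), ← area, abs_of_nonneg (sq_nonneg _), circumradius,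
    inv_pow, Real.sq_sqrt hpos.le, inv_mul_cancel₀ hpos.ne']

/-- The `n`-gon segment with `m` corners: the convex hull of `m` consecutive corners of the
regular `n`-gon of area `1` (the whole `n`-gon if `m ≥ n`). -/
def polygonSegment (n m : ℕ) : Set ℂ := convexHull ℝ (corner n '' {k | k < m})

/-- The threshold `s(n)`. Note that `(n + 1) / 2 = ⌈n / 2⌉`. -/
def threshold (n : ℕ) : ℝ :=
  if n % 4 = 0 then area (polygonSegment n (n / 2 + 2))
  else if n % 4 = 1 then area (polygonSegment n ((n + 1) / 2 + 1))
  else if n % 4 = 2 then area (polygonSegment n (n / 2 + 1))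
  else area (polygonSegment n ((n + 1) / 2 + 2))

/-- The homothetic copy of the regular `n`-gon with centre `c` and scaling factor `r`. -/
def polygonCopy (n : ℕ) (c : ℂ) (r : ℝ) : Set ℂ := (fun z => c + r • z) '' regularPolygon n

/-- A collection `{S_v}_{v ∈ V}` of homothetic copies of the regular `n`-gon. -/
structure PolygonFamily (V : Type) where
  center : V → ℂ
  scale : V → ℝ
  scale_pos : ∀ v, 0 < scale v

namespace PolygonFamily

variable {V : Type}

/-- The shape `S_v`. -/
def shape (C : PolygonFamily V) (n : ℕ) (v : V) : Set ℂ :=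
  polygonCopy n (C.center v) (C.scale v)

/-- The collection is `α`-free: of each shape, at least an `α`-fraction of the area is disjoint
from all other shapes. -/
def IsFree (C : PolygonFamily V) (n : ℕ) (α : ℝ) : Prop :=
  ∀ v, α * area (C.shape n v) ≤ area (C.shape n v \ ⋃ u ∈ {u | u ≠ v}, C.shape n u)

/-- The intersection graph of the collection. -/
def intersectionGraph (C : PolygonFamily V) (n : ℕ) : SimpleGraph V where
  Adj u v := u ≠ v ∧ (C.shape n u ∩ C.shape n v).Nonempty
  symm := ⟨fun _ _ h => ⟨h.1.symm, by rw [Set.inter_comm]; exact h.2⟩⟩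
  loopless := ⟨fun _ h => h.1 rfl⟩

end PolygonFamily

/-- A drawing with one bend per edge: a point for each vertex, and a bend point for each edge
(the values of `bend` at unordered pairs that are not edges are irrelevant). -/
structure OneBendDrawing (V : Type) where
  pos : V → ℂ
  bend : Sym2 V → ℂ

namespace OneBendDrawing

variable {V : Type}

/-- The polyline of the edge `e = uv`, from `u` to the bend point of `e` to `v`. -/
def curve (D : OneBendDrawing V) (e : Sym2 V) : Set ℂ :=
  {z | ∃ v ∈ e, z ∈ segment ℝ (D.pos v) (D.bend e)}

/-- All vertices and all bend points of edges of `G` are distinct, and no three of these points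
lie on a line. In such a drawing, any two edges have only finitely many points in common,
each being either a common endpoint or a proper crossing. -/
def GeneralPosition (D : OneBendDrawing V) (G : SimpleGraph V) : Prop :=
  let q : V ⊕ G.edgeSet → ℂ := Sum.elim D.pos (fun e => D.bend e)
  Function.Injective q ∧
    ∀ i j k, i ≠ j → i ≠ k → j ≠ k → ¬ Collinear ℝ {q i, q j, q k}

/-- Two different edges cross if they have a point in common that is not a common endpoint. -/
def Crosses (D : OneBendDrawing V) (e f : Sym2 V) : Prop :=
  e ≠ f ∧ ∃ z ∈ D.curve e ∩ D.curve f, ¬ ∃ v, v ∈ e ∧ v ∈ f ∧ z = D.pos v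

/-- `M` is a set of pairwise independent edges of `G` (no two of them share a vertex), each of
which crosses `e`. -/
def IsIndependentCrossingSet (D : OneBendDrawing V) (G : SimpleGraph V) (e : Sym2 V)
    (M : Finset (Sym2 V)) : Prop :=
  (∀ f ∈ M, f ∈ G.edgeSet ∧ D.Crosses e f) ∧
    ∀ f ∈ M, ∀ g ∈ M, f ≠ g → ∀ v, ¬ (v ∈ f ∧ v ∈ g)

/-- No edge of `G` is crossed by more than `k` independent edges of `G`. -/
def IsIndependentCrossing (D : OneBendDrawing V) (G : SimpleGraph V) (k : ℕ) : Prop :=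
  ∀ e ∈ G.edgeSet, ∀ M : Finset (Sym2 V), D.IsIndependentCrossingSet G e M → M.card ≤ k

end OneBendDrawing

namespace PolygonFamily

variable {V : Type}

/-- `p` is an admissible point `p_{uv}`: there are copies `A` of `S_u` and `B` of `S_v`, scaled
down at their centres, which still contain the `ε`-balls around their centres, such that `A` and
`B` touch but share no positive area, and `p` is the point where the segment between the centres
meets `A ∩ B`, or, if there is no such point, the single point of `A ∩ B`. -/
def IsContactPoint (C : PolygonFamily V) (n : ℕ) (ε : ℝ) (u v : V) (p : ℂ) : Prop :=
  ∃ a b : ℝ, 0 < a ∧ a ≤ C.scale u ∧ 0 < b ∧ b ≤ C.scale v ∧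
    let A := polygonCopy n (C.center u) a
    let B := polygonCopy n (C.center v) b
    let L := segment ℝ (C.center u) (C.center v)
    Metric.ball (C.center u) ε ⊆ A ∧ Metric.ball (C.center v) ε ⊆ B ∧
    (A ∩ B).Nonempty ∧ area (A ∩ B) = 0 ∧
    (p ∈ L ∩ (A ∩ B) ∨ (L ∩ (A ∩ B) = ∅ ∧ A ∩ B = {p}))

/-- `D` is a canonical drawing, with offsets smaller than `ε`, of the intersection graph of the
collection: vertices are drawn `ε`-close to the centres of their shapes, the bend point of
each edge is `ε`-close to a contact point, vertices and bend points are in general position, and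
edges with a common endpoint and the same contact point do not cross. -/
def IsCanonicalDrawing (C : PolygonFamily V) (n : ℕ) (ε : ℝ) (D : OneBendDrawing V) : Prop :=
  (∀ v, D.pos v ∈ Metric.ball (C.center v) ε) ∧
  D.GeneralPosition (C.intersectionGraph n) ∧
  ∃ p : Sym2 V → ℂ,
    (∀ u v, (C.intersectionGraph n).Adj u v →
      C.IsContactPoint n ε u v (p s(u, v)) ∧
      D.bend s(u, v) ∈ Metric.ball (p s(u, v)) ε) ∧
    (∀ e ∈ (C.intersectionGraph n).edgeSet, ∀ f ∈ (C.intersectionGraph n).edgeSet,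
      (∃ v, v ∈ e ∧ v ∈ f) → p e = p f → ¬ D.Crosses e f)

end PolygonFamily

/-- The canonical drawings of all (finite) intersection graphs of `α`-free homothetic regular
`n`-gons are `k`-independent crossing. The offsets of a canonical drawing are taken
sufficiently small, depending on the collection. -/
def CanonicalDrawingsIndependentCrossing (n : ℕ) (α : ℝ) (k : ℕ) : Prop :=
  ∀ (V : Type) [Finite V] (C : PolygonFamily V), C.IsFree n α →
    ∀ᶠ ε in 𝓝[>] (0 : ℝ), ∀ D : OneBendDrawing V, C.IsCanonicalDrawing n ε D →
      D.IsIndependentCrossing (C.intersectionGraph n) k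

end

/-! Up to `ε`, an edge `uv` is drawn as two spokes, from the centres of `S_u` and `S_v` to a contact
point `p` in `S_u ∩ S_v`. Write `μ = halfCount n`. The threshold is the area of the segment with
`2μ` corners, where `μ` is the least integer with `(2μ - 1)π/n ≥ π/2`; its chord passes through the
centre or lies beyond it, as seen from the middle side of the segment.

Upper bound. An edge crossing `uv` has an endpoint `w` whose shape, in the limit `ε → 0`, meets a
spoke, say that of `u`. Suppose `S_w` contains no corner of `S_u`. Then inside `S_w` the polygon
`S_u` looks like the half-plane of one of its sides (`exists_halfPlane`), because a sinusoid plus a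
constant cannot change sign four times in a period. If `S_w` keeps a fraction `s(n)` of its area,
the line of this side cuts `S_w` at or below the chord (`area_inter_lt_threshold`). By the choice of
`μ`, the part of `S_w` below the chord is stable under moves in the cone spanned by the two ends of
the side, as long as they stay below the chord (`add_mem_of_nrm_le`). It follows that the spoke lies
in this cone and that `S_w` contains `p` (`end_mem_of_free`). So every crossing edge has an endpoint
that is `u` or `v`, or whose shape contains `p` or a corner of `S_u` or `S_v`. A packing argument
allows at most eleven shapes through a point (`card_le_of_forall_mem`), and independent edges yield
different endpoints, which bounds their number by `2 + 11 + 22n`.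

Lower bound. A huge shape `L` has its top at `0`, and a unit shape stands on it with its bottom at
`0`. The edge between them runs along an axis of symmetry from the centre of `L` to `0`. For each of
`k` sizes, two mirror images, the arms, enter `L` near its top from the two hands, and their corners
furthest across touch on the axis inside `L`. The part of an arm inside `L` reaches only slightly
above the chord, so for `α < s(n)` the rest is large enough (`exists_le_area_inter`). Geometric
growth of the sizes keeps the pairs apart, and the size of `L` keeps `L` free. The edge of each pair
bends at its joint on the axis and so crosses the long edge, stably under perturbation
(`exists_stable_crossing`). The residue of `n` modulo 4 decides which kind of axis has the end of
the chord as the corner extreme in the perpendicular direction; this is why the same `μ` serves both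
bounds. -/

namespace RegularPolygon

/-! ### Unit vectors, corners and side normals -/

/-- The unit vector with argument `x`. -/
noncomputable def unitVec (x : ℝ) : ℂ := ⟨Real.cos x, Real.sin x⟩

/-- The scalar product with the unit vector with argument `x`. -/
noncomputable def dot (x : ℝ) : ℂ →L[ℝ] ℝ :=
  Real.cos x • Complex.reCLM + Real.sin x • Complex.imCLM

theorem dot_apply (x : ℝ) (z : ℂ) : dot x z = Real.cos x * z.re + Real.sin x * z.im := by
  simp [dot]

theorem dot_unitVec (x y : ℝ) : dot x (unitVec y) = Real.cos (y - x) := by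
  rw [dot_apply, unitVec, Real.cos_sub]; ring

theorem norm_unitVec (x : ℝ) : ‖unitVec x‖ = 1 := by
  rw [unitVec, Complex.norm_def, Complex.normSq_mk, Real.sqrt_eq_one]
  nlinarith [Real.sin_sq_add_cos_sq x]

theorem dot_le_norm (x : ℝ) (z : ℂ) : dot x z ≤ ‖z‖ := by
  rw [dot_apply]
  refine le_of_sq_le_sq ?_ (norm_nonneg z)
  rw [Complex.sq_norm, Complex.normSq_apply]
  nlinarith [Real.sin_sq_add_cos_sq x, sq_nonneg (Real.cos x * z.im - Real.sin x * z.re)]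

theorem exists_eq_smul_unitVec (z : ℂ) : z = ‖z‖ • unitVec z.arg := by
  apply Complex.ext
  · simp [unitVec, Complex.norm_mul_cos_arg]
  · simp [unitVec, Complex.norm_mul_sin_arg]

theorem sin_smul_unitVec (x y z : ℝ) :
    Real.sin (y - x) • unitVec z =
      Real.sin (y - z) • unitVec x + Real.sin (z - x) • unitVec y := by
  apply Complex.ext <;> simp only [unitVec, Complex.add_re, Complex.add_im, Complex.real_smul,
    Complex.mul_re, Complex.mul_im, Complex.ofReal_re, Complex.ofReal_im, Real.sin_sub] <;>
  · have h := Real.sin_sq_add_cos_sq z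
    ring

/-- Interpolation of a direction between two others. When `z` lies between `x` and `y`, at most a
half turn apart, the coefficients are nonnegative, so bounds in directions `x` and `y` imply one in
direction `z`. -/
theorem sin_mul_dot (x y z : ℝ) (w : ℂ) :
    Real.sin (y - x) * dot z w =
      Real.sin (y - z) * dot x w + Real.sin (z - x) * dot y w := by
  simp only [dot_apply, Real.sin_sub]; ring

/-- The `k`-th corner of the regular `n`-gon of area `1`, for an integer `k`. -/
noncomputable def vtx (n : ℕ) (k : ℤ) : ℂ := circumradius n • unitVec (2 * k * (Real.pi / n))

/-- The scalar product with the unit normal of the side between the corners `k` and `k + 1`. -/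
noncomputable def nrm (n : ℕ) (k : ℤ) : ℂ →L[ℝ] ℝ := dot ((2 * k + 1) * (Real.pi / n))

/-- The inradius of the regular `n`-gon of area `1`. -/
noncomputable def inradius (n : ℕ) : ℝ := circumradius n * Real.cos (Real.pi / n)

variable {n : ℕ}

theorem circumradius_pos (hn : 3 ≤ n) : 0 < circumradius n :=
  inv_pos.2 (Real.sqrt_pos.2 (area_unit_pos hn))

theorem angle_pos (hn : 3 ≤ n) : 0 < Real.pi / n :=
  div_pos Real.pi_pos (by exact_mod_cast (by omega : 0 < n))

theorem nat_mul_angle (hn : 3 ≤ n) : n * (Real.pi / n) = Real.pi := by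
  have : (n : ℝ) ≠ 0 := by exact_mod_cast (by omega : n ≠ 0)
  field_simp

theorem angle_le (hn : 3 ≤ n) : 3 * (Real.pi / n) ≤ Real.pi := by
  have h := nat_mul_angle hn
  have : (3 : ℝ) ≤ n := by exact_mod_cast hn
  nlinarith [angle_pos hn]

theorem cos_angle_pos (hn : 3 ≤ n) : 0 < Real.cos (Real.pi / n) :=
  Real.cos_pos_of_mem_Ioo ⟨by linarith [angle_pos hn, Real.pi_pos],
    by linarith [angle_le hn, Real.pi_pos]⟩

theorem sin_angle_pos (hn : 3 ≤ n) : 0 < Real.sin (Real.pi / n) :=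
  Real.sin_pos_of_pos_of_lt_pi (angle_pos hn) (by linarith [angle_le hn, Real.pi_pos])

theorem sin_two_angle_pos (hn : 3 ≤ n) : 0 < Real.sin (2 * (Real.pi / n)) :=
  Real.sin_pos_of_pos_of_lt_pi (by linarith [angle_pos hn])
    (by linarith [angle_le hn, angle_pos hn])

theorem inradius_pos (hn : 3 ≤ n) : 0 < inradius n :=
  mul_pos (circumradius_pos hn) (cos_angle_pos hn)

theorem nrm_vtx (j k : ℤ) :
    nrm n j (vtx n k) =
      circumradius n * Real.cos (((2 * k - 2 * j - 1 : ℤ) : ℝ) * (Real.pi / n)) := by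
  rw [nrm, vtx, map_smul, dot_unitVec, smul_eq_mul]
  congr 2; push_cast; ring

theorem nrm_vtx_self (k : ℤ) : nrm n k (vtx n k) = inradius n := by
  rw [nrm_vtx, inradius, ← Real.cos_neg]
  congr 2; push_cast; ring

theorem nrm_vtx_succ (k : ℤ) : nrm n k (vtx n (k + 1)) = inradius n := by
  rw [nrm_vtx, inradius]
  congr 2; push_cast; ring

theorem nrm_add_mul (hn : 3 ≤ n) (k i : ℤ) : nrm n (k + n * i) = nrm n k := by
  ext z
  have h : ((2 * (k + n * i : ℤ) + 1 : ℝ)) * (Real.pi / n) =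
      (2 * k + 1) * (Real.pi / n) + i * (2 * Real.pi) := by
    push_cast
    linear_combination (2 * i : ℝ) * nat_mul_angle hn
  rw [nrm, nrm, h, dot_apply, dot_apply, Real.cos_add_int_mul_two_pi, Real.sin_add_int_mul_two_pi]

theorem vtx_add_mul (hn : 3 ≤ n) (k i : ℤ) : vtx n (k + n * i) = vtx n k := by
  have h : (2 * (k + n * i : ℤ) : ℝ) * (Real.pi / n) =
      2 * k * (Real.pi / n) + i * (2 * Real.pi) := by
    push_cast
    linear_combination (2 * i : ℝ) * nat_mul_angle hn
  rw [vtx, vtx, h, unitVec, unitVec, Real.cos_add_int_mul_two_pi, Real.sin_add_int_mul_two_pi]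

theorem corner_eq_vtx (k : ℕ) : corner n k = vtx n k := by
  rw [corner, vtx, unitCorner]
  congr 1
  have : (2 * Real.pi * Complex.I * k / n : ℂ) =
      ((2 * (k : ℝ) * (Real.pi / n) : ℝ) : ℂ) * Complex.I := by
    push_cast; ring
  have h : (2 * ((k : ℤ) : ℝ) * (Real.pi / n)) = 2 * (k : ℝ) * (Real.pi / n) := by push_cast; rfl
  rw [h]
  rw [this, Complex.exp_mul_I, ← Complex.ofReal_cos, ← Complex.ofReal_sin]
  generalize 2 * (k : ℝ) * (Real.pi / n) = x
  apply Complex.ext <;> simp [unitVec, -Complex.ofReal_cos, -Complex.ofReal_sin]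

theorem exists_nat_vtx (hn : 3 ≤ n) (k : ℤ) : ∃ j < n, vtx n k = corner n j := by
  have hn0 : (0 : ℤ) < n := by omega
  refine ⟨(k % n).toNat, ?_, ?_⟩
  · have := Int.emod_lt_of_pos k hn0
    have := Int.emod_nonneg k hn0.ne'
    omega
  · rw [corner_eq_vtx, Int.toNat_of_nonneg (Int.emod_nonneg k hn0.ne')]
    conv_lhs => rw [← Int.emod_add_mul_ediv k n]
    rw [vtx_add_mul hn]

theorem range_corner (hn : 3 ≤ n) : Set.range (corner n) = Set.range (vtx n) := by
  apply subset_antisymm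
  · rintro _ ⟨k, rfl⟩
    exact ⟨k, (corner_eq_vtx k).symm⟩
  · rintro _ ⟨k, rfl⟩
    obtain ⟨j, -, h⟩ := exists_nat_vtx hn k
    exact ⟨j, h.symm⟩

theorem regularPolygon_eq (hn : 3 ≤ n) :
    regularPolygon n = convexHull ℝ (Set.range (vtx n)) := by
  rw [regularPolygon, range_corner hn]

theorem vtx_mem (hn : 3 ≤ n) (k : ℤ) : vtx n k ∈ regularPolygon n := by
  rw [regularPolygon_eq hn]
  exact subset_convexHull _ _ ⟨k, rfl⟩

theorem convex_regularPolygon (n : ℕ) : Convex ℝ (regularPolygon n) := convex_convexHull _ _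

/-! ### The polygon as an intersection of half-planes -/

/-- Comparison of cosines of integer multiples of `π / n`. -/
theorem cos_le_cos_of_abs_le (hn : 3 ≤ n) {i j : ℤ} (h : |j| ≤ |i|) (hi : |i| ≤ 2 * n - |j|) :
    Real.cos (i * (Real.pi / n)) ≤ Real.cos (j * (Real.pi / n)) := by
  have key : ∀ k : ℤ, Real.cos ((k : ℝ) * (Real.pi / n)) =
      Real.cos ((|k| : ℤ) * (Real.pi / n)) := by
    intro k
    rcases abs_choice k with h | h <;> rw [h]
    push_cast
    rw [neg_mul, Real.cos_neg]
  rw [key i, key j]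
  have ha := angle_pos hn
  have hna := nat_mul_angle hn
  have h1 : ((|j| : ℤ) : ℝ) ≤ (|i| : ℤ) := by exact_mod_cast h
  have h2 : ((|i| : ℤ) : ℝ) ≤ 2 * n - (|j| : ℤ) := by exact_mod_cast hi
  have h0 : (0 : ℝ) ≤ (|j| : ℤ) := by exact_mod_cast abs_nonneg j
  generalize ((|j| : ℤ) : ℝ) = J at *
  generalize ((|i| : ℤ) : ℝ) = I at *
  rcases le_total (I * (Real.pi / n)) Real.pi with hle | hle
  · exact Real.cos_le_cos_of_nonneg_of_le_pi (by positivity) hle (by gcongr)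
  · rw [← Real.cos_two_pi_sub]
    refine Real.cos_le_cos_of_nonneg_of_le_pi (by positivity) (by linarith) ?_
    nlinarith

theorem nrm_vtx_le (hn : 3 ≤ n) (j k : ℤ) : nrm n j (vtx n k) ≤ inradius n := by
  have hn0 : (0 : ℤ) < n := by omega
  rw [← vtx_add_mul hn k (-((k - j) / n)), nrm_vtx, inradius]
  refine mul_le_mul_of_nonneg_left ?_ (circumradius_pos hn).le
  have h1 := Int.emod_lt_of_pos (k - j) hn0
  have h2 := Int.emod_nonneg (k - j) hn0.ne'
  have h3 := Int.emod_add_mul_ediv (k - j) n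
  have := cos_le_cos_of_abs_le hn (j := 1) (i := 2 * ((k - j) % n) - 1)
    (by rw [abs_one, le_abs]; omega) (by rw [abs_one, abs_le]; omega)
  have e : 2 * (k + n * -((k - j) / n)) - 2 * j - 1 = 2 * ((k - j) % n) - 1 := by linarith
  rw [e]
  simpa using this

theorem nrm_le_of_mem (hn : 3 ≤ n) {z : ℂ} (hz : z ∈ regularPolygon n) (j : ℤ) :
    nrm n j z ≤ inradius n := by
  rw [regularPolygon_eq hn] at hz
  have : convexHull ℝ (Set.range (vtx n)) ⊆ {z | nrm n j z ≤ inradius n} := by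
    refine convexHull_min ?_ (convex_halfSpace_le (nrm n j).toLinearMap.isLinear _)
    rintro _ ⟨k, rfl⟩
    exact nrm_vtx_le hn j k
  exact this hz

theorem exists_basis (hn : 3 ≤ n) (z : ℂ) (k : ℤ) :
    ∃ s t : ℝ, z = s • vtx n k + t • vtx n (k + 1) := by
  have hs := sin_two_angle_pos hn
  have hR := circumradius_pos hn
  have h := sin_smul_unitVec (2 * k * (Real.pi / n)) (2 * (k + 1) * (Real.pi / n)) z.arg
  rw [show 2 * ((k : ℝ) + 1) * (Real.pi / n) - 2 * k * (Real.pi / n) = 2 * (Real.pi / n) by ring]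
    at h
  refine ⟨‖z‖ * Real.sin (2 * (k + 1) * (Real.pi / n) - z.arg) /
    (Real.sin (2 * (Real.pi / n)) * circumradius n), ‖z‖ * Real.sin (z.arg -
    2 * k * (Real.pi / n)) / (Real.sin (2 * (Real.pi / n)) * circumradius n), ?_⟩
  have h2 : z = ‖z‖ • (Real.sin (2 * (Real.pi / n)))⁻¹ • Real.sin (2 * (Real.pi / n)) •
      unitVec z.arg := by
    rw [inv_smul_smul₀ hs.ne', ← exists_eq_smul_unitVec]
  rw [h] at h2
  conv_lhs => rw [h2]
  simp only [vtx, smul_add, smul_smul]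
  push_cast
  congr 2 <;> field_simp

theorem exists_sector (hn : 3 ≤ n) (z : ℂ) :
    ∃ (k : ℤ) (s t : ℝ), 0 ≤ s ∧ 0 ≤ t ∧ z = s • vtx n k + t • vtx n (k + 1) := by
  have hs := sin_two_angle_pos hn
  have hR := circumradius_pos hn
  have ha := angle_pos hn
  set k : ℤ := ⌊z.arg / (2 * (Real.pi / n))⌋ with hk
  have h1 : 2 * k * (Real.pi / n) ≤ z.arg := by
    have := Int.floor_le (z.arg / (2 * (Real.pi / n)))
    rw [le_div_iff₀ (by positivity)] at this
    linarith
  have h2 : z.arg ≤ 2 * (k + 1) * (Real.pi / n) := by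
    have := (Int.lt_floor_add_one (z.arg / (2 * (Real.pi / n)))).le
    rw [div_le_iff₀ (by positivity)] at this
    linarith
  have hpi := angle_le hn
  have h := sin_smul_unitVec (2 * k * (Real.pi / n)) (2 * (k + 1) * (Real.pi / n)) z.arg
  rw [show 2 * ((k : ℝ) + 1) * (Real.pi / n) - 2 * k * (Real.pi / n) = 2 * (Real.pi / n) by ring]
    at h
  have hs1 : 0 ≤ Real.sin (2 * (k + 1) * (Real.pi / n) - z.arg) :=
    Real.sin_nonneg_of_nonneg_of_le_pi (by linarith) (by linarith)
  have hs2 : 0 ≤ Real.sin (z.arg - 2 * k * (Real.pi / n)) :=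
    Real.sin_nonneg_of_nonneg_of_le_pi (by linarith) (by linarith)
  refine ⟨k, ‖z‖ * Real.sin (2 * (k + 1) * (Real.pi / n) - z.arg) /
    (Real.sin (2 * (Real.pi / n)) * circumradius n), ‖z‖ * Real.sin (z.arg -
    2 * k * (Real.pi / n)) / (Real.sin (2 * (Real.pi / n)) * circumradius n), by positivity,
    by positivity, ?_⟩
  have h2 : z = ‖z‖ • (Real.sin (2 * (Real.pi / n)))⁻¹ • Real.sin (2 * (Real.pi / n)) •
      unitVec z.arg := by
    rw [inv_smul_smul₀ hs.ne', ← exists_eq_smul_unitVec]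
  rw [h] at h2
  conv_lhs => rw [h2]
  simp only [vtx, smul_add, smul_smul]
  push_cast
  congr 2 <;> field_simp

theorem sum_corner (hn : 3 ≤ n) : ∑ k ∈ Finset.range n, corner n k = 0 := by
  have h := (Complex.isPrimitiveRoot_exp n (by omega)).geom_sum_eq_zero (by omega)
  simp only [corner, unitCorner_eq_pow]
  rw [← Finset.smul_sum, h, smul_zero]

theorem zero_mem (hn : 3 ≤ n) : (0 : ℂ) ∈ regularPolygon n := by
  have hn0 : (n : ℝ) ≠ 0 := by exact_mod_cast (by omega : n ≠ 0)
  have h := (convex_regularPolygon n).sum_mem (t := Finset.range n) (w := fun _ => (n : ℝ)⁻¹)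
    (z := corner n) (fun _ _ => by positivity) (by simp [hn0])
    (fun k _ => by rw [corner_eq_vtx]; exact vtx_mem hn k)
  rwa [← Finset.smul_sum, sum_corner hn, smul_zero] at h

theorem mem_of_sector {A : Set ℂ} (hA : Convex ℝ A) (h0 : (0 : ℂ) ∈ A) {x y : ℂ}
    (hx : x ∈ A) (hy : y ∈ A) {s t : ℝ} (hs : 0 ≤ s) (ht : 0 ≤ t) (hst : s + t ≤ 1) :
    s • x + t • y ∈ A := by
  have h := hA.sum_mem (t := Finset.univ) (w := ![s, t, 1 - s - t]) (z := ![x, y, 0])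
    (by intro i _; fin_cases i <;> simp <;> linarith) (by simp [Fin.sum_univ_three])
    (by intro i _; fin_cases i <;> simpa)
  simpa [Fin.sum_univ_three] using h

/-- The regular polygon is the intersection of the half-planes of its sides. -/
theorem mem_regularPolygon (hn : 3 ≤ n) {z : ℂ} :
    z ∈ regularPolygon n ↔ ∀ j, nrm n j z ≤ inradius n := by
  refine ⟨fun h => nrm_le_of_mem hn h, fun h => ?_⟩
  obtain ⟨k, s, t, hs, ht, rfl⟩ := exists_sector hn z
  -- In the sector over side `k` only the inequality of this side matters: it says `s + t ≤ 1`.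
  have hk := h k
  rw [map_add, map_smul, map_smul, nrm_vtx_self, nrm_vtx_succ, smul_eq_mul, smul_eq_mul,
    ← add_mul] at hk
  have : s + t ≤ 1 := by
    have := inradius_pos hn
    nlinarith
  exact mem_of_sector (convex_regularPolygon n) (zero_mem hn) (vtx_mem hn k) (vtx_mem hn _)
    hs ht this

theorem mem_polygonCopy (hn : 3 ≤ n) {c z : ℂ} {r : ℝ} (hr : 0 < r) :
    z ∈ polygonCopy n c r ↔ ∀ j, nrm n j (z - c) ≤ r * inradius n := by
  have : z ∈ polygonCopy n c r ↔ r⁻¹ • (z - c) ∈ regularPolygon n := by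
    constructor
    · rintro ⟨x, hx, rfl⟩
      simpa only [add_sub_cancel_left, inv_smul_smul₀ hr.ne'] using hx
    · intro h
      refine ⟨_, h, ?_⟩
      simp only [smul_inv_smul₀ hr.ne']
      ring
  rw [this, mem_regularPolygon hn]
  refine forall_congr' fun j => ?_
  rw [map_smul, smul_eq_mul, inv_mul_le_iff₀ hr]

theorem polygonCopy_mono (hn : 3 ≤ n) {c : ℂ} {r r' : ℝ} (hr : 0 < r) (h : r ≤ r') :
    polygonCopy n c r ⊆ polygonCopy n c r' := by
  intro z hz
  rw [mem_polygonCopy hn hr] at hz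
  rw [mem_polygonCopy hn (hr.trans_le h)]
  intro j
  have := inradius_pos hn
  exact (hz j).trans (by gcongr)

theorem convex_polygonCopy (n : ℕ) (c : ℂ) (r : ℝ) : Convex ℝ (polygonCopy n c r) := by
  have : polygonCopy n c r = (fun z => c + z) '' ((fun z => r • z) '' regularPolygon n) := by
    rw [Set.image_image]; rfl
  rw [this]
  exact ((convex_regularPolygon n).smul r).translate c

theorem isCompact_regularPolygon (hn : 3 ≤ n) : IsCompact (regularPolygon n) := by
  have : Set.range (corner n) = corner n '' Set.Iio n := by
    apply subset_antisymm
    · rintro _ ⟨k, rfl⟩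
      obtain ⟨j, hj, h⟩ := exists_nat_vtx hn k
      exact ⟨j, hj, by rw [← h, corner_eq_vtx]⟩
    · exact Set.image_subset_range _ _
  rw [regularPolygon, this]
  exact ((Set.finite_Iio n).image _).isCompact_convexHull ℝ

theorem isCompact_polygonCopy (hn : 3 ≤ n) (c : ℂ) (r : ℝ) : IsCompact (polygonCopy n c r) :=
  (isCompact_regularPolygon hn).image (by fun_prop)

theorem center_mem (hn : 3 ≤ n) (c : ℂ) (r : ℝ) : c ∈ polygonCopy n c r :=
  ⟨0, zero_mem hn, by simp⟩

open scoped Pointwise in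
theorem area_homothety (c : ℂ) (r : ℝ) (A : Set ℂ) :
    area ((fun z => c + r • z) '' A) = r ^ 2 * area A := by
  have : (fun z => c + r • z) '' A = (fun z => c + z) '' (r • A) := by
    rw [← Set.image_smul, Set.image_image]
  rw [this, area, Set.image_add_left, measure_preimage_add, Measure.addHaar_smul,
    Complex.finrank_real_complex, ENNReal.toReal_mul, ENNReal.toReal_ofReal (abs_nonneg _),
    abs_of_nonneg (by positivity), area]

theorem dot_add_pi_div_two (x : ℝ) (z : ℂ) :
    dot (x + Real.pi / 2) z = Real.cos x * z.im - Real.sin x * z.re := by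
  rw [dot_apply, Real.cos_add_pi_div_two, Real.sin_add_pi_div_two]; ring

theorem dot_ext {x : ℝ} {z w : ℂ} (h : dot x z = dot x w)
    (h' : dot (x + Real.pi / 2) z = dot (x + Real.pi / 2) w) : z = w := by
  rw [dot_apply, dot_apply] at h
  rw [dot_add_pi_div_two, dot_add_pi_div_two] at h'
  have hc := Real.sin_sq_add_cos_sq x
  apply Complex.ext
  · linear_combination Real.cos x * h - Real.sin x * h' - (z.re - w.re) * hc
  · linear_combination Real.sin x * h + Real.cos x * h' - (z.im - w.im) * hc

theorem dot_add (x y : ℝ) (z : ℂ) :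
    dot (x + y) z = Real.cos y * dot x z + Real.sin y * dot (x + Real.pi / 2) z := by
  rw [dot_add_pi_div_two, dot_apply, dot_apply, Real.cos_add, Real.sin_add]; ring

theorem volume_dot_eq (x a : ℝ) : volume {z | dot x z = a} = 0 := by
  have h : {z | dot x z = a} =
      (fun z => a • unitVec x + z) '' ((dot x).toLinearMap.ker : Set ℂ) := by
    ext z
    simp only [Set.mem_ofPred_eq, Set.image_add_left, Set.mem_preimage, SetLike.mem_coe,
      LinearMap.mem_ker, ContinuousLinearMap.coe_coe, map_add, map_neg, map_smul, dot_unitVec,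
      sub_self, Real.cos_zero, smul_eq_mul, mul_one]
    constructor <;> intro h <;> linarith
  rw [h, Set.image_add_left, measure_preimage_add]
  refine Measure.addHaar_submodule _ _ fun h => ?_
  have : unitVec x ∈ (dot x).toLinearMap.ker := h ▸ Submodule.mem_top
  simp [dot_unitVec] at this

/-! ### The segment of the threshold and its chord -/

/-- Half the number of corners of the segment whose area is the threshold. -/
def halfCount (n : ℕ) : ℤ := ((n + 1) / 4 + 1 : ℕ)

theorem two_le_halfCount (hn : 3 ≤ n) : 2 ≤ halfCount n := by
  unfold halfCount; omega

/-- Equality holds for `n = 3`: there the two ends of the segment are the same corner. -/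
theorem two_mul_halfCount_le (hn : 3 ≤ n) : 2 * halfCount n - 1 ≤ n := by
  unfold halfCount; omega

/-- `halfCount n` is the least integer with this property, which puts the ends of the chord at an
angle of at least `π/2` from the normal of the middle side. -/
theorem le_four_mul_halfCount : (n : ℤ) ≤ 4 * halfCount n - 2 := by
  unfold halfCount; omega

theorem two_mul_halfCount_lt (hn : 5 ≤ n) : 2 * halfCount n < n := by
  unfold halfCount; omega

theorem le_two_mul_halfCount (hn : n ≤ 4) (hn3 : 3 ≤ n) : (n : ℤ) ≤ 2 * halfCount n := by
  unfold halfCount; omega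

/-- The (nonpositive) level of the chord through the last corners of the segment, in the direction
of the normal of its middle side. -/
noncomputable def chordLevel (n : ℕ) : ℝ :=
  circumradius n * Real.cos ((2 * halfCount n - 1 : ℤ) * (Real.pi / n))

theorem cos_nonpos_of_le (hn : 3 ≤ n) {i : ℤ} (h : n ≤ 2 * i) (h' : 2 * i ≤ 3 * n) :
    Real.cos (i * (Real.pi / n)) ≤ 0 := by
  have h1 : (n : ℝ) ≤ 2 * i := by exact_mod_cast h
  have h2 : (2 * i : ℝ) ≤ 3 * n := by exact_mod_cast h'
  have := nat_mul_angle hn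
  have := angle_pos hn
  exact Real.cos_nonpos_of_pi_div_two_le_of_le (by nlinarith) (by nlinarith)

theorem sin_nonneg_of_le (hn : 3 ≤ n) {i : ℤ} (h : 0 ≤ i) (h' : i ≤ n) :
    0 ≤ Real.sin (i * (Real.pi / n)) := by
  have h1 : (0 : ℝ) ≤ i := by exact_mod_cast h
  have h2 : (i : ℝ) ≤ n := by exact_mod_cast h'
  have := nat_mul_angle hn
  have := angle_pos hn
  exact Real.sin_nonneg_of_nonneg_of_le_pi (by positivity) (by nlinarith)

theorem sin_pos_of_lt (hn : 3 ≤ n) {i : ℤ} (h : 0 < i) (h' : i < n) :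
    0 < Real.sin (i * (Real.pi / n)) := by
  have h1 : (0 : ℝ) < i := by exact_mod_cast h
  have h2 : (i : ℝ) < n := by exact_mod_cast h'
  have := nat_mul_angle hn
  have := angle_pos hn
  exact Real.sin_pos_of_pos_of_lt_pi (by positivity) (by nlinarith)

theorem chordLevel_nonpos (hn : 3 ≤ n) : chordLevel n ≤ 0 := by
  refine mul_nonpos_of_nonneg_of_nonpos (circumradius_pos hn).le (cos_nonpos_of_le hn ?_ ?_)
  · linarith [le_four_mul_halfCount (n := n)]
  · linarith [two_mul_halfCount_le hn]

theorem nrm_vtx_right (k : ℤ) : nrm n k (vtx n (k + halfCount n)) = chordLevel n := by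
  rw [nrm_vtx, chordLevel]; congr 4; ring

theorem nrm_vtx_left (k : ℤ) : nrm n k (vtx n (k + 1 - halfCount n)) = chordLevel n := by
  rw [nrm_vtx, chordLevel, ← Real.cos_neg]; congr 2; push_cast; ring

/-- The segment of the polygon whose middle side is the side between the corners `k` and
`k + 1`. -/
def segmentHull (n : ℕ) (k : ℤ) : Set ℂ :=
  convexHull ℝ (vtx n '' Set.Icc (k + 1 - halfCount n) (k + halfCount n))

theorem convex_segmentHull (n : ℕ) (k : ℤ) : Convex ℝ (segmentHull n k) := convex_convexHull _ _

theorem segmentHull_subset (hn : 3 ≤ n) (k : ℤ) : segmentHull n k ⊆ regularPolygon n :=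
  convexHull_min (by rintro _ ⟨i, -, rfl⟩; exact vtx_mem hn i) (convex_regularPolygon n)

theorem chordLevel_le (hn : 3 ≤ n) {k : ℤ} {z : ℂ} (hz : z ∈ segmentHull n k) :
    chordLevel n ≤ nrm n k z := by
  have : segmentHull n k ⊆ {z | chordLevel n ≤ nrm n k z} := by
    refine convexHull_min ?_ (convex_halfSpace_ge (nrm n k).toLinearMap.isLinear _)
    rintro _ ⟨i, ⟨h1, h2⟩, rfl⟩
    have h3 := two_mul_halfCount_le hn
    have h4 := two_le_halfCount hn
    rw [Set.mem_ofPred_eq, nrm_vtx, chordLevel]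
    refine mul_le_mul_of_nonneg_left (cos_le_cos_of_abs_le hn ?_ ?_) (circumradius_pos hn).le
    · rw [abs_of_nonneg (a := 2 * halfCount n - 1) (by omega), abs_le]; omega
    · have : |2 * i - 2 * k - 1| ≤ 2 * halfCount n - 1 := by rw [abs_le]; omega
      rw [abs_of_nonneg (a := 2 * halfCount n - 1) (by omega)]; omega
  exact this hz

theorem vtx_right_mem (hn : 3 ≤ n) (k : ℤ) : vtx n (k + halfCount n) ∈ segmentHull n k := by
  have := two_le_halfCount hn
  exact subset_convexHull _ _ ⟨_, ⟨by omega, le_rfl⟩, rfl⟩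

theorem vtx_left_mem (hn : 3 ≤ n) (k : ℤ) : vtx n (k + 1 - halfCount n) ∈ segmentHull n k := by
  have := two_le_halfCount hn
  exact subset_convexHull _ _ ⟨_, ⟨le_rfl, by omega⟩, rfl⟩

theorem nrm_add (k i : ℤ) (z : ℂ) :
    nrm n (k + i) z = Real.cos ((2 * i : ℤ) * (Real.pi / n)) * nrm n k z +
      Real.sin ((2 * i : ℤ) * (Real.pi / n)) *
        dot ((2 * k + 1) * (Real.pi / n) + Real.pi / 2) z := by
  rw [nrm, nrm, ← dot_add]
  congr 2; push_cast; ring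

theorem nrm_vtx_left_side (k : ℤ) :
    nrm n (k - (halfCount n - 1)) (vtx n (k + 1 - halfCount n)) = inradius n := by
  rw [show k + 1 - halfCount n = k - (halfCount n - 1) by ring, nrm_vtx_self]

theorem nrm_vtx_right_side (k : ℤ) :
    nrm n (k + (halfCount n - 1)) (vtx n (k + halfCount n)) = inradius n := by
  rw [show k + halfCount n = k + (halfCount n - 1) + 1 by ring, nrm_vtx_succ]

/-- The sides `k ± (halfCount n - 1)` contain the ends of the chord. At chord level their
inequalities bound the coordinate along the chord by its values at these ends. -/
theorem mem_segmentHull_of_eq (hn : 3 ≤ n) {k : ℤ} {z : ℂ} (hz : z ∈ regularPolygon n)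
    (h : nrm n k z = chordLevel n) : z ∈ segmentHull n k := by
  have h2 := two_le_halfCount hn
  have h3 := two_mul_halfCount_le hn
  have hs : 0 < Real.sin ((2 * (halfCount n - 1) : ℤ) * (Real.pi / n)) :=
    sin_pos_of_lt hn (by omega) (by omega)
  set τ := dot ((2 * k + 1) * (Real.pi / n) + Real.pi / 2) with hτ
  have e1 : τ z ≤ τ (vtx n (k + halfCount n)) := by
    have e := nrm_vtx_right_side (n := n) k
    have e' := nrm_le_of_mem hn hz (k + (halfCount n - 1))
    rw [nrm_add, nrm_vtx_right] at e
    rw [nrm_add, h] at e'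
    exact le_of_mul_le_mul_left (by linarith) hs
  have e2 : τ (vtx n (k + 1 - halfCount n)) ≤ τ z := by
    have e := nrm_vtx_left_side (n := n) k
    have e' := nrm_le_of_mem hn hz (k - (halfCount n - 1))
    have hneg : ((2 * -(halfCount n - 1) : ℤ) : ℝ) * (Real.pi / n) =
      -((2 * (halfCount n - 1) : ℤ) * (Real.pi / n)) := by push_cast; ring
    rw [sub_eq_add_neg, nrm_add, nrm_vtx_left, hneg, Real.sin_neg, Real.cos_neg] at e
    rw [sub_eq_add_neg, nrm_add, h, hneg, Real.sin_neg, Real.cos_neg] at e'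
    exact le_of_mul_le_mul_left (by linarith) hs
  have hseg : z ∈ segment ℝ (vtx n (k + 1 - halfCount n)) (vtx n (k + halfCount n)) := by
    have : τ z ∈ segment ℝ (τ (vtx n (k + 1 - halfCount n))) (τ (vtx n (k + halfCount n))) := by
      rw [segment_eq_Icc (e2.trans e1)]; exact ⟨e2, e1⟩
    obtain ⟨a, b, ha, hb, hab, he⟩ := this
    refine ⟨a, b, ha, hb, hab, ?_⟩
    apply dot_ext (x := (2 * k + 1) * (Real.pi / n))
    · change nrm n k _ = nrm n k z
      rw [map_add, map_smul, map_smul, nrm_vtx_left, nrm_vtx_right, h, ← add_smul, hab, one_smul]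
    · rw [map_add, map_smul, map_smul]
      exact he
  exact (convex_convexHull ℝ _).segment_subset (vtx_left_mem hn k) (vtx_right_mem hn k) hseg

/-- Every corner belongs to the segment or is at most at chord level. Hence the point lies between
some `x` of the segment and some `y` at or below the chord, and `xy` meets the chord inside the
segment by `mem_segmentHull_of_eq`. -/
theorem mem_segmentHull_of_le (hn : 3 ≤ n) {k : ℤ} {z : ℂ} (hz : z ∈ regularPolygon n)
    (h : chordLevel n ≤ nrm n k z) : z ∈ segmentHull n k := by
  have hn0 : (0 : ℤ) < n := by omega
  have h2 := two_le_halfCount hn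
  have h3 := two_mul_halfCount_le hn
  have hAB : Set.range (vtx n) = vtx n '' Set.Icc (k + 1 - halfCount n) (k + halfCount n) ∪
      {x | ∃ i, x = vtx n i ∧ nrm n k x ≤ chordLevel n} := by
    apply subset_antisymm
    · rintro _ ⟨i, rfl⟩
      set m := k + 1 - halfCount n with hm
      have e1 := Int.emod_lt_of_pos (i - m) hn0
      have e2 := Int.emod_nonneg (i - m) hn0.ne'
      have e3 := Int.emod_add_mul_ediv (i - m) n
      set j := (i - m) % n with hj
      have hi : vtx n i = vtx n (m + j) := by
        rw [← vtx_add_mul hn (m + j) ((i - m) / n)]; congr 1; linarith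
      rw [hi]
      by_cases hc : m + j ≤ k + halfCount n
      · exact Or.inl ⟨m + j, ⟨by omega, hc⟩, rfl⟩
      · refine Or.inr ⟨m + j, rfl, ?_⟩
        rw [nrm_vtx, chordLevel]
        refine mul_le_mul_of_nonneg_left (cos_le_cos_of_abs_le hn ?_ ?_) (circumradius_pos hn).le
        · rw [abs_of_nonneg (by omega), abs_of_nonneg (by omega)]; omega
        · rw [abs_of_nonneg (by omega), abs_of_nonneg (by omega)]; omega
    · rintro x (⟨i, -, rfl⟩ | ⟨i, rfl, -⟩) <;> exact ⟨i, rfl⟩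
  have hz' := hz
  have hA0 : (vtx n '' Set.Icc (k + 1 - halfCount n) (k + halfCount n)).Nonempty :=
    ⟨_, ⟨k, ⟨by omega, by omega⟩, rfl⟩⟩
  have hB0 : {x | ∃ i, x = vtx n i ∧ nrm n k x ≤ chordLevel n}.Nonempty :=
    ⟨_, ⟨k + halfCount n, rfl, (nrm_vtx_right k).le⟩⟩
  rw [regularPolygon_eq hn, hAB, convexHull_union hA0 hB0, mem_convexJoin] at hz'
  obtain ⟨x, hx, y, hy, hzxy⟩ := hz'
  change x ∈ segmentHull n k at hx
  have hyl : nrm n k y ≤ chordLevel n := by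
    have : convexHull ℝ {x | ∃ i, x = vtx n i ∧ nrm n k x ≤ chordLevel n} ⊆
        {x | nrm n k x ≤ chordLevel n} :=
      convexHull_min (fun x hx => by obtain ⟨i, -, h⟩ := hx; exact h)
        (convex_halfSpace_le (nrm n k).toLinearMap.isLinear _)
    exact this hy
  have hyK : y ∈ regularPolygon n := by
    rw [regularPolygon_eq hn]
    exact convexHull_mono (by rintro x ⟨i, rfl, -⟩; exact ⟨i, rfl⟩) hy
  have hxl := chordLevel_le hn hx
  obtain ⟨a, t, ha, ht, hat, rfl⟩ := hzxy
  rw [map_add, map_smul, map_smul, smul_eq_mul, smul_eq_mul] at h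
  obtain rfl : a = 1 - t := by linarith
  rcases (hyl.trans hxl).eq_or_lt with he | hlt
  · refine mem_segmentHull_of_eq hn hz ?_
    rw [map_add, map_smul, map_smul, smul_eq_mul, smul_eq_mul]
    have : nrm n k y = chordLevel n := by linarith
    rw [← he, this]; ring
  · set X := nrm n k x
    set Y := nrm n k y
    -- The parameter at which the way from `x` to `y` reaches the chord; the given point comes
    -- before it.
    set σ := (X - chordLevel n) / (X - Y) with hσ
    have hσ0 : 0 ≤ σ := div_nonneg (by linarith) (by linarith)
    have hσ1 : σ ≤ 1 := (div_le_one (by linarith)).2 (by linarith)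
    have hσt : t ≤ σ := by rw [hσ, le_div_iff₀ (by linarith)]; linarith
    have hσe : σ * (X - Y) = X - chordLevel n := div_mul_cancel₀ _ (by linarith)
    have hc : (1 - σ) • x + σ • y ∈ segmentHull n k := by
      refine mem_segmentHull_of_eq hn (convex_regularPolygon n (segmentHull_subset hn k hx) hyK
        (by linarith) hσ0 (by ring)) ?_
      rw [map_add, map_smul, map_smul, smul_eq_mul, smul_eq_mul]
      linarith
    rcases hσ0.eq_or_lt with h0 | h0
    · have : t = 0 := by linarith
      subst this
      simpa using hx
    · have := convex_segmentHull n k hx hc (a := 1 - t / σ) (b := t / σ)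
        (sub_nonneg.2 ((div_le_one h0).2 hσt)) (by positivity) (by ring)
      convert this using 1
      rw [smul_add, smul_smul, smul_smul, ← add_assoc, ← add_smul]
      congr 2 <;> field_simp; ring

theorem zero_mem_segmentHull (hn : 3 ≤ n) (k : ℤ) : (0 : ℂ) ∈ segmentHull n k :=
  mem_segmentHull_of_le hn (zero_mem hn) (by simpa using chordLevel_nonpos hn)

/-! ### Areas of caps compared with the threshold -/

theorem area_mono {A B : Set ℂ} (h : A ⊆ B) (hB : volume B ≠ ⊤) : area A ≤ area B :=
  ENNReal.toReal_mono hB (measure_mono h)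

theorem area_nonneg (A : Set ℂ) : 0 ≤ area A := ENNReal.toReal_nonneg

theorem volume_ne_top {A : Set ℂ} (hn : 3 ≤ n) (h : A ⊆ regularPolygon n) : volume A ≠ ⊤ :=
  ((measure_mono h).trans_lt (isCompact_regularPolygon hn).measure_lt_top).ne

theorem area_segmentHull (k l : ℤ) : area (segmentHull n k) = area (segmentHull n l) := by
  have h : segmentHull n k =
      (rotation (Circle.exp (2 * (k - l) * (Real.pi / n)))).toLinearEquiv.toLinearMap ''
        segmentHull n l := by
    rw [segmentHull, segmentHull, LinearMap.image_convexHull, ← Set.image_comp]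
    congr 1
    have e : ∀ i : ℤ, (rotation (Circle.exp (2 * (k - l) * (Real.pi / n)))) (vtx n i) =
        vtx n (i + (k - l)) := by
      intro i
      rw [rotation_apply, Circle.coe_exp, vtx, vtx, Complex.exp_mul_I, ← Complex.ofReal_cos,
        ← Complex.ofReal_sin]
      have : (2 * ((i + (k - l) : ℤ) : ℝ) * (Real.pi / n)) =
        2 * i * (Real.pi / n) + 2 * (k - l) * (Real.pi / n) := by push_cast; ring
      rw [this, unitVec, unitVec, Real.cos_add, Real.sin_add]
      generalize 2 * ((k : ℝ) - l) * (Real.pi / n) = x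
      generalize 2 * (i : ℝ) * (Real.pi / n) = y
      apply Complex.ext <;> simp [-Complex.ofReal_cos, -Complex.ofReal_sin] <;> ring
    ext z
    constructor
    · rintro ⟨i, ⟨h1, h2⟩, rfl⟩
      refine ⟨i - (k - l), ⟨by omega, by omega⟩, ?_⟩
      exact (e _).trans (by congr 1; ring)
    · rintro ⟨i, ⟨h1, h2⟩, rfl⟩
      exact ⟨i + (k - l), ⟨by omega, by omega⟩, (e _).symm⟩
  rw [h, area, Measure.addHaar_image_linearMap]
  have hd : LinearMap.det
      (rotation (Circle.exp (2 * (k - l) * (Real.pi / n)))).toLinearEquiv.toLinearMap = 1 :=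
    det_rotation _
  rw [hd]
  simp [area]

/-- All four residue classes count `2 * ((n + 1) / 4 + 1)` corners, with rounding down. -/
theorem threshold_eq (k : ℤ) : threshold n = area (segmentHull n k) := by
  have h1 : threshold n = area (polygonSegment n (2 * ((n + 1) / 4 + 1))) := by
    unfold threshold
    split_ifs <;> congr 2 <;> omega
  rw [h1, area_segmentHull k (halfCount n - 1), polygonSegment, segmentHull]
  congr 2
  ext z
  constructor
  · rintro ⟨i, hi, rfl⟩
    refine ⟨i, ⟨by omega, ?_⟩, (corner_eq_vtx i).symm⟩
    simp only [Set.mem_ofPred_eq] at hi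
    unfold halfCount; omega
  · rintro ⟨i, ⟨h2, h3⟩, rfl⟩
    obtain ⟨j, rfl⟩ := Int.eq_ofNat_of_zero_le (a := i) (by omega)
    refine ⟨j, ?_, corner_eq_vtx j⟩
    unfold halfCount at h3
    simp only [Set.mem_ofPred_eq]
    omega

theorem threshold_le_one (hn : 3 ≤ n) : threshold n ≤ 1 := by
  rw [threshold_eq 0, ← area_regularPolygon hn]
  exact area_mono (segmentHull_subset hn 0) (volume_ne_top hn subset_rfl)

theorem segmentHull_eq (hn : 3 ≤ n) (h : n ≤ 4) (k : ℤ) : segmentHull n k = regularPolygon n := by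
  refine subset_antisymm (segmentHull_subset hn k) ?_
  have hn0 : (0 : ℤ) < n := by omega
  rw [regularPolygon_eq hn]
  refine convexHull_min ?_ (convex_convexHull _ _)
  rintro _ ⟨i, rfl⟩
  set m := k + 1 - halfCount n with hm
  have e1 := Int.emod_lt_of_pos (i - m) hn0
  have e2 := Int.emod_nonneg (i - m) hn0.ne'
  have e3 := Int.emod_add_mul_ediv (i - m) n
  have hi : vtx n i = vtx n (m + (i - m) % n) := by
    rw [← vtx_add_mul hn (m + (i - m) % n) ((i - m) / n)]; congr 1; linarith
  rw [hi]
  have := le_two_mul_halfCount h hn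
  exact subset_convexHull _ _ ⟨_, ⟨by omega, by omega⟩, rfl⟩

theorem threshold_eq_one (hn : 3 ≤ n) (h : n ≤ 4) : threshold n = 1 := by
  rw [threshold_eq 0, segmentHull_eq hn h, area_regularPolygon hn]

/-- A segment contains the centre and `2 * halfCount n - 1` consecutive sides. Two consecutive
segments contain at least `n` sides, by `le_four_mul_halfCount`, and therefore cover the polygon
sector by sector. -/
theorem half_le_threshold (hn : 3 ≤ n) : 1 / 2 ≤ threshold n := by
  have hn0 : (0 : ℤ) < n := by omega
  have h2 := two_le_halfCount hn
  have h3 := le_four_mul_halfCount (n := n)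
  have hsub : regularPolygon n ⊆ segmentHull n 0 ∪ segmentHull n (2 * halfCount n - 1) := by
    intro z hz
    obtain ⟨i, s, t, hs, ht, rfl⟩ := exists_sector hn z
    have hst : s + t ≤ 1 := by
      have h := nrm_le_of_mem hn hz i
      rw [map_add, map_smul, map_smul, nrm_vtx_self, nrm_vtx_succ, smul_eq_mul, smul_eq_mul,
        ← add_mul] at h
      have := inradius_pos hn
      nlinarith
    set m := 1 - halfCount n with hm
    have e1 := Int.emod_lt_of_pos (i - m) hn0
    have e2 := Int.emod_nonneg (i - m) hn0.ne'
    have e3 := Int.emod_add_mul_ediv (i - m) n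
    set j := (i - m) % n with hj
    have hi : vtx n i = vtx n (m + j) := by
      rw [← vtx_add_mul hn (m + j) ((i - m) / n)]; congr 1; linarith
    have hi' : vtx n (i + 1) = vtx n (m + j + 1) := by
      rw [← vtx_add_mul hn (m + j + 1) ((i - m) / n)]; congr 1; linarith
    rw [hi, hi']
    by_cases hc : m + j ≤ halfCount n - 1
    · left
      refine mem_of_sector (convex_convexHull _ _) (zero_mem_segmentHull hn 0)
        (subset_convexHull _ _ ⟨_, ⟨?_, ?_⟩, rfl⟩) (subset_convexHull _ _ ⟨_, ⟨?_, ?_⟩, rfl⟩)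
        hs ht hst <;> omega
    · right
      refine mem_of_sector (convex_convexHull _ _) (zero_mem_segmentHull hn _)
        (subset_convexHull _ _ ⟨_, ⟨?_, ?_⟩, rfl⟩) (subset_convexHull _ _ ⟨_, ⟨?_, ?_⟩, rfl⟩)
        hs ht hst <;> omega
  have h := area_regularPolygon hn
  have : area (regularPolygon n) ≤
      area (segmentHull n 0) + area (segmentHull n (2 * halfCount n - 1)) := by
    have e1 := volume_ne_top hn (segmentHull_subset hn 0)
    have e2 := volume_ne_top hn (segmentHull_subset hn (2 * halfCount n - 1))
    rw [area, area, area, ← ENNReal.toReal_add e1 e2]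
    exact ENNReal.toReal_mono (ENNReal.add_ne_top.2 ⟨e1, e2⟩)
      ((measure_mono hsub).trans (measure_union_le _ _))
  rw [← threshold_eq, ← threshold_eq] at this
  linarith

theorem interior_segmentHull_nonempty (hn : 3 ≤ n) (k : ℤ) :
    (interior (segmentHull n k)).Nonempty := by
  by_contra h
  rw [Set.not_nonempty_iff_eq_empty] at h
  have h0 : volume (segmentHull n k) = 0 := by
    refine measure_mono_null ?_ ((convex_segmentHull n k).addHaar_frontier volume)
    intro z hz
    rw [frontier, h, Set.sdiff_empty]
    exact subset_closure hz
  have := half_le_threshold hn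
  rw [threshold_eq k, area, h0] at this
  norm_num at this

/-- The inequality is strict because the cap misses an open piece of the segment near an end of the
chord. -/
theorem area_inter_lt_threshold (hn : 3 ≤ n) (k : ℤ) {t : ℝ} (ht : chordLevel n < t) :
    area (regularPolygon n ∩ {z | t < nrm n k z}) < threshold n := by
  set O := interior (segmentHull n k) ∩ {z | nrm n k z < t} with hO
  have hOo : IsOpen O := isOpen_interior.inter (isOpen_lt (nrm n k).continuous continuous_const)
  have hne : O.Nonempty := by
    have hcl : vtx n (k + halfCount n) ∈ closure (interior (segmentHull n k)) := by
      rw [(convex_segmentHull n k).closure_interior_eq_closure_of_nonempty_interior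
        (interior_segmentHull_nonempty hn k)]
      exact subset_closure (vtx_right_mem hn k)
    have := mem_closure_iff.1 hcl {z | nrm n k z < t}
      (isOpen_lt (nrm n k).continuous continuous_const)
      (by rw [Set.mem_ofPred_eq, nrm_vtx_right]; exact ht)
    rwa [Set.inter_comm] at this
  have hpos : 0 < volume O := hOo.measure_pos volume hne
  have hsub : regularPolygon n ∩ {z | t < nrm n k z} ∪ O ⊆ segmentHull n k := by
    rintro z (⟨h1, h2⟩ | h)
    · exact mem_segmentHull_of_le hn h1 (ht.le.trans (le_of_lt h2))
    · exact interior_subset h.1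
  have hdisj : Disjoint (regularPolygon n ∩ {z | t < nrm n k z}) O := by
    rw [Set.disjoint_left]
    rintro z ⟨-, h1⟩ ⟨-, h2⟩
    rw [Set.mem_ofPred_eq] at h1 h2
    exact lt_asymm h1 h2
  have hfin := volume_ne_top hn (segmentHull_subset hn k)
  have hm := measure_mono (μ := volume) hsub
  rw [measure_union hdisj hOo.measurableSet] at hm
  rw [threshold_eq k, area, area]
  refine ENNReal.toReal_strict_mono hfin (lt_of_lt_of_le (ENNReal.lt_add_right ?_ hpos.ne') hm)
  exact volume_ne_top hn Set.inter_subset_left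

/-- The caps above levels decreasing to the chord exhaust the segment up to the chord, which is a
null set. -/
theorem exists_le_area_inter (hn : 3 ≤ n) (k : ℤ) {α : ℝ} (h : α < threshold n) :
    ∃ δ > 0, α ≤ area (regularPolygon n ∩ {z | chordLevel n + δ < nrm n k z}) := by
  set F : ℕ → Set ℂ := fun m =>
    regularPolygon n ∩ {z | chordLevel n + 1 / ((m : ℝ) + 1) < nrm n k z}
  have hF : Monotone F := by
    intro i j hij z hz
    have hz2 : chordLevel n + 1 / ((i : ℝ) + 1) < nrm n k z := hz.2
    refine ⟨hz.1, ?_⟩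
    rw [Set.mem_ofPred_eq]
    refine lt_of_le_of_lt ?_ hz2
    have : 1 / ((j : ℝ) + 1) ≤ 1 / ((i : ℝ) + 1) := Nat.one_div_le_one_div hij
    linarith
  have hU : segmentHull n k ⊆ (⋃ m, F m) ∪ {z | nrm n k z = chordLevel n} := by
    intro z hz
    rcases (chordLevel_le hn hz).eq_or_lt with h | h
    · exact Or.inr h.symm
    · obtain ⟨m, hm⟩ := exists_nat_one_div_lt (sub_pos.2 h)
      exact Or.inl (Set.mem_iUnion.2 ⟨m, segmentHull_subset hn k hz, by
        rw [Set.mem_ofPred_eq]; linarith⟩)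
  have hle : volume (segmentHull n k) ≤ volume (⋃ m, F m) := by
    refine (measure_mono hU).trans ((measure_union_le _ _).trans ?_)
    rw [nrm, volume_dot_eq, add_zero]
  have hfin : volume (⋃ m, F m) ≠ ⊤ :=
    volume_ne_top hn (Set.iUnion_subset fun m => Set.inter_subset_left)
  have hlt : α < (volume (⋃ m, F m)).toReal := by
    rw [threshold_eq k] at h
    exact h.trans_le (ENNReal.toReal_mono hfin hle)
  have ht := (ENNReal.tendsto_toReal hfin).comp (tendsto_measure_iUnion_atTop (μ := volume) hF)
  obtain ⟨m, hm⟩ := (ht.eventually (lt_mem_nhds hlt)).exists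
  exact ⟨1 / ((m : ℝ) + 1), by positivity, hm.le⟩

/-! ### Moves below the chord -/

theorem exists_nrm_add (hn : 3 ≤ n) (j m : ℤ) :
    ∃ i : ℤ, 0 ≤ i ∧ i < n ∧ nrm n j = nrm n (m + i) := by
  have hn0 : (0 : ℤ) < n := by omega
  refine ⟨(j - m) % n, Int.emod_nonneg _ hn0.ne', Int.emod_lt_of_pos _ hn0, ?_⟩
  rw [← nrm_add_mul hn (m + (j - m) % n) ((j - m) / n)]
  congr 1
  have := Int.emod_add_mul_ediv (j - m) n
  linarith

/-- The angles between these normals and the two corners lie in `[π/2, 3π/2]`. This is where the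
size of `halfCount n` enters the upper bound. -/
theorem nrm_add_vtx_nonpos (hn : 3 ≤ n) {k i : ℤ} (h1 : halfCount n ≤ i)
    (h2 : i ≤ n - halfCount n) :
    nrm n (k + i) (vtx n k) ≤ 0 ∧ nrm n (k + i) (vtx n (k + 1)) ≤ 0 := by
  have h3 := le_four_mul_halfCount (n := n)
  have hR := (circumradius_pos hn).le
  rw [nrm_vtx, nrm_vtx]
  constructor <;> refine mul_nonpos_of_nonneg_of_nonpos hR ?_
  · rw [← Real.cos_neg]
    have := cos_nonpos_of_le hn (i := 2 * i + 1) (by omega) (by omega)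
    convert this using 1
    congr 1; push_cast; ring_nf
  · rw [← Real.cos_neg]
    have := cos_nonpos_of_le hn (i := 2 * i - 1) (by omega) (by omega)
    convert this using 1
    congr 1; push_cast; ring_nf

/-- The part of the polygon below the chord is closed under moving towards the chord in the
directions between those of the two corners adjacent to the opposite side. -/
theorem add_mem_of_nrm_le (hn : 3 ≤ n) {k : ℤ} {x : ℂ} (hx : x ∈ regularPolygon n) {s t : ℝ}
    (hs : 0 ≤ s) (ht : 0 ≤ t)
    (h : nrm n k (x + (s • vtx n k + t • vtx n (k + 1))) ≤ chordLevel n) :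
    x + (s • vtx n k + t • vtx n (k + 1)) ∈ regularPolygon n := by
  have hρ := inradius_pos hn
  rcases Nat.lt_or_ge 4 n with h5 | h4
  · have h2 := two_le_halfCount hn
    have hlt := two_mul_halfCount_lt h5
    set z := x + (s • vtx n k + t • vtx n (k + 1)) with hz
    have hS : 0 < Real.sin ((2 * halfCount n : ℤ) * (Real.pi / n)) :=
      sin_pos_of_lt hn (by omega) hlt
    -- The sides far from side `k` face away from both corners, so the move does not bring the point
    -- closer to their lines.
    have hlow : ∀ i, halfCount n ≤ i → i ≤ n - halfCount n → nrm n (k + i) z ≤ inradius n := by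
      intro i h1 h2
      obtain ⟨e1, e2⟩ := nrm_add_vtx_nonpos hn (k := k) h1 h2
      have e3 := nrm_le_of_mem hn hx (k + i)
      rw [hz, map_add, map_add, map_smul, map_smul, smul_eq_mul, smul_eq_mul]
      nlinarith [mul_nonpos_of_nonneg_of_nonpos hs e1, mul_nonpos_of_nonneg_of_nonpos ht e2]
    rw [mem_regularPolygon hn]
    intro j
    obtain ⟨i, hi1, hi2, hj⟩ := exists_nrm_add hn j (k + 1 - halfCount n)
    rw [hj]
    rcases le_or_gt (2 * halfCount n - 1) i with hc | hc
    · have := hlow (1 - halfCount n + i) (by omega) (by omega)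
      rwa [show k + 1 - halfCount n + i = k + (1 - halfCount n + i) by ring]
    rcases le_or_gt (halfCount n - 1) i with hc' | hc'
    · set m := i - (halfCount n - 1) with hm
      have hki : k + 1 - halfCount n + i = k + m := by omega
      rw [hki]
      -- The normal `k + m` lies between the normals `k` and `k + halfCount n`. In these two
      -- directions `z` is bounded by the values at the corner `k + halfCount n`; hence also in
      -- direction `k + m`, where the corner satisfies the inequality. The other hand is symmetric.
      have key : ∀ w, Real.sin ((2 * halfCount n : ℤ) * (Real.pi / n)) * nrm n (k + m) w =
          Real.sin ((2 * (halfCount n - m) : ℤ) * (Real.pi / n)) * nrm n k w +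
          Real.sin ((2 * m : ℤ) * (Real.pi / n)) * nrm n (k + halfCount n) w := by
        intro w
        have := sin_mul_dot ((2 * k + 1) * (Real.pi / n))
          ((2 * (k + halfCount n : ℤ) + 1) * (Real.pi / n))
          ((2 * (k + m : ℤ) + 1) * (Real.pi / n)) w
        rw [nrm, nrm, nrm]
        convert this using 3 <;> (try congr 1) <;> push_cast <;> ring_nf
      have hs1 := sin_nonneg_of_le hn (i := 2 * (halfCount n - m)) (by omega) (by omega)
      have hs2 := sin_nonneg_of_le hn (i := 2 * m) (by omega) (by omega)
      have k1 := key z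
      have k2 := key (vtx n (k + halfCount n))
      rw [nrm_vtx_right, nrm_vtx_self] at k2
      have k3 := hlow (halfCount n) le_rfl (by omega)
      have k4 := nrm_vtx_le hn (k + m) (k + halfCount n)
      have k5 := mul_le_mul_of_nonneg_left h hs1
      have k6 := mul_le_mul_of_nonneg_left k3 hs2
      exact le_of_mul_le_mul_left (by nlinarith) hS
    · set m := halfCount n - 1 - i with hm
      have hki : k + 1 - halfCount n + i = k - m := by omega
      rw [hki]
      have key : ∀ w, Real.sin ((2 * halfCount n : ℤ) * (Real.pi / n)) * nrm n (k - m) w =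
          Real.sin ((2 * m : ℤ) * (Real.pi / n)) * nrm n (k - halfCount n) w +
          Real.sin ((2 * (halfCount n - m) : ℤ) * (Real.pi / n)) * nrm n k w := by
        intro w
        have := sin_mul_dot ((2 * (k - halfCount n : ℤ) + 1) * (Real.pi / n))
          ((2 * k + 1) * (Real.pi / n)) ((2 * (k - m : ℤ) + 1) * (Real.pi / n)) w
        rw [nrm, nrm, nrm]
        convert this using 3 <;> (try congr 1) <;> push_cast <;> ring_nf
      have hs1 := sin_nonneg_of_le hn (i := 2 * (halfCount n - m)) (by omega) (by omega)
      have hs2 := sin_nonneg_of_le hn (i := 2 * m) (by omega) (by omega)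
      have k1 := key z
      have k2 := key (vtx n (k + 1 - halfCount n))
      have e : nrm n (k - halfCount n) (vtx n (k + 1 - halfCount n)) = inradius n := by
        rw [show k + 1 - halfCount n = k - halfCount n + 1 by ring, nrm_vtx_succ]
      rw [nrm_vtx_left, e] at k2
      have k3 := hlow (n - halfCount n) (by omega) le_rfl
      rw [show k + (n - halfCount n) = k - halfCount n + n * 1 by ring, nrm_add_mul hn] at k3
      have k4 := nrm_vtx_le hn (k - m) (k + 1 - halfCount n)
      have k5 := mul_le_mul_of_nonneg_left h hs1
      have k6 := mul_le_mul_of_nonneg_left k3 hs2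
      exact le_of_mul_le_mul_left (by nlinarith) hS
  -- For `n ≤ 4` the segment is the whole polygon: `x` is already at or above the chord, so the move
  -- is zero.
  · have h1 : chordLevel n ≤ nrm n k x := chordLevel_le hn (by rwa [segmentHull_eq hn h4])
    rw [map_add, map_add, map_smul, map_smul, nrm_vtx_self, nrm_vtx_succ, smul_eq_mul,
      smul_eq_mul] at h
    have hs0 : s = 0 := by nlinarith [mul_nonneg ht hρ.le]
    have ht0 : t = 0 := by nlinarith [mul_nonneg hs hρ.le]
    simpa [hs0, ht0] using hx

/-! ### Copies that contain no corner of the polygon -/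

theorem cos_three_angle_lt (hn : 3 ≤ n) : Real.cos (3 * (Real.pi / n)) < Real.cos (Real.pi / n) :=
  Real.cos_lt_cos_of_nonneg_of_le_pi (angle_pos hn).le (angle_le hn) (by linarith [angle_pos hn])

/-- A point of the polygon on the line of a side, in terms of the corners of this side. -/
theorem exists_of_nrm_eq (hn : 3 ≤ n) {l : ℤ} {e : ℂ} (he : e ∈ regularPolygon n)
    (h : nrm n l e = inradius n) :
    ∃ s : ℝ, 0 ≤ s ∧ s ≤ 1 ∧ e = (1 - s) • vtx n l + s • vtx n (l + 1) := by
  obtain ⟨ξ, η, rfl⟩ := exists_basis hn e l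
  have hρ := inradius_pos hn
  have hR := circumradius_pos hn
  have h3 := cos_three_angle_lt hn
  have h1 := nrm_le_of_mem hn he (l + 1)
  have h2 := nrm_le_of_mem hn he (l - 1)
  rw [map_add, map_smul, map_smul, nrm_vtx_self, nrm_vtx_succ, smul_eq_mul, smul_eq_mul] at h
  obtain rfl : ξ = 1 - η := by
    have : (ξ + η - 1) * inradius n = 0 := by linarith
    rcases mul_eq_zero.1 this with h | h <;> linarith
  have e1 : nrm n (l + 1) (vtx n l) = circumradius n * Real.cos (3 * (Real.pi / n)) := by
    rw [nrm_vtx, ← Real.cos_neg]; congr 2; push_cast; ring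
  have e2 : nrm n (l - 1) (vtx n (l + 1)) = circumradius n * Real.cos (3 * (Real.pi / n)) := by
    rw [nrm_vtx]; congr 2; push_cast; ring
  have e3 : nrm n (l - 1) (vtx n l) = inradius n := by
    simpa using nrm_vtx_succ (n := n) (l - 1)
  rw [map_add, map_smul, map_smul, nrm_vtx_self, e1, smul_eq_mul, smul_eq_mul] at h1
  rw [map_add, map_smul, map_smul, e2, e3, smul_eq_mul, smul_eq_mul] at h2
  have hpos : 0 < inradius n - circumradius n * Real.cos (3 * (Real.pi / n)) := by
    rw [inradius]; nlinarith
  refine ⟨η, ?_, ?_, rfl⟩ <;> nlinarith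

/-- Twice the area of a positively oriented triangle inscribed in the unit circle; it factors into
the sines of the half angles. -/
theorem sin_triple_pos {a b c : ℝ} (h1 : a < b) (h2 : b < c) (h3 : c < a + 2 * Real.pi) :
    0 < Real.sin (b - a) + Real.sin (c - b) + Real.sin (a - c) := by
  have e : Real.sin (b - a) + Real.sin (c - b) + Real.sin (a - c) =
      4 * Real.sin ((b - a) / 2) * Real.sin ((c - b) / 2) * Real.sin ((c - a) / 2) := by
    rw [show b - a = 2 * ((b - a) / 2) by ring, show c - b = 2 * ((c - b) / 2) by ring,
      show a - c = -(2 * ((b - a) / 2) + 2 * ((c - b) / 2)) by ring,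
      show (c - a) / 2 = (b - a) / 2 + (c - b) / 2 by ring]
    generalize (b - a) / 2 = x
    generalize (c - b) / 2 = y
    rw [show 2 * x / 2 = x by ring, show 2 * y / 2 = y by ring, Real.sin_neg, Real.sin_add,
      Real.sin_add, Real.sin_two_mul, Real.sin_two_mul, Real.cos_two_mul, Real.cos_two_mul]
    linear_combination (4 * Real.sin x * Real.cos x) * (Real.sin_sq_add_cos_sq y).symm +
      (4 * Real.sin y * Real.cos y) * (Real.sin_sq_add_cos_sq x).symm
  rw [e]
  have := Real.sin_pos_of_pos_of_lt_pi (x := (b - a) / 2) (by linarith) (by linarith)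
  have := Real.sin_pos_of_pos_of_lt_pi (x := (c - b) / 2) (by linarith) (by linarith)
  have := Real.sin_pos_of_pos_of_lt_pi (x := (c - a) / 2) (by linarith) (by linarith)
  positivity

/-- A translate of a sinusoid changes its sign at most twice per period. -/
theorem sinusoid_sign_changes {θ₁ θ₂ θ₃ θ₄ C : ℝ} (z : ℂ) (h12 : θ₁ < θ₂) (h23 : θ₂ < θ₃)
    (h34 : θ₃ < θ₄) (h41 : θ₄ < θ₁ + 2 * Real.pi) (h1 : 0 ≤ dot θ₁ z + C)
    (h2 : dot θ₂ z + C < 0) (h3 : 0 ≤ dot θ₃ z + C) (h4 : dot θ₄ z + C < 0) : False := by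
  have d1 := sin_triple_pos h23 h34 (by linarith)
  have d2 := sin_triple_pos (h12.trans h23) h34 (by linarith)
  have d3 := sin_triple_pos h12 (h23.trans h34) (by linarith)
  have d4 := sin_triple_pos h12 h23 (by linarith)
  -- The values of `1`, `cos` and `sin` at four angles satisfy one linear relation. Its coefficients
  -- are the triangle areas with alternating signs, so the four sign conditions contradict it.
  have key : (Real.sin (θ₃ - θ₂) + Real.sin (θ₄ - θ₃) + Real.sin (θ₂ - θ₄)) * (dot θ₁ z + C) -
      (Real.sin (θ₃ - θ₁) + Real.sin (θ₄ - θ₃) + Real.sin (θ₁ - θ₄)) * (dot θ₂ z + C) +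
      (Real.sin (θ₂ - θ₁) + Real.sin (θ₄ - θ₂) + Real.sin (θ₁ - θ₄)) * (dot θ₃ z + C) -
      (Real.sin (θ₂ - θ₁) + Real.sin (θ₃ - θ₂) + Real.sin (θ₁ - θ₃)) * (dot θ₄ z + C) = 0 := by
    simp only [dot_apply, Real.sin_sub]; ring
  nlinarith [mul_nonneg d1.le h1, mul_nonneg d3.le h3, mul_pos_of_neg_of_neg (neg_lt_zero.2 d2) h2,
    mul_pos_of_neg_of_neg (neg_lt_zero.2 d4) h4]

theorem cos_sub_cos_angle (n : ℕ) (i : ℤ) :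
    Real.cos ((2 * i - 1 : ℤ) * (Real.pi / n)) - Real.cos ((2 * i + 1 : ℤ) * (Real.pi / n)) =
      2 * Real.sin ((2 * i : ℤ) * (Real.pi / n)) * Real.sin (Real.pi / n) := by
  have e1 : ((2 * i - 1 : ℤ) : ℝ) * (Real.pi / n) = (2 * i : ℤ) * (Real.pi / n) - Real.pi / n := by
    push_cast; ring
  have e2 : ((2 * i + 1 : ℤ) : ℝ) * (Real.pi / n) = (2 * i : ℤ) * (Real.pi / n) + Real.pi / n := by
    push_cast; ring
  rw [e1, e2, Real.cos_sub, Real.cos_add]; ring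

theorem sin_two_mul_nonpos (hn : 3 ≤ n) {i : ℤ} (h1 : n ≤ 2 * i) (h2 : i ≤ n) :
    Real.sin ((2 * i : ℤ) * (Real.pi / n)) ≤ 0 := by
  have := sin_nonneg_of_le hn (i := 2 * i - n) (by omega) (by omega)
  have e : ((2 * i : ℤ) : ℝ) * (Real.pi / n) = (2 * i - n : ℤ) * (Real.pi / n) + Real.pi := by
    push_cast; linear_combination nat_mul_angle hn
  rw [e, Real.sin_add_pi]
  linarith

/-- A half-plane with normal `j` contains points of the sides `l` and `l + M` but not the corner `l
+ 1`. The level rises along side `l` towards this corner, hence `0 < 2J < n`. If `J ≥ M`, both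
corners of side `l + M` would be at least as high as corner `l + 1`, against the second hypothesis.
-/
theorem exists_between_of_cut (hn : 3 ≤ n) {l M j : ℤ} (hM : 0 < M) {s s' : ℝ}
    (hs : s < 1) (hs0 : 0 ≤ s') (hs1 : s' ≤ 1)
    (he : nrm n j ((1 - s) • vtx n l + s • vtx n (l + 1)) < nrm n j (vtx n (l + 1)))
    (he' : nrm n j ((1 - s') • vtx n (l + M) + s' • vtx n (l + M + 1)) <
      nrm n j (vtx n (l + 1))) :
    ∃ J, 0 < J ∧ J < M ∧ nrm n j = nrm n (l + J) := by
  obtain ⟨J, hJ0, hJn, hj⟩ := exists_nrm_add hn j l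
  have hR := circumradius_pos hn
  rw [hj] at he he'
  have c1 : 2 * l - 2 * (l + J) - 1 = -(2 * J + 1) := by ring
  have c2 : 2 * (l + 1) - 2 * (l + J) - 1 = -(2 * J - 1) := by ring
  rw [map_add, map_smul, map_smul, nrm_vtx, nrm_vtx, c1, c2, Int.cast_neg, Int.cast_neg, neg_mul,
    neg_mul, Real.cos_neg, Real.cos_neg, smul_eq_mul, smul_eq_mul] at he
  have hd := cos_sub_cos_angle n J
  have hsin : 0 < Real.sin ((2 * J : ℤ) * (Real.pi / n)) := by
    by_contra hneg
    rw [not_lt] at hneg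
    have h1 : Real.cos ((2 * J - 1 : ℤ) * (Real.pi / n)) ≤
        Real.cos ((2 * J + 1 : ℤ) * (Real.pi / n)) := by
      nlinarith [mul_nonneg_of_nonpos_of_nonpos hneg (neg_nonpos.2 (sin_angle_pos hn).le)]
    nlinarith [mul_nonneg (mul_nonneg (sub_nonneg.2 hs.le) hR.le) (sub_nonneg.2 h1)]
  have hJ1 : 0 < J := by
    rcases hJ0.eq_or_lt with h | h
    · subst h; simp at hsin
    · exact h
  have hJ2 : 2 * J < n := by
    by_contra h
    exact (sin_two_mul_nonpos hn (by omega) hJn.le).not_gt hsin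
  refine ⟨J, hJ1, ?_, hj⟩
  by_contra hMJ
  rw [not_lt] at hMJ
  rw [map_add, map_smul, map_smul, nrm_vtx, nrm_vtx, nrm_vtx, smul_eq_mul, smul_eq_mul] at he'
  have k1 := cos_le_cos_of_abs_le hn (i := 2 * (l + 1) - 2 * (l + J) - 1)
    (j := 2 * (l + M) - 2 * (l + J) - 1) (by rw [c2, abs_neg, abs_of_nonneg (a := 2 * J - 1)
      (by omega), abs_of_nonpos (by omega)]; omega)
    (by rw [c2, abs_neg, abs_of_nonneg (a := 2 * J - 1) (by omega), abs_of_nonpos (by omega)]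
        omega)
  have k2 := cos_le_cos_of_abs_le hn (i := 2 * (l + 1) - 2 * (l + J) - 1)
    (j := 2 * (l + M + 1) - 2 * (l + J) - 1)
    (by rw [c2, abs_neg, abs_of_nonneg (a := 2 * J - 1) (by omega), abs_le]; omega)
    (by have : |2 * (l + M + 1) - 2 * (l + J) - 1| ≤ 2 * J - 1 := by rw [abs_le]; omega
        rw [c2, abs_neg, abs_of_nonneg (a := 2 * J - 1) (by omega)]; omega)
  nlinarith [mul_nonneg (mul_nonneg (sub_nonneg.2 hs1) hR.le) (sub_nonneg.2 k1),
    mul_nonneg (mul_nonneg hs0 hR.le) (sub_nonneg.2 k2)]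

/-- The mirror image of `exists_between_of_cut`: cutting off the other end of side `l` forces the
normal into the complementary arc. -/
theorem exists_beyond_of_cut (hn : 3 ≤ n) {l M j : ℤ} (hMn : M < n) {s s' : ℝ}
    (hs : 0 < s) (hs0 : 0 ≤ s') (hs1 : s' ≤ 1)
    (he : nrm n j ((1 - s) • vtx n l + s • vtx n (l + 1)) < nrm n j (vtx n l))
    (he' : nrm n j ((1 - s') • vtx n (l + M) + s' • vtx n (l + M + 1)) < nrm n j (vtx n l)) :
    ∃ J, M < J ∧ J < n ∧ nrm n j = nrm n (l + J) := by
  obtain ⟨J, hJ0, hJn, hj⟩ := exists_nrm_add hn j l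
  have hR := circumradius_pos hn
  rw [hj] at he he'
  have c1 : 2 * l - 2 * (l + J) - 1 = -(2 * J + 1) := by ring
  have c2 : 2 * (l + 1) - 2 * (l + J) - 1 = -(2 * J - 1) := by ring
  rw [map_add, map_smul, map_smul, nrm_vtx, nrm_vtx, c1, c2, Int.cast_neg, Int.cast_neg, neg_mul,
    neg_mul, Real.cos_neg, Real.cos_neg, smul_eq_mul, smul_eq_mul] at he
  have hd := cos_sub_cos_angle n J
  have hsin : Real.sin ((2 * J : ℤ) * (Real.pi / n)) < 0 := by
    by_contra hneg
    rw [not_lt] at hneg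
    have h1 : Real.cos ((2 * J + 1 : ℤ) * (Real.pi / n)) ≤
        Real.cos ((2 * J - 1 : ℤ) * (Real.pi / n)) := by
      nlinarith [mul_nonneg hneg (sin_angle_pos hn).le]
    nlinarith [mul_nonneg (mul_nonneg hs.le hR.le) (sub_nonneg.2 h1)]
  have hJ2 : n < 2 * J := by
    by_contra h
    exact (sin_nonneg_of_le hn (i := 2 * J) (by omega) (by omega)).not_gt hsin
  refine ⟨J, ?_, hJn, hj⟩
  by_contra hMJ
  rw [not_lt] at hMJ
  rw [map_add, map_smul, map_smul, nrm_vtx, nrm_vtx, nrm_vtx, smul_eq_mul, smul_eq_mul] at he'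
  have hab : ∀ i, |i| ≤ 2 * n - 2 * J - 1 →
      Real.cos ((2 * l - 2 * (l + J) - 1 : ℤ) * (Real.pi / n)) ≤ Real.cos (i * (Real.pi / n)) := by
    intro i hi
    apply cos_le_cos_of_abs_le hn <;>
      rw [c1, abs_neg, abs_of_nonneg (a := 2 * J + 1) (by omega)] <;> omega
  have k1 := hab (2 * (l + M) - 2 * (l + J) - 1) (by rw [abs_le]; omega)
  have k2 := hab (2 * (l + M + 1) - 2 * (l + J) - 1) (by rw [abs_le]; omega)
  nlinarith [mul_nonneg (mul_nonneg (sub_nonneg.2 hs1) hR.le) (sub_nonneg.2 k1),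
    mul_nonneg (mul_nonneg hs0 hR.le) (sub_nonneg.2 k2)]

/-- A segment leaving the polygon crosses one of its sides. -/
theorem exists_side_crossing (hn : 3 ≤ n) {a b : ℂ} (ha : a ∈ regularPolygon n)
    (hb : b ∉ regularPolygon n) :
    ∃ l : ℤ, ∃ e ∈ segment ℝ a b, e ∈ regularPolygon n ∧ nrm n l e = inradius n ∧
      inradius n < nrm n l b := by
  have hper : ∀ j : ℤ, ∃ i ∈ Finset.range n, nrm n j = nrm n (i : ℤ) := by
    intro j
    obtain ⟨i, hi0, hin, hj⟩ := exists_nrm_add hn j 0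
    refine ⟨i.toNat, Finset.mem_range.2 (by omega), ?_⟩
    rw [hj, Int.toNat_of_nonneg hi0, zero_add]
  set F := (Finset.range n).filter fun j : ℕ => inradius n < nrm n (j : ℤ) b with hF
  -- The parameter at which `ab` meets the line of side `j`. The smallest one, over the sides that
  -- separate `b` from the polygon, belongs to the exit point.
  set τ : ℕ → ℝ := fun j => (inradius n - nrm n (j : ℤ) a) / (nrm n (j : ℤ) b - nrm n (j : ℤ) a)
  have hne : F.Nonempty := by
    rw [mem_regularPolygon hn, not_forall] at hb
    obtain ⟨j, hj⟩ := hb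
    obtain ⟨i, hi, hji⟩ := hper j
    exact ⟨i, Finset.mem_filter.2 ⟨hi, by rw [← hji]; exact not_le.1 hj⟩⟩
  obtain ⟨l, hl, hmin⟩ := Finset.exists_min_image F τ hne
  have hla := nrm_le_of_mem hn ha l
  have hlb := (Finset.mem_filter.1 hl).2
  have h0 : 0 ≤ τ l := div_nonneg (by linarith) (by linarith)
  have h1 : τ l ≤ 1 := (div_le_one (by linarith)).2 (by linarith)
  have hτ : ∀ j : ℤ, nrm n j ((1 - τ l) • a + τ l • b) =
      nrm n j a + τ l * (nrm n j b - nrm n j a) := by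
    intro j; rw [map_add, map_smul, map_smul, smul_eq_mul, smul_eq_mul]; ring
  refine ⟨l, (1 - τ l) • a + τ l • b, ⟨_, _, by linarith, h0, by ring, rfl⟩, ?_, ?_, hlb⟩
  · rw [mem_regularPolygon hn]
    intro j
    obtain ⟨i, hi, hji⟩ := hper j
    rw [hji, hτ]
    have hia := nrm_le_of_mem hn ha i
    by_cases hc : inradius n < nrm n (i : ℤ) b
    · have := hmin i (Finset.mem_filter.2 ⟨hi, hc⟩)
      have := (le_div_iff₀ (by linarith)).1 this
      linarith
    · nlinarith
  · rw [hτ, div_mul_cancel₀ _ (by linarith)]; ring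

/-- If a homothetic copy `S` of the polygon contains no corner of the polygon, then inside `S`
the polygon looks like a half-plane. -/
theorem exists_halfPlane (hn : 3 ≤ n) {c : ℂ} {r : ℝ} (hr : 0 < r)
    (hv : ∀ k, vtx n k ∉ polygonCopy n c r) {a : ℂ} (ha : a ∈ polygonCopy n c r)
    (haK : a ∈ regularPolygon n) (hns : ¬ polygonCopy n c r ⊆ regularPolygon n) :
    ∃ l, ∀ x ∈ polygonCopy n c r, nrm n l x ≤ inradius n → x ∈ regularPolygon n := by
  obtain ⟨b, hb, hbK⟩ := Set.not_subset.1 hns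
  have hconv := convex_polygonCopy n c r
  obtain ⟨l, e, hes, heK, hel, -⟩ := exists_side_crossing hn haK hbK
  have heS := hconv.segment_subset ha hb hes
  refine ⟨l, ?_⟩
  -- Otherwise the copy also contains a point `e'` of a second side, `l + M`.
  by_contra! hf
  obtain ⟨f, hfS, hfl, hfK⟩ := hf
  obtain ⟨m', e', hes', heK', hem', hfm⟩ := exists_side_crossing hn haK hfK
  have heS' := hconv.segment_subset ha hfS hes'
  obtain ⟨M, hM0, hMn, hm⟩ := exists_nrm_add hn m' l
  rw [hm] at hem' hfm
  have hM : 0 < M := by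
    rcases hM0.eq_or_lt with h | h
    · subst h; rw [add_zero] at hfm; linarith
    · exact h
  obtain ⟨s, hs0, hs1, rfl⟩ := exists_of_nrm_eq hn heK hel
  obtain ⟨s', hs0', hs1', rfl⟩ := exists_of_nrm_eq hn heK' hem'
  have hs1 : s < 1 := lt_of_le_of_ne hs1 (by
    rintro rfl; exact hv (l + 1) (by simpa using heS))
  have hs0 : 0 < s := lt_of_le_of_ne hs0 (by
    rintro rfl; exact hv l (by simpa using heS))
  have hH : ∀ {z} j, z ∈ polygonCopy n c r → nrm n j z ≤ nrm n j c + r * inradius n := by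
    intro z j hz
    have := (mem_polygonCopy hn hr).1 hz j
    rw [map_sub] at this
    linarith
  -- Each corner is cut off from the copy by the line of one of the sides of the copy. For the two
  -- ends of side `l`, the normals of these lines lie on the two arcs between the normals `l` and `l
  -- + M`.
  have hcut : ∀ k, ∃ j, nrm n j c + r * inradius n < nrm n j (vtx n k) := by
    intro k
    have := hv k
    rw [mem_polygonCopy hn hr, not_forall] at this
    obtain ⟨j, hj⟩ := this
    rw [map_sub] at hj
    exact ⟨j, by linarith⟩
  obtain ⟨j₁, hj₁⟩ := hcut (l + 1)
  obtain ⟨j₂, hj₂⟩ := hcut l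
  obtain ⟨J, hJ0, hJM, hJ⟩ := exists_between_of_cut hn hM hs1 hs0' hs1'
    ((hH j₁ heS).trans_lt hj₁) ((hH j₁ heS').trans_lt hj₁)
  obtain ⟨J', hJM', hJn', hJ'⟩ := exists_beyond_of_cut hn hMn hs0 hs0' hs1'
    ((hH j₂ heS).trans_lt hj₂) ((hH j₂ heS').trans_lt hj₂)
  rw [hJ] at hj₁
  rw [hJ'] at hj₂
  have hα := angle_pos hn
  have hπ := nat_mul_angle hn
  have q1 : (0 : ℝ) < J := by exact_mod_cast hJ0
  have q2 : (J : ℝ) < M := by exact_mod_cast hJM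
  have q3 : (M : ℝ) < J' := by exact_mod_cast hJM'
  have q4 : (J' : ℝ) < n := by exact_mod_cast hJn'
  -- The sinusoid compares the two polygons in each normal direction: it is nonnegative exactly when
  -- the side line of the copy is at least as far out as that of the polygon. Its signs at `l`, `l +
  -- J`, `l + M`, `l + J'` alternate.
  refine sinusoid_sign_changes (θ₁ := (2 * l + 1) * (Real.pi / n))
    (θ₂ := (2 * (l + J : ℤ) + 1) * (Real.pi / n)) (θ₃ := (2 * (l + M : ℤ) + 1) * (Real.pi / n))
    (θ₄ := (2 * (l + J' : ℤ) + 1) * (Real.pi / n)) (C := (r - 1) * inradius n) c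
    ?_ ?_ ?_ ?_ ?_ ?_ ?_ ?_
  · push_cast; nlinarith
  · push_cast; nlinarith
  · push_cast; nlinarith
  · push_cast; nlinarith
  · have := hH l heS
    rw [hel] at this
    change 0 ≤ nrm n l c + _
    linarith
  · have := nrm_vtx_le hn (l + J) (l + 1)
    change nrm n (l + J) c + _ < 0
    linarith
  · have := hH (l + M) heS'
    rw [hem'] at this
    change 0 ≤ nrm n (l + M) c + _
    linarith
  · have := nrm_vtx_le hn (l + J') l
    change nrm n (l + J') c + _ < 0
    linarith

/-! ### From a point of a spoke to its end -/

theorem area_polygonCopy (hn : 3 ≤ n) (c : ℂ) (r : ℝ) : area (polygonCopy n c r) = r ^ 2 := by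
  rw [polygonCopy, area_homothety, area_regularPolygon hn, mul_one]

/-- If a homothetic copy of the polygon is sufficiently uncovered by the polygon and contains no
corner of the polygon, then with a point of a segment from the centre it contains the end of this
segment. -/
theorem end_mem_of_free (hn : 3 ≤ n) {c : ℂ} {r : ℝ} (hr : 0 < r)
    (hv : ∀ k, vtx n k ∉ polygonCopy n c r)
    (hfree : threshold n * r ^ 2 ≤ area (polygonCopy n c r \ regularPolygon n)) {p z : ℂ}
    (hp : p ∈ regularPolygon n) (hz : z ∈ segment ℝ 0 p) (hzS : z ∈ polygonCopy n c r) :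
    p ∈ polygonCopy n c r := by
  have hρ := inradius_pos hn
  have hzK : z ∈ regularPolygon n := (convex_regularPolygon n).segment_subset (zero_mem hn) hp hz
  have hth := half_le_threshold hn
  obtain ⟨l, hl⟩ := exists_halfPlane hn hr hv hzS hzK (by
    intro h
    rw [Set.sdiff_eq_empty.2 h, area, measure_empty, ENNReal.toReal_zero] at hfree
    nlinarith [pow_pos hr 2])
  -- Measured in the copy, the line of side `l` is at or below the chord. Otherwise the uncovered
  -- part lies in a cap of area less than the threshold.
  have hheight : inradius n - nrm n l c ≤ chordLevel n * r := by
    by_contra! hlt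
    rw [← lt_div_iff₀ hr] at hlt
    have h1 := area_inter_lt_threshold hn l hlt
    have h2 : polygonCopy n c r \ regularPolygon n ⊆ (fun z => c + r • z) ''
        (regularPolygon n ∩ {z | (inradius n - nrm n l c) / r < nrm n l z}) := by
      rintro _ ⟨⟨x, hx, rfl⟩, hxK⟩
      refine ⟨x, ⟨hx, ?_⟩, rfl⟩
      rw [Set.mem_ofPred_eq, div_lt_iff₀ hr]
      by_contra! hle
      refine hxK (hl _ ⟨x, hx, rfl⟩ ?_)
      rw [map_add, map_smul, smul_eq_mul]
      linarith
    have h3 := area_mono h2 (((measure_mono (Set.image_mono Set.inter_subset_left)).trans_lt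
      (isCompact_polygonCopy hn c r).measure_lt_top).ne)
    rw [area_homothety] at h3
    nlinarith [pow_pos hr 2]
  -- Polygon and copy have parallel sides, so `add_mem_of_nrm_le` applies to moves towards side `l`
  -- after rescaling.
  have hcap : ∀ x ∈ polygonCopy n c r, ∀ s t : ℝ, 0 ≤ s → 0 ≤ t →
      nrm n l (x + (s • vtx n l + t • vtx n (l + 1))) ≤ inradius n →
      x + (s • vtx n l + t • vtx n (l + 1)) ∈ polygonCopy n c r := by
    rintro _ ⟨x, hx, rfl⟩ s t hs ht h
    have e : (s • vtx n l + t • vtx n (l + 1)) =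
        r • ((s / r) • vtx n l + (t / r) • vtx n (l + 1)) := by
      rw [smul_add, smul_smul, smul_smul, mul_div_cancel₀ _ hr.ne', mul_div_cancel₀ _ hr.ne']
    have e2 : c + r • x + (s • vtx n l + t • vtx n (l + 1)) =
        c + r • (x + ((s / r) • vtx n l + (t / r) • vtx n (l + 1))) := by
      rw [e, add_assoc, ← smul_add]
    simp only [e2] at h ⊢
    refine ⟨_, add_mem_of_nrm_le hn hx (by positivity) (by positivity) ?_, rfl⟩
    rw [map_add (nrm n l) c, map_smul, smul_eq_mul] at h
    have := (le_div_iff₀ hr).2 (show nrm n l (x + ((s / r) • vtx n l + (t / r) •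
      vtx n (l + 1))) * r ≤ inradius n - nrm n l c by linarith)
    exact this.trans ((div_le_iff₀ hr).2 hheight)
  obtain ⟨ξ, η, hξη⟩ := exists_basis hn z l
  have hsum : ξ + η ≤ 1 := by
    have := nrm_le_of_mem hn hzK l
    rw [hξη, map_add, map_smul, map_smul, nrm_vtx_self, nrm_vtx_succ, smul_eq_mul,
      smul_eq_mul] at this
    nlinarith
  -- A move within the cone from `z` to the line of side `l` ends in the copy and in the polygon,
  -- hence on the side, but not at a corner. The moves parallel to one corner vector then give `η >
  -- 0` and `ξ > 0`.
  have hside : ∀ s t : ℝ, 0 ≤ s → 0 ≤ t → ξ + s + (η + t) = 1 → 0 < ξ + s ∧ 0 < η + t := by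
    intro s t hs ht hst
    have e : z + (s • vtx n l + t • vtx n (l + 1)) =
        (1 - (η + t)) • vtx n l + (η + t) • vtx n (l + 1) := by
      rw [hξη, ← hst]
      module
    have hnrm : nrm n l (z + (s • vtx n l + t • vtx n (l + 1))) = inradius n := by
      rw [e, map_add, map_smul, map_smul, nrm_vtx_self, nrm_vtx_succ, smul_eq_mul, smul_eq_mul]
      ring
    have hmem := hcap z hzS s t hs ht hnrm.le
    obtain ⟨q, hq0, hq1, hq⟩ := exists_of_nrm_eq hn (hl _ hmem hnrm.le) hnrm
    have hqe : q = η + t := by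
      rw [e] at hq
      have h3 := congrArg (nrm n (l + 1)) hq
      simp only [map_add, map_smul, smul_eq_mul] at h3
      have e1 : nrm n (l + 1) (vtx n l) = circumradius n * Real.cos (3 * (Real.pi / n)) := by
        rw [nrm_vtx, ← Real.cos_neg]; congr 2; push_cast; ring
      rw [nrm_vtx_self, e1, inradius] at h3
      have h4 : (q - (η + t)) * (circumradius n * (Real.cos (Real.pi / n) -
        Real.cos (3 * (Real.pi / n)))) = 0 := by linear_combination -h3
      rcases mul_eq_zero.1 h4 with h | h
      · linarith
      · have := mul_pos (circumradius_pos hn) (sub_pos.2 (cos_three_angle_lt hn))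
        linarith
    rw [hq] at hmem
    have hq0' : q ≠ 0 := by
      rintro rfl; exact hv l (by simpa using hmem)
    have hq1' : q ≠ 1 := by
      rintro rfl; exact hv (l + 1) (by simpa using hmem)
    have := lt_of_le_of_ne hq0 hq0'.symm
    have := lt_of_le_of_ne hq1 hq1'
    constructor <;> linarith
  have hη : 0 < η := by
    have := (hside (1 - ξ - η) 0 (by linarith) le_rfl (by ring)).2
    linarith
  have hξ : 0 < ξ := by
    have := (hside 0 (1 - ξ - η) le_rfl (by linarith) (by ring)).1
    linarith
  rw [segment_eq_image ℝ 0 p] at hz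
  obtain ⟨τ, ⟨hτ0, hτ1⟩, hτ⟩ := hz
  simp only [smul_zero, zero_add] at hτ
  have hτ0 : 0 < τ := by
    refine lt_of_le_of_ne hτ0 ?_
    rintro rfl
    rw [zero_smul] at hτ
    have := congrArg (nrm n l) (hτ.trans hξη)
    rw [map_zero, map_add, map_smul, map_smul, nrm_vtx_self, nrm_vtx_succ, smul_eq_mul,
      smul_eq_mul] at this
    nlinarith [mul_pos hξ hρ, mul_pos hη hρ]
  -- As `z` lies in the open cone, `p - z`, a nonnegative multiple of `z`, is an admissible move.
  have hpz : p = z + (((1 / τ - 1) * ξ) • vtx n l + ((1 / τ - 1) * η) • vtx n (l + 1)) := by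
    rw [mul_smul, mul_smul, ← smul_add, ← hξη, ← hτ, smul_smul, ← add_smul]
    have : τ + (1 / τ - 1) * τ = 1 := by field_simp; ring
    rw [this, one_smul]
  have h1τ : 0 ≤ 1 / τ - 1 := by rw [sub_nonneg, le_div_iff₀ hτ0]; linarith
  rw [hpz]
  refine hcap z hzS _ _ (by positivity) (by positivity) ?_
  rw [← hpz]
  exact nrm_le_of_mem hn hp l

theorem norm_le_circumradius (hn : 3 ≤ n) {z : ℂ} (hz : z ∈ regularPolygon n) :
    ‖z‖ ≤ circumradius n := by
  have : regularPolygon n ⊆ Metric.closedBall 0 (circumradius n) := by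
    rw [regularPolygon_eq hn]
    refine convexHull_min ?_ (convex_closedBall _ _)
    rintro _ ⟨k, rfl⟩
    rw [mem_closedBall_zero_iff, vtx, norm_smul, norm_unitVec, mul_one, Real.norm_of_nonneg
      (circumradius_pos hn).le]
  simpa using this hz

/-! ### Shapes through a point and the number of crossing edges -/

theorem measurableSet_polygonCopy (hn : 3 ≤ n) (c : ℂ) (r : ℝ) :
    MeasurableSet (polygonCopy n c r) :=
  (isCompact_polygonCopy hn c r).measurableSet

theorem volume_polygonCopy_ne_top (hn : 3 ≤ n) (c : ℂ) (r : ℝ) :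
    volume (polygonCopy n c r) ≠ ⊤ :=
  (isCompact_polygonCopy hn c r).measure_lt_top.ne

theorem homothety_surjective (c : ℂ) {r : ℝ} (hr : r ≠ 0) :
    Function.Surjective fun z : ℂ => c + r • z :=
  fun z => ⟨r⁻¹ • (z - c), by simp only [smul_inv_smul₀ hr]; ring⟩

theorem area_preimage_homothety (c : ℂ) {r : ℝ} (hr : r ≠ 0) (A : Set ℂ) :
    r ^ 2 * area ((fun z => c + r • z) ⁻¹' A) = area A := by
  rw [← area_homothety c, Set.image_preimage_eq _ (homothety_surjective c hr)]

/-- Source of the bound eleven. The ratio is `1 + 1 / cos (π / n)`: it is `3` for the triangle,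
whose threshold is `1`, and at most `1 + √2` for `n ≥ 4`, where the threshold is at least `1 / 2`.
-/
theorem sq_ratio_lt (hn : 3 ≤ n) :
    ((inradius n + circumradius n) / inradius n) ^ 2 < 12 * threshold n := by
  have hR := circumradius_pos hn
  have hc := cos_angle_pos hn
  have e : (inradius n + circumradius n) / inradius n = 1 + (Real.cos (Real.pi / n))⁻¹ := by
    rw [inradius]; field_simp
  rw [e]
  rcases hn.eq_or_lt with h | h
  · subst h
    rw [threshold_eq_one le_rfl (by norm_num), show ((3 : ℕ) : ℝ) = 3 by norm_num,
      Real.cos_pi_div_three]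
    norm_num
  · have h1 : Real.sqrt 2 / 2 ≤ Real.cos (Real.pi / n) := by
      rw [← Real.cos_pi_div_four]
      have : (4 : ℝ) ≤ n := by exact_mod_cast h
      exact Real.cos_le_cos_of_nonneg_of_le_pi (angle_pos hn).le (by linarith [Real.pi_pos])
        (by gcongr)
    have h2 : (Real.cos (Real.pi / n))⁻¹ ≤ Real.sqrt 2 := by
      rw [inv_le_iff_one_le_mul₀ hc]
      have := Real.sq_sqrt (show (0 : ℝ) ≤ 2 by norm_num)
      nlinarith [Real.sqrt_nonneg 2]
    have h3 := half_le_threshold hn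
    have h4 : Real.sqrt 2 < 1.42 := by
      rw [Real.sqrt_lt' (by norm_num)]; norm_num
    have h5 := inv_pos.2 hc
    nlinarith

/-- A point is contained in at most eleven shapes of a sufficiently free collection. -/
theorem card_le_of_forall_mem (hn : 3 ≤ n) {V : Type} [Finite V] (C : PolygonFamily V) {α : ℝ}
    (hα : threshold n ≤ α) (hC : C.IsFree n α) (y : ℂ) (I : Finset V)
    (hI : ∀ i ∈ I, y ∈ C.shape n i) : I.card ≤ 11 := by
  have hρ := inradius_pos hn
  have hR := circumradius_pos hn
  set F : V → Set ℂ := fun i => C.shape n i \ ⋃ j ∈ {j | j ≠ i}, C.shape n j with hF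
  -- The uncovered part of each shape is rescaled about `y`, as if all shapes had scale `1`. These
  -- regions lie in `B`, have area at least `α` and are disjoint.
  set N : V → Set ℂ := fun i => (fun z => y + C.scale i • z) ⁻¹' F i with hN
  set B := polygonCopy n 0 ((inradius n + circumradius n) / inradius n) with hB
  have hmem : ∀ i ∈ I, ∀ x ∈ N i, y + C.scale i • x ∈ C.shape n i := fun i _ x hx => hx.1
  have hsub : ∀ i ∈ I, N i ⊆ B := by
    intro i hi x hx
    have hs := C.scale_pos i
    rw [hB, mem_polygonCopy hn (by positivity)]
    intro j
    rw [div_mul_cancel₀ _ hρ.ne', sub_zero]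
    have h1 := (mem_polygonCopy hn hs).1 (hmem i hi x hx) j
    obtain ⟨k, hk, hky⟩ := hI i hi
    simp only at hky
    have h2 : -nrm n j k ≤ circumradius n := by
      rw [← map_neg]
      exact (dot_le_norm _ _).trans (by rw [norm_neg]; exact norm_le_circumradius hn hk)
    rw [show y + C.scale i • x - C.center i = C.scale i • (k + x) by
      rw [← hky, smul_add]; ring, map_smul, map_add, smul_eq_mul] at h1
    have := le_of_mul_le_mul_left h1 hs
    linarith
  have hmeas : ∀ i, MeasurableSet (N i) := by
    intro i
    have hf : Measurable fun z : ℂ => y + C.scale i • z := by fun_prop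
    refine hf ?_
    refine (measurableSet_polygonCopy hn _ _).diff ?_
    exact MeasurableSet.biUnion (Set.to_countable _) fun j _ => measurableSet_polygonCopy hn _ _
  -- If `x` were in both regions, the point `y + C.scale i • x` would lie between `y` and a point of
  -- the larger shape, hence in that shape, although it is uncovered.
  have hdisj' : ∀ i ∈ I, ∀ j ∈ I, i ≠ j → C.scale i ≤ C.scale j → Disjoint (N i) (N j) := by
    intro i hi j hj hij hle
    rw [Set.disjoint_left]
    intro x hx hx'
    refine hx.2 (Set.mem_biUnion (x := j) hij.symm ?_)
    have hsj := C.scale_pos j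
    have hsi := C.scale_pos i
    have hconv : Convex ℝ (C.shape n j) := convex_polygonCopy n _ _
    have := hconv (hI j hj) (hmem j hj x hx')
      (a := 1 - C.scale i / C.scale j) (b := C.scale i / C.scale j)
      (sub_nonneg.2 ((div_le_one hsj).2 hle)) (by positivity) (by ring)
    convert this using 1
    rw [smul_add, smul_smul, div_mul_cancel₀ _ hsj.ne', ← add_assoc, ← add_smul]
    simp
  have hdisj : Set.PairwiseDisjoint (I : Set V) N := by
    intro i hi j hj hij
    rcases le_total (C.scale i) (C.scale j) with h | h
    · exact hdisj' i hi j hj hij h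
    · exact (hdisj' j hj i hi hij.symm h).symm
  have hsum : ∑ i ∈ I, area (N i) ≤ area B := by
    have hBfin : volume B ≠ ⊤ := volume_polygonCopy_ne_top hn _ _
    have h := measure_biUnion_finset (μ := volume) hdisj fun i _ => hmeas i
    have h2 : volume (⋃ i ∈ I, N i) ≤ volume B := measure_mono (Set.iUnion₂_subset hsub)
    rw [h] at h2
    have h3 : ∀ i ∈ I, volume (N i) ≠ ⊤ := fun i hi =>
      ((measure_mono (hsub i hi)).trans_lt hBfin.lt_top).ne
    simp only [area]
    rw [← ENNReal.toReal_sum h3]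
    exact ENNReal.toReal_mono hBfin h2
  have hge : ∀ i ∈ I, α ≤ area (N i) := by
    intro i _
    have h := hC i
    have hs := C.scale_pos i
    have h2 := area_preimage_homothety y hs.ne' (F i)
    change α * area (C.shape n i) ≤ area (F i) at h
    rw [← h2, PolygonFamily.shape, area_polygonCopy hn, mul_comm] at h
    exact le_of_mul_le_mul_left h (pow_pos hs 2)
  have hlow : (I.card : ℝ) * α ≤ area B := by
    refine le_trans ?_ hsum
    rw [← nsmul_eq_mul]
    exact Finset.card_nsmul_le_sum I _ _ hge
  rw [hB, area_polygonCopy hn] at hlow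
  have h12 := sq_ratio_lt hn
  have hth := half_le_threshold hn
  by_contra! hcard
  have : (12 : ℝ) ≤ I.card := by exact_mod_cast hcard
  nlinarith

theorem mem_polygonCopy_homothety (hn : 3 ≤ n) {c c' x : ℂ} {r r' : ℝ} (hr : 0 < r)
    (hr' : 0 < r') :
    c + r • x ∈ polygonCopy n c' r' ↔ x ∈ polygonCopy n (r⁻¹ • (c' - c)) (r' / r) := by
  rw [mem_polygonCopy hn hr', mem_polygonCopy hn (by positivity)]
  refine forall_congr' fun j => ?_
  have : c + r • x - c' = r • (x - r⁻¹ • (c' - c)) := by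
    rw [smul_sub, smul_inv_smul₀ hr.ne']; ring
  rw [this, map_smul, smul_eq_mul, div_mul_eq_mul_div, le_div_iff₀ hr, mul_comm]

/-- In a sufficiently free collection, a shape meeting the segment from the centre of another
shape to a point `p` of that shape contains `p` or a corner of that shape. -/
theorem mem_or_corner_mem (hn : 3 ≤ n) {V : Type} (C : PolygonFamily V) {α : ℝ}
    (hα : threshold n ≤ α) (hC : C.IsFree n α) {u w : V} (huw : w ≠ u) {p z : ℂ}
    (hp : p ∈ C.shape n u) (hz : z ∈ segment ℝ (C.center u) p) (hzw : z ∈ C.shape n w) :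
    p ∈ C.shape n w ∨ ∃ j < n, C.center u + C.scale u • corner n j ∈ C.shape n w := by
  have hu := C.scale_pos u
  have hw := C.scale_pos w
  rw [or_iff_not_imp_right]
  intro hcor
  obtain ⟨p, hpK, rfl⟩ := hp
  have hz' : ∃ z' ∈ segment ℝ 0 p, z = C.center u + C.scale u • z' := by
    obtain ⟨a, b, ha, hb, hab, rfl⟩ := hz
    refine ⟨a • 0 + b • p, ⟨a, b, ha, hb, hab, rfl⟩, ?_⟩
    obtain rfl : a = 1 - b := by linarith
    module
  obtain ⟨z, hzp, rfl⟩ := hz'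
  refine (mem_polygonCopy_homothety hn hu hw).2 (end_mem_of_free hn (by positivity) ?_ ?_ hpK hzp
    ((mem_polygonCopy_homothety hn hu hw).1 hzw))
  · intro k hk
    obtain ⟨j, hj, hkj⟩ := exists_nat_vtx hn k
    rw [hkj] at hk
    exact hcor ⟨j, hj, (mem_polygonCopy_homothety hn hu hw).2 hk⟩
  · have h1 := hC w
    have h2 : area (C.shape n w \ ⋃ j ∈ {j | j ≠ w}, C.shape n j) ≤
        area (C.shape n w \ C.shape n u) := by
      refine area_mono (Set.sdiff_subset_sdiff_right fun x hx => Set.mem_biUnion huw.symm hx) ?_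
      exact ((measure_mono Set.sdiff_subset).trans_lt
        (volume_polygonCopy_ne_top hn _ _).lt_top).ne
    rw [← area_preimage_homothety (C.center u) hu.ne' (C.shape n w \ C.shape n u),
      PolygonFamily.shape] at h2
    rw [PolygonFamily.shape, area_polygonCopy hn] at h1
    have h3 : (fun z => C.center u + C.scale u • z) ⁻¹' (polygonCopy n (C.center w) (C.scale w) \
        C.shape n u) = polygonCopy n ((C.scale u)⁻¹ • (C.center w - C.center u))
        (C.scale w / C.scale u) \ regularPolygon n := by
      ext x
      rw [Set.mem_preimage, Set.mem_sdiff, Set.mem_sdiff, mem_polygonCopy_homothety hn hu hw]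
      refine and_congr_right fun _ => not_congr ?_
      constructor
      · rintro ⟨y, hy, hyx⟩
        have : y = x := by
          have := add_left_cancel hyx
          exact smul_right_injective ℂ hu.ne' this
        rwa [← this]
      · exact fun h => ⟨x, h, rfl⟩
    rw [h3] at h2
    have h4 := h1.trans h2
    rw [div_pow, ← mul_div_assoc, div_le_iff₀ (by positivity)]
    nlinarith [mul_le_mul_of_nonneg_right hα (pow_pos hw 2).le]

/-- Each edge of `M` has an endpoint in `W`: the vertices `u`, `v` and those whose shapes contain
`p` or a corner of `S_u` or `S_v`. Independence makes a choice of such endpoints injective, and `W`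
has at most `2 + 11 + 22n` elements. -/
theorem card_le_of_meets (hn : 3 ≤ n) {V : Type} [Finite V] (C : PolygonFamily V) {α : ℝ}
    (hα : threshold n ≤ α) (hC : C.IsFree n α) {u v : V} {p : ℂ} (hpu : p ∈ C.shape n u)
    (hpv : p ∈ C.shape n v) (M : Finset (Sym2 V))
    (hind : ∀ f ∈ M, ∀ g ∈ M, f ≠ g → ∀ w, ¬ (w ∈ f ∧ w ∈ g))
    (hM : ∀ f ∈ M, ∃ w ∈ f, ∃ z ∈ segment ℝ (C.center u) p ∪ segment ℝ (C.center v) p,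
      z ∈ C.shape n w) : M.card ≤ 26 * (n + 1) := by
  classical
  have := Fintype.ofFinite V
  set I : ℂ → Finset V := fun y => Finset.univ.filter fun w => y ∈ C.shape n w with hI
  have hIc : ∀ y, (I y).card ≤ 11 := fun y =>
    card_le_of_forall_mem hn C hα hC y (I y) fun i hi => (Finset.mem_filter.1 hi).2
  have hmemI : ∀ {y w}, y ∈ C.shape n w → w ∈ I y := fun h =>
    Finset.mem_filter.2 ⟨Finset.mem_univ _, h⟩
  set U : V → Finset V := fun x =>
    (Finset.range n).biUnion fun j => I (C.center x + C.scale x • corner n j) with hU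
  have hUc : ∀ x, (U x).card ≤ n * 11 := fun x => by
    have := Finset.card_biUnion_le_card_mul (Finset.range n)
      (fun j => I (C.center x + C.scale x • corner n j)) 11 fun j _ => hIc _
    rwa [Finset.card_range] at this
  set W : Finset V := ({u, v} ∪ I p) ∪ (U u ∪ U v) with hW
  have hWc : W.card ≤ 26 * (n + 1) := by
    have h1 := Finset.card_union_le ({u, v} ∪ I p) (U u ∪ U v)
    have h2 := Finset.card_union_le {u, v} (I p)
    have h3 := Finset.card_union_le (U u) (U v)
    have h4 : ({u, v} : Finset V).card ≤ 2 := Finset.card_le_two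
    have := hIc p
    have := hUc u
    have := hUc v
    rw [hW]
    omega
  have key : ∀ f ∈ M, ∃ w ∈ f, w ∈ W := by
    intro f hf
    obtain ⟨w, hwf, z, hz, hzw⟩ := hM f hf
    refine ⟨w, hwf, ?_⟩
    by_cases hwu : w = u
    · simp [hW, hwu]
    by_cases hwv : w = v
    · simp [hW, hwv]
    rcases hz with hz | hz
    · rcases mem_or_corner_mem hn C hα hC hwu hpu hz hzw with h | ⟨j, hj, h⟩
      · exact Finset.mem_union_left _ (Finset.mem_union_right _ (hmemI h))
      · exact Finset.mem_union_right _ (Finset.mem_union_left _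
          (Finset.mem_biUnion.2 ⟨j, Finset.mem_range.2 hj, hmemI h⟩))
    · rcases mem_or_corner_mem hn C hα hC hwv hpv hz hzw with h | ⟨j, hj, h⟩
      · exact Finset.mem_union_left _ (Finset.mem_union_right _ (hmemI h))
      · exact Finset.mem_union_right _ (Finset.mem_union_right _
          (Finset.mem_biUnion.2 ⟨j, Finset.mem_range.2 hj, hmemI h⟩))
  have : Nonempty V := ⟨u⟩
  choose! g hgf hgW using key
  refine (Finset.card_le_card_of_injOn g hgW ?_).trans hWc
  intro f hf f' hf' hgg
  by_contra hne
  exact hind f hf f' hf' hne (g f) ⟨hgf f hf, by rw [hgg]; exact hgf f' hf'⟩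

/-! ### The upper bound, by passing to the limit -/

theorem exists_near_mem_segment {a b a' b' z : ℂ} {ε : ℝ} (hz : z ∈ segment ℝ a b)
    (ha : dist a a' ≤ ε) (hb : dist b b' ≤ ε) : ∃ z' ∈ segment ℝ a' b', dist z z' ≤ ε := by
  obtain ⟨s, t, hs, ht, hst, rfl⟩ := hz
  refine ⟨s • a' + t • b', ⟨s, t, hs, ht, hst, rfl⟩, ?_⟩
  rw [dist_eq_norm] at *
  rw [show s • a + t • b - (s • a' + t • b') = s • (a - a') + t • (b - b') by module]
  refine (norm_add_le _ _).trans ?_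
  rw [norm_smul, norm_smul, Real.norm_of_nonneg hs, Real.norm_of_nonneg ht]
  have h1 := mul_le_mul_of_nonneg_left ha hs
  have h2 := mul_le_mul_of_nonneg_left hb ht
  have h3 : s * ε + t * ε = ε := by rw [← add_mul, hst, one_mul]
  linarith

theorem contactPoint_mem (hn : 3 ≤ n) {V : Type} {C : PolygonFamily V} {ε : ℝ} {u v : V} {p : ℂ}
    (h : C.IsContactPoint n ε u v p) : p ∈ C.shape n u ∧ p ∈ C.shape n v := by
  obtain ⟨a, b, ha, hau, hb, hbv, -, -, -, -, h⟩ := h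
  have hp : p ∈ polygonCopy n (C.center u) a ∩ polygonCopy n (C.center v) b := by
    rcases h with h | h
    · exact h.2
    · rw [h.2]; rfl
  exact ⟨polygonCopy_mono hn ha hau hp.1, polygonCopy_mono hn hb hbv hp.2⟩

theorem isCompact_segment (a b : ℂ) : IsCompact (segment ℝ a b) := by
  rw [segment_eq_image]
  exact isCompact_Icc.image (by fun_prop)

/-- There are finitely many pairs `(e, M)`, so `ε` may depend on the pair. A pair failing for
arbitrarily small `ε` gives a sequence of drawings whose contact points converge, along a
subsequence, to some `q` in `S_u ∩ S_v`. The count is then applied to the limit spokes. -/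
theorem canonicalDrawingsIndependentCrossing_of_threshold_le (hn : 3 ≤ n) {α : ℝ}
    (hα : threshold n ≤ α) : CanonicalDrawingsIndependentCrossing n α (26 * (n + 1)) := by
  intro V _ C hC
  suffices h : ∀ (e : Sym2 V) (M : Finset (Sym2 V)), ∀ᶠ ε in 𝓝[>] (0 : ℝ),
      ∀ D : OneBendDrawing V, C.IsCanonicalDrawing n ε D → e ∈ (C.intersectionGraph n).edgeSet →
      D.IsIndependentCrossingSet (C.intersectionGraph n) e M → M.card ≤ 26 * (n + 1) by
    have h2 := eventually_all.2 fun e => eventually_all.2 fun M => h e M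
    filter_upwards [h2] with ε hε D hD e he M hM
    exact hε e M D hD he hM
  intro e M
  by_contra hcon
  rw [not_eventually] at hcon
  obtain ⟨ε, hε, hbad⟩ := exists_seq_forall_of_frequently hcon
  push Not at hbad
  choose D hD he hM hcard using hbad
  induction e using Sym2.inductionOn with
  | _ u v =>
  have hε0 : Tendsto ε atTop (𝓝 0) := tendsto_nhds_of_tendsto_nhdsWithin hε
  choose hpos _ p hp _ using hD
  have hadj : (C.intersectionGraph n).Adj u v := he 0
  have hpS : ∀ i, p i s(u, v) ∈ C.shape n u ∩ C.shape n v := fun i =>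
    contactPoint_mem hn (hp i u v hadj).1
  have hcomp : IsCompact (C.shape n u ∩ C.shape n v) :=
    (isCompact_polygonCopy hn _ _).inter (isCompact_polygonCopy hn _ _)
  obtain ⟨q, hq, φ, hφ, hlim⟩ := hcomp.tendsto_subseq hpS
  refine (hcard 0).not_ge (card_le_of_meets hn C hα hC hq.1 hq.2 M (hM 0).2 ?_)
  intro f hf
  by_contra! hno
  -- If no endpoint of `f` had a shape meeting the limit spokes `X`, then `X` and the union `Y` of
  -- these shapes would have positive distance; but a crossing point `ζ` is close to both.
  set X := segment ℝ (C.center u) q ∪ segment ℝ (C.center v) q with hX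
  set Y := ⋃ w ∈ {w | w ∈ f}, C.shape n w with hY
  have hXc : IsCompact X := (isCompact_segment _ _).union (isCompact_segment _ _)
  have hYc : IsClosed Y := Set.Finite.isClosed_biUnion (Set.toFinite _) fun w _ =>
    (isCompact_polygonCopy hn _ _).isClosed
  have hXY : Disjoint X Y := by
    rw [Set.disjoint_left]
    intro z hz hzY
    obtain ⟨w, hw, hzw⟩ := Set.mem_iUnion₂.1 hzY
    exact hno w hw z hz hzw
  obtain ⟨δ, hδ, hdist⟩ := Metric.exists_pos_forall_lt_edist hXc hYc hXY
  have hsmall : ∀ᶠ i in atTop, ε (φ i) + ε (φ i) + dist (p (φ i) s(u, v)) q < δ := by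
    have h1 := hε0.comp hφ.tendsto_atTop
    have h2 := (h1.add h1).add (tendsto_iff_dist_tendsto_zero.1 hlim)
    rw [add_zero, add_zero] at h2
    exact h2.eventually (gt_mem_nhds (by exact_mod_cast hδ))
  obtain ⟨i, hi⟩ := hsmall.exists
  set j := φ i with hj
  obtain ⟨hfG, -, ζ, ⟨⟨v', hv', hζ⟩, w', hw', hζ'⟩, -⟩ := (hM j).1 f hf
  have hclose : ∀ w, dist ((D j).pos w) (C.center w) ≤ ε j := fun w =>
    (Metric.mem_ball.1 (hpos j w)).le
  obtain ⟨z₁, hz₁, hd₁⟩ := exists_near_mem_segment hζ (hclose v')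
    (Metric.mem_ball.1 (hp j u v hadj).2).le
  obtain ⟨z₂, hz₂, hd₂⟩ := exists_near_mem_segment (b' := q) hz₁
    ((dist_self _).le.trans dist_nonneg) le_rfl
  have hz₂X : z₂ ∈ X := by
    rcases Sym2.mem_iff.1 hv' with rfl | rfl
    · exact Or.inl hz₂
    · exact Or.inr hz₂
  have hz₃ : ∃ z₃ ∈ C.shape n w', dist ζ z₃ ≤ ε j := by
    obtain ⟨x, rfl⟩ := hw'
    obtain ⟨hc, hb⟩ := hp j w' x hfG
    obtain ⟨z₃, h3, hd⟩ := exists_near_mem_segment hζ' (hclose w') (Metric.mem_ball.1 hb).le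
    exact ⟨z₃, (convex_polygonCopy n _ _).segment_subset (center_mem hn _ _)
      (contactPoint_mem hn hc).1 h3, hd⟩
  obtain ⟨z₃, hz₃, hd₃⟩ := hz₃
  have hlt := hdist z₂ hz₂X z₃ (Set.mem_biUnion hw' hz₃)
  rw [edist_dist, ← ENNReal.ofReal_coe_nnreal, ENNReal.ofReal_lt_ofReal_iff_of_nonneg
    δ.coe_nonneg] at hlt
  have t1 := dist_triangle z₂ z₁ z₃
  have t2 := dist_triangle z₁ ζ z₃
  rw [dist_comm z₂ z₁] at t1
  rw [dist_comm z₁ ζ] at t2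
  linarith

/-! ### General position and stability of crossings -/

theorem volume_line (x y : ℂ) : volume (affineSpan ℝ {x, y} : Set ℂ) = 0 := by
  refine Measure.addHaar_affineSubspace _ _ fun h => ?_
  have h1 : Module.finrank ℝ (vectorSpan ℝ {x, y}) ≤ 1 :=
    collinear_iff_finrank_le_one.1 (collinear_pair ℝ x y)
  rw [← direction_affineSpan, h, AffineSubspace.direction_top, finrank_top,
    Complex.finrank_real_complex] at h1
  norm_num at h1

/-- The points are placed one at a time: a ball has positive area, while the lines through points
already placed form a null set. -/
theorem exists_generalPosition {ι : Type*} [Finite ι] (c : ι → ℂ) {ε : ℝ} (hε : 0 < ε) :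
    ∃ q : ι → ℂ, (∀ i, q i ∈ Metric.ball (c i) ε) ∧ Function.Injective q ∧
      ∀ i j k, i ≠ j → i ≠ k → j ≠ k → ¬ Collinear ℝ {q i, q j, q k} := by
  classical
  have := Fintype.ofFinite ι
  suffices h : ∀ s : Finset ι, ∃ q : ι → ℂ, (∀ i, q i ∈ Metric.ball (c i) ε) ∧
      (∀ i ∈ s, ∀ j ∈ s, i ≠ j → q i ≠ q j) ∧
      ∀ i ∈ s, ∀ j ∈ s, ∀ k ∈ s, i ≠ j → i ≠ k → j ≠ k → ¬ Collinear ℝ {q i, q j, q k} by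
    obtain ⟨q, h1, h2, h3⟩ := h Finset.univ
    exact ⟨q, h1, fun i j hij => by_contra fun hne => h2 i (Finset.mem_univ _) j
      (Finset.mem_univ _) hne hij, fun i j k => h3 i (Finset.mem_univ _) j (Finset.mem_univ _) k
      (Finset.mem_univ _)⟩
  intro s
  induction s using Finset.induction_on with
  | empty => exact ⟨c, fun i => Metric.mem_ball_self hε, by simp, by simp⟩
  | insert a s ha ih =>
    obtain ⟨q, h1, h2, h3⟩ := ih
    have hnull : volume (⋃ i ∈ s, ⋃ j ∈ s, (affineSpan ℝ {q i, q j} : Set ℂ)) = 0 := by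
      refine (measure_biUnion_null_iff s.countable_toSet).2 fun i _ => ?_
      exact (measure_biUnion_null_iff s.countable_toSet).2 fun j _ => volume_line _ _
    obtain ⟨x, hx, hxn⟩ : ∃ x ∈ Metric.ball (c a) ε,
        x ∉ ⋃ i ∈ s, ⋃ j ∈ s, (affineSpan ℝ {q i, q j} : Set ℂ) := by
      by_contra! hcon
      have hpos := Metric.measure_ball_pos volume (c a) hε
      exact hpos.ne' (measure_mono_null hcon hnull)
    have hx' : ∀ i ∈ s, ∀ j ∈ s, x ∉ affineSpan ℝ {q i, q j} := by
      intro i hi j hj hmem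
      exact hxn (Set.mem_biUnion hi (Set.mem_biUnion hj hmem))
    have hqa : Function.update q a x a = x := Function.update_self ..
    have hqs : ∀ i ∈ s, Function.update q a x i = q i := fun i hi =>
      Function.update_of_ne (by rintro rfl; exact ha hi) ..
    -- The degenerate pairs with `i = j`, whose span is a single point, keep `x` away from the
    -- points already placed.
    have hne : ∀ i ∈ s, q i ≠ x := by
      rintro i hi rfl
      exact hx' i hi i hi (mem_affineSpan ℝ (by simp))
    have hcol : ∀ i ∈ s, ∀ j ∈ s, i ≠ j → ∀ t : Set ℂ, q i ∈ t → q j ∈ t → x ∈ t →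
        ¬ Collinear ℝ t := by
      intro i hi j hj hij t hit hjt hxt hc
      exact hx' i hi j hj (hc.mem_affineSpan_of_mem_of_ne hit hjt hxt (h2 i hi j hj hij))
    refine ⟨Function.update q a x, ?_, ?_, ?_⟩
    · intro i
      by_cases hi : i = a
      · subst hi; rwa [hqa]
      · rw [Function.update_of_ne hi]; exact h1 i
    · intro i hi j hj hij
      rcases Finset.mem_insert.1 hi with rfl | hi'
      · have hj := Finset.mem_of_mem_insert_of_ne hj hij.symm
        rw [hqa, hqs j hj]
        exact (hne j hj).symm
      rcases Finset.mem_insert.1 hj with rfl | hj'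
      · rw [hqa, hqs i hi']
        exact hne i hi'
      · rw [hqs i hi', hqs j hj']
        exact h2 i hi' j hj' hij
    · intro i hi j hj k hk hij hik hjk
      rcases Finset.mem_insert.1 hi with rfl | hi'
      · have hj := Finset.mem_of_mem_insert_of_ne hj hij.symm
        have hk := Finset.mem_of_mem_insert_of_ne hk hik.symm
        rw [hqa, hqs j hj, hqs k hk]
        exact hcol j hj k hk hjk _ (by simp) (by simp) (by simp)
      rcases Finset.mem_insert.1 hj with rfl | hj'
      · have hk := Finset.mem_of_mem_insert_of_ne hk hjk.symm
        rw [hqa, hqs i hi', hqs k hk]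
        exact hcol i hi' k hk hik _ (by simp) (by simp) (by simp)
      rcases Finset.mem_insert.1 hk with rfl | hk'
      · rw [hqa, hqs i hi', hqs j hj']
        exact hcol i hi' j hj' hij _ (by simp) (by simp) (by simp)
      · rw [hqs i hi', hqs j hj', hqs k hk']
        exact h3 i hi' j hj' k hk' hij hik hjk

/-- Twice the signed area of the triangle `a b c`. -/
noncomputable def orient (a b c : ℂ) : ℝ :=
  (b - a).re * (c - a).im - (b - a).im * (c - a).re

theorem orient_eq (x : ℝ) (a b c : ℂ) :
    orient a b c = dot x (b - a) * dot (x + Real.pi / 2) (c - a) -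
      dot (x + Real.pi / 2) (b - a) * dot x (c - a) := by
  rw [orient, dot_add_pi_div_two, dot_add_pi_div_two, dot_apply, dot_apply]
  linear_combination (-((b - a).re * (c - a).im - (b - a).im * (c - a).re)) *
    Real.sin_sq_add_cos_sq x

/-- By Cramer's rule the orientations themselves are, up to the common factor `1 / d`, the weights
of the intersection point on both segments. -/
theorem segment_inter_nonempty {U B W Z : ℂ} (h1 : 0 ≤ orient U B W) (h2 : orient U B Z ≤ 0)
    (h3 : orient W Z U < 0) (h4 : 0 < orient W Z B) :
    (segment ℝ U B ∩ segment ℝ W Z).Nonempty := by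
  have he : orient U B W - orient U B Z = orient W Z B - orient W Z U := by
    simp only [orient, Complex.sub_re, Complex.sub_im]; ring
  have hd : 0 < orient W Z B - orient W Z U := by linarith
  set d := orient W Z B - orient W Z U with hd'
  have hc : (orient W Z B / d) • U + (-orient W Z U / d) • B =
      (-orient U B Z / d) • W + (orient U B W / d) • Z := by
    have : d • ((orient W Z B / d) • U + (-orient W Z U / d) • B) =
        d • ((-orient U B Z / d) • W + (orient U B W / d) • Z) := by
      simp only [smul_add, smul_smul, mul_div_cancel₀ _ hd.ne']
      apply Complex.ext <;> simp only [orient, Complex.sub_re, Complex.sub_im, Complex.add_re,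
        Complex.add_im, Complex.smul_re, Complex.smul_im, smul_eq_mul] <;> ring
    exact smul_right_injective ℂ hd.ne' this
  refine ⟨(orient W Z B / d) • U + (-orient W Z U / d) • B, ⟨_, _, by positivity,
    div_nonneg (by linarith) hd.le, ?_, rfl⟩, ?_⟩
  · rw [← add_div, div_eq_one_iff_eq hd.ne']; rw [hd']; ring
  · rw [hc]
    refine ⟨_, _, div_nonneg (by linarith) hd.le, by positivity, ?_, rfl⟩
    rw [← add_div, div_eq_one_iff_eq hd.ne']; linarith

/-- If a polyline `W Z X` crosses the segment `U B` properly at its bend `Z`, then so does every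
small perturbation. -/
theorem exists_stable_crossing {U B W Z X : ℂ} (hW : 0 < orient U B W) (hX : orient U B X < 0)
    (h1 : orient W Z U < 0) (h2 : 0 < orient W Z B) (h3 : orient Z X U < 0)
    (h4 : 0 < orient Z X B) :
    ∃ η > 0, ∀ U' B' W' Z' X' : ℂ, dist U' U < η → dist B' B < η → dist W' W < η →
      dist Z' Z < η → dist X' X < η →
      (segment ℝ U' B' ∩ (segment ℝ W' Z' ∪ segment ℝ X' Z')).Nonempty := by
  have hcont : ∀ f g h : ℂ × ℂ × ℂ × ℂ × ℂ → ℂ, Continuous f → Continuous g → Continuous h →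
      Continuous fun q => orient (f q) (g q) (h q) := by
    intro f g h hf hg hh
    unfold orient
    exact ((Complex.continuous_re.comp (hg.sub hf)).mul
      (Complex.continuous_im.comp (hh.sub hf))).sub
      ((Complex.continuous_im.comp (hg.sub hf)).mul (Complex.continuous_re.comp (hh.sub hf)))
  have hU : Continuous fun q : ℂ × ℂ × ℂ × ℂ × ℂ => q.1 := by fun_prop
  have hB : Continuous fun q : ℂ × ℂ × ℂ × ℂ × ℂ => q.2.1 := by fun_prop
  have hWc : Continuous fun q : ℂ × ℂ × ℂ × ℂ × ℂ => q.2.2.1 := by fun_prop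
  have hZ : Continuous fun q : ℂ × ℂ × ℂ × ℂ × ℂ => q.2.2.2.1 := by fun_prop
  have hXc : Continuous fun q : ℂ × ℂ × ℂ × ℂ × ℂ => q.2.2.2.2 := by fun_prop
  have ev : ∀ᶠ q : ℂ × ℂ × ℂ × ℂ × ℂ in 𝓝 (U, B, W, Z, X), 0 < orient q.1 q.2.1 q.2.2.1 ∧
      orient q.1 q.2.1 q.2.2.2.2 < 0 ∧ orient q.2.2.1 q.2.2.2.1 q.1 < 0 ∧
      0 < orient q.2.2.1 q.2.2.2.1 q.2.1 ∧ orient q.2.2.2.1 q.2.2.2.2 q.1 < 0 ∧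
      0 < orient q.2.2.2.1 q.2.2.2.2 q.2.1 :=
    ((hcont _ _ _ hU hB hWc).continuousAt.eventually (lt_mem_nhds hW)).and
    (((hcont _ _ _ hU hB hXc).continuousAt.eventually (gt_mem_nhds hX)).and
    (((hcont _ _ _ hWc hZ hU).continuousAt.eventually (gt_mem_nhds h1)).and
    (((hcont _ _ _ hWc hZ hB).continuousAt.eventually (lt_mem_nhds h2)).and
    (((hcont _ _ _ hZ hXc hU).continuousAt.eventually (gt_mem_nhds h3)).and
    ((hcont _ _ _ hZ hXc hB).continuousAt.eventually (lt_mem_nhds h4))))))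
  obtain ⟨η, hη, hball⟩ := Metric.eventually_nhds_iff.1 ev
  refine ⟨η, hη, fun U' B' W' Z' X' dU dB dW dZ dX => ?_⟩
  obtain ⟨k1, k2, k3, k4, k5, k6⟩ := hball (y := (U', B', W', Z', X')) (by
    simp only [Prod.dist_eq, max_lt_iff]
    exact ⟨dU, dB, dW, dZ, dX⟩)
  -- The perturbed bend may fall on either side of `U'B'`; in each case one leg of the polyline
  -- crosses.
  rcases le_total (orient U' B' Z') 0 with h | h
  · exact (segment_inter_nonempty k1.le h k3 k4).mono
      (Set.inter_subset_inter_right _ Set.subset_union_left)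
  · have := segment_inter_nonempty h k2.le k5 k6
    rw [segment_symm ℝ Z' X'] at this
    exact this.mono (Set.inter_subset_inter_right _ Set.subset_union_right)

/-! ### Touching copies -/

/-- The width of the regular polygon below its centre, in the direction of the normal of a
side. -/
noncomputable def depth (n : ℕ) : ℝ := if Even n then inradius n else circumradius n

theorem inradius_le (hn : 3 ≤ n) : inradius n ≤ circumradius n :=
  mul_le_of_le_one_right (circumradius_pos hn).le (Real.cos_le_one _)

theorem depth_le (hn : 3 ≤ n) : depth n ≤ circumradius n := by
  unfold depth
  split_ifs
  exacts [inradius_le hn, le_rfl]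

theorem depth_pos (hn : 3 ≤ n) : 0 < depth n := by
  unfold depth
  split_ifs
  exacts [inradius_pos hn, circumradius_pos hn]

theorem nrm_opposite (hn : 3 ≤ n) {m : ℤ} (hm : (n : ℤ) = 2 * m) (k : ℤ) (z : ℂ) :
    nrm n (k + m) z = -nrm n k z := by
  have h : (n : ℝ) = 2 * m := by exact_mod_cast hm
  have e : (2 * (k + m : ℤ) + 1 : ℝ) * (Real.pi / n) = (2 * k + 1) * (Real.pi / n) + Real.pi := by
    push_cast
    linear_combination nat_mul_angle hn - (Real.pi / n) * h
  rw [nrm, nrm, e, dot_apply, dot_apply, Real.cos_add_pi, Real.sin_add_pi]; ring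

theorem neg_depth_le (hn : 3 ≤ n) {x : ℂ} (hx : x ∈ regularPolygon n) (k : ℤ) :
    -depth n ≤ nrm n k x := by
  unfold depth
  split_ifs with h
  · obtain ⟨m, hm⟩ := h
    have := nrm_le_of_mem hn hx (k + m)
    rw [nrm_opposite hn (by omega)] at this
    linarith
  · rw [neg_le, ← map_neg]
    exact (dot_le_norm _ _).trans (by rw [norm_neg]; exact norm_le_circumradius hn hx)

/-- The equality case of the Cauchy–Schwarz inequality. -/
theorem eq_neg_smul_of_dot_eq {x R : ℝ} {z : ℂ} (hz : ‖z‖ ≤ R)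
    (h : dot x z = -R) : z = -R • unitVec x := by
  have h1 : (dot x z) ^ 2 + (dot (x + Real.pi / 2) z) ^ 2 = ‖z‖ ^ 2 := by
    rw [dot_add_pi_div_two, dot_apply, Complex.sq_norm, Complex.normSq_apply]
    linear_combination (z.re ^ 2 + z.im ^ 2) * Real.sin_sq_add_cos_sq x
  have h2 : dot (x + Real.pi / 2) z = 0 := by
    have : ‖z‖ ^ 2 ≤ R ^ 2 := by gcongr
    rw [h] at h1
    nlinarith
  apply dot_ext (x := x)
  · rw [h, map_smul, dot_unitVec, sub_self, Real.cos_zero, smul_eq_mul, mul_one]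
  · rw [h2, map_smul, dot_unitVec, show x - (x + Real.pi / 2) = -(Real.pi / 2) by ring,
      Real.cos_neg, Real.cos_pi_div_two, smul_zero]

theorem nrm_le_of_sector (hn : 3 ≤ n) {k : ℤ} {x : ℂ} {s t : ℝ} (hs : 0 ≤ s) (ht : 0 ≤ t)
    (hx : x = s • vtx n k + t • vtx n (k + 1)) (j : ℤ) : nrm n j x ≤ nrm n k x := by
  rw [hx, map_add, map_add, map_smul, map_smul, map_smul, map_smul, nrm_vtx_self, nrm_vtx_succ]
  simp only [smul_eq_mul]
  have := mul_le_mul_of_nonneg_left (nrm_vtx_le hn j k) hs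
  have := mul_le_mul_of_nonneg_left (nrm_vtx_le hn j (k + 1)) ht
  linarith

/-- Two homothetic copies of the polygon, one of them just reaching the line of a side of the
other, touch each other. -/
theorem exists_contact (hn : 3 ≤ n) {cu cw : ℂ} {k : ℤ} {a b s t s' t' : ℝ} (ha : 0 < a)
    (hb : 0 < b) (hab : a * inradius n = nrm n k (cw - cu) - b * depth n) (hs : 0 ≤ s)
    (ht : 0 ≤ t) (hst : cw - cu = s • vtx n k + t • vtx n (k + 1)) (hs' : 0 ≤ s') (ht' : 0 ≤ t')
    (hst' : cw - cu - (b * depth n) • unitVec ((2 * k + 1) * (Real.pi / n)) =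
      s' • vtx n k + t' • vtx n (k + 1)) :
    (polygonCopy n cu a ∩ polygonCopy n cw b).Nonempty ∧
    area (polygonCopy n cu a ∩ polygonCopy n cw b) = 0 ∧
    ∃ p, (p ∈ segment ℝ cu cw ∩ (polygonCopy n cu a ∩ polygonCopy n cw b) ∨
      (segment ℝ cu cw ∩ (polygonCopy n cu a ∩ polygonCopy n cw b) = ∅ ∧
        polygonCopy n cu a ∩ polygonCopy n cw b = {p})) := by
  have hρ := inradius_pos hn
  set ν := unitVec ((2 * k + 1) * (Real.pi / n)) with hν
  have hnν : nrm n k ν = 1 := by rw [nrm, hν, dot_unitVec, sub_self, Real.cos_zero]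
  -- The first copy is at most at this level and the second at least.
  have hline : ∀ z ∈ polygonCopy n cu a ∩ polygonCopy n cw b,
      nrm n k z = nrm n k cw - b * depth n := by
    rintro z ⟨hzA, x, hx, rfl⟩
    have h1 := (mem_polygonCopy hn ha).1 hzA k
    rw [map_sub, hab, map_sub] at h1
    have h2 := neg_depth_le hn hx k
    have h3 : nrm n k (cw + b • x) = nrm n k cw + b * nrm n k x := by
      rw [map_add, map_smul, smul_eq_mul]
    simp only at h1 ⊢
    nlinarith
  have harea : area (polygonCopy n cu a ∩ polygonCopy n cw b) = 0 := by
    rw [area, measure_mono_null hline (volume_dot_eq _ _), ENNReal.toReal_zero]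
  rcases Nat.even_or_odd n with he | ho
  · obtain ⟨m, hm⟩ := he
    have hdep : depth n = inradius n := if_pos ⟨m, hm⟩
    rw [hdep] at hab
    have hg : nrm n k (cw - cu) = (a + b) * inradius n := by linarith
    have hle := nrm_le_of_sector hn hs ht hst
    -- For even `n` the polygon is centrally symmetric, and the point dividing the segment between
    -- the centres in the ratio of the scales belongs to both copies.
    set p := cu + (a / (a + b)) • (cw - cu) with hp
    have hpL : p ∈ segment ℝ cu cw := by
      refine ⟨b / (a + b), a / (a + b), by positivity, by positivity, by field_simp; ring, ?_⟩
      rw [hp]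
      have : b / (a + b) = 1 - a / (a + b) := by field_simp; ring
      rw [this]; module
    have hpA : p ∈ polygonCopy n cu a := by
      rw [mem_polygonCopy hn ha]
      intro j
      rw [hp, add_sub_cancel_left, map_smul, smul_eq_mul]
      have h1 := (hle j).trans hg.le
      calc a / (a + b) * nrm n j (cw - cu) ≤ a / (a + b) * ((a + b) * inradius n) := by gcongr
        _ = a * inradius n := by field_simp
    have hpB : p ∈ polygonCopy n cw b := by
      rw [mem_polygonCopy hn hb]
      intro j
      have e : p - cw = -((b / (a + b)) • (cw - cu)) := by
        have : b / (a + b) = 1 - a / (a + b) := by field_simp; ring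
        rw [hp, this]; module
      rw [e, map_neg, map_smul, smul_eq_mul]
      have h1 := (hle (j + m)).trans hg.le
      rw [nrm_opposite hn (by omega)] at h1
      calc -(b / (a + b) * nrm n j (cw - cu)) = b / (a + b) * -nrm n j (cw - cu) := by ring
        _ ≤ b / (a + b) * ((a + b) * inradius n) := by gcongr
        _ = b * inradius n := by field_simp
    exact ⟨⟨p, hpA, hpB⟩, harea, p, Or.inl ⟨hpL, hpA, hpB⟩⟩
  · have hdep : depth n = circumradius n := if_neg (Nat.not_even_iff_odd.2 ho)
    obtain ⟨m, hm⟩ := ho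
    rw [hdep] at hab hst' hline
    set p := cw - (b * circumradius n) • ν with hp
    -- For odd `n` the lowest point of the second copy is the corner opposite to side `k`. It is
    -- then the only common point, on the segment between the centres or not.
    have hopp : vtx n (k + m + 1) = -circumradius n • ν := by
      have hmR : (n : ℝ) = 2 * m + 1 := by exact_mod_cast hm
      have e : (2 * ((k + m + 1 : ℤ) : ℝ)) * (Real.pi / n) =
          (2 * k + 1) * (Real.pi / n) + Real.pi := by
        push_cast
        linear_combination nat_mul_angle hn - (Real.pi / n) * hmR
      rw [vtx, e, hν, unitVec, unitVec, Real.cos_add_pi, Real.sin_add_pi]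
      apply Complex.ext <;> simp
    have hpA : p ∈ polygonCopy n cu a := by
      rw [mem_polygonCopy hn ha]
      intro j
      have e : p - cu = cw - cu - (b * circumradius n) • ν := by rw [hp]; ring
      have := nrm_le_of_sector hn hs' ht' hst' j
      rw [map_sub (nrm n k) (cw - cu), map_smul, hnν, smul_eq_mul, mul_one, ← hab] at this
      rwa [e]
    have hpB : p ∈ polygonCopy n cw b := by
      refine ⟨vtx n (k + m + 1), vtx_mem hn _, ?_⟩
      simp only [hopp, hp, smul_smul]
      rw [mul_neg, neg_smul, sub_eq_add_neg]
    have hsing : polygonCopy n cu a ∩ polygonCopy n cw b = {p} := by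
      refine subset_antisymm ?_ (Set.singleton_subset_iff.2 ⟨hpA, hpB⟩)
      rintro z hz
      have h1 := hline z hz
      obtain ⟨-, x, hx, rfl⟩ := hz
      simp only [map_add, map_smul, smul_eq_mul] at h1
      have h2 : nrm n k x = -circumradius n := by
        have : b * (nrm n k x + circumradius n) = 0 := by linarith
        rcases mul_eq_zero.1 this with h | h <;> linarith
      have h3 := eq_neg_smul_of_dot_eq (norm_le_circumradius hn hx) h2
      rw [Set.mem_singleton_iff, hp]
      simp only
      rw [h3, hν]
      module
    refine ⟨⟨p, hpA, hpB⟩, harea, p, ?_⟩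
    by_cases hpL : p ∈ segment ℝ cu cw
    · exact Or.inl ⟨hpL, hpA, hpB⟩
    · refine Or.inr ⟨?_, hsing⟩
      rw [hsing, Set.eq_empty_iff_forall_notMem]
      rintro z ⟨hz, hzp⟩
      rw [Set.mem_singleton_iff] at hzp
      exact hpL (hzp ▸ hz)

/-! ### Axes of symmetry -/

/-- The sign `1` for the left hand side (`true`) of an axis, `-1` for the right hand side. -/
def sgn (c : Bool) : ℝ := if c then 1 else -1

theorem sgn_true : sgn true = 1 := rfl

theorem sgn_false : sgn false = -1 := rfl

/-- An axis of symmetry of the regular `n`-gon. On each hand, `side` is a side meeting the top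
of the polygon, `tip` an end of the chord that cuts off the segment with middle side `side`, and
`above` and `below` are the sides adjacent to that end. -/
structure Axis (n : ℕ) where
  angle : ℝ
  top : ℝ
  bot : ℝ
  slope : ℝ
  side : Bool → ℤ
  tip : Bool → ℤ
  above : Bool → ℤ
  below : Bool → ℤ
  top_pos : 0 < top
  bot_pos : 0 < bot
  slope_pos : 0 < slope
  bot_le : bot ≤ circumradius n
  le_top : ∀ x ∈ regularPolygon n, dot angle x ≤ top
  top_mem : top • unitVec angle ∈ regularPolygon n
  neg_bot_le : ∀ x ∈ regularPolygon n, -bot ≤ dot angle x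
  bot_mem : -bot • unitVec angle ∈ regularPolygon n
  side_tip : ∀ c, nrm n (side c) (vtx n (tip c)) = chordLevel n
  side_top : ∀ c, top * nrm n (side c) (unitVec angle) = inradius n
  above_tip : ∀ c, nrm n (above c) (vtx n (tip c)) = inradius n
  below_tip : ∀ c, nrm n (below c) (vtx n (tip c)) = inradius n
  above_axis : ∀ c, nrm n (above c) (unitVec angle) = slope
  -- Positivity of both coefficients makes the tip the unique extreme point across the axis, so two
  -- mirror images with a common tip meet only there.
  lateral : ∀ c, ∃ p > 0, ∃ q > 0, ∀ z, sgn c * dot (angle + Real.pi / 2) z =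
    -(p * nrm n (above c) z + q * nrm n (below c) z)
  -- Seen from a point far enough down the axis, everything on hand `c` lies in the sector of `side
  -- c`.
  sector : ∀ c x, 0 ≤ sgn c * dot (angle + Real.pi / 2) x → ∃ r₀ : ℝ, ∀ r ≥ r₀,
    ∃ s t : ℝ, 0 ≤ s ∧ 0 ≤ t ∧
      x + r • (top • unitVec angle) = s • vtx n (side c) + t • vtx n (side c + 1)
  lateral_tip : ∀ c, sgn c * dot (angle + Real.pi / 2) (vtx n (tip c)) < 0
  -- Used with `s` the scale of an arm and `b` that of its shrunken copy: the point at distance `b *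
  -- depth n` below the centre of the arm, in the direction normal to `side c`, stays on hand `c`.
  foot : ∀ c (b s : ℝ), 0 ≤ b → b ≤ s → 0 ≤ sgn c * dot (angle + Real.pi / 2)
    (-(s • vtx n (tip c)) - (b * depth n) • unitVec ((2 * side c + 1) * (Real.pi / n)))

theorem inradius_smul_mem (hn : 3 ≤ n) (k : ℤ) :
    inradius n • unitVec ((2 * k + 1) * (Real.pi / n)) ∈ regularPolygon n := by
  rw [mem_regularPolygon hn]
  intro j
  rw [nrm, map_smul, dot_unitVec, smul_eq_mul]
  exact mul_le_of_le_one_right (inradius_pos hn).le (Real.cos_le_one _)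

theorem inradius_smul_eq (k : ℤ) :
    inradius n • unitVec ((2 * k + 1) * (Real.pi / n)) =
      (1 / 2 : ℝ) • (vtx n k + vtx n (k + 1)) := by
  have h1 : 2 * (k : ℝ) * (Real.pi / n) = (2 * k + 1) * (Real.pi / n) - Real.pi / n := by ring
  have h2 : 2 * ((k + 1 : ℤ) : ℝ) * (Real.pi / n) =
      (2 * k + 1) * (Real.pi / n) + Real.pi / n := by push_cast; ring
  rw [vtx, vtx, h1, h2, inradius]
  apply Complex.ext <;> simp only [unitVec, Complex.add_re, Complex.add_im, Complex.smul_re,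
    Complex.smul_im, smul_eq_mul, Real.cos_sub, Real.cos_add, Real.sin_sub, Real.sin_add] <;> ring

/-- The data of an axis not concerned with its ends, for an axis through a corner (`τ = 0`) or
through the midpoint of a side (`τ = 1`). -/
theorem exists_axis_of (hn : 3 ≤ n) (τ : ℤ) (hτ : τ = 0 ∨ τ = 1)
    (h1 : n ≤ 2 * (2 * halfCount n - 2 + τ) + 1) (h2 : 2 * (2 * halfCount n - 2 + τ) ≤ n + 1)
    {top bot : ℝ} (top_pos : 0 < top) (bot_pos : 0 < bot) (bot_le : bot ≤ circumradius n)
    (le_top : ∀ x ∈ regularPolygon n, dot (τ * (Real.pi / n)) x ≤ top)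
    (top_mem : top • unitVec (τ * (Real.pi / n)) ∈ regularPolygon n)
    (neg_bot_le : ∀ x ∈ regularPolygon n, -bot ≤ dot (τ * (Real.pi / n)) x)
    (bot_mem : -bot • unitVec (τ * (Real.pi / n)) ∈ regularPolygon n)
    (side_top : top * Real.cos ((1 - τ) * (Real.pi / n)) = inradius n)
    (top_eq : top • unitVec (τ * (Real.pi / n)) =
      (if τ = 0 then vtx n 0 else (1 / 2 : ℝ) • (vtx n 0 + vtx n 1))) :
    Nonempty (Axis n) := by
  have hμ := two_le_halfCount hn
  have hR := circumradius_pos hn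
  have ha := angle_pos hn
  have hs2 := sin_two_angle_pos hn
  set μ := halfCount n with hμd
  set a := Real.pi / n with had
  -- The tips lie at the angles `±m * a` from the axis, and `h1`, `h2` place `π / 2` strictly
  -- between `(m - 1) * a` and `(m + 1) * a`, the angles of the two sides adjacent to a tip.
  set m : ℤ := 2 * μ - 2 + τ with hm
  have hca : 0 < Real.cos ((m - 1 : ℤ) * a) := by
    have e1 : (2 : ℝ) * ((m - 1 : ℤ) : ℝ) ≤ n - 1 := by
      have : 2 * (m - 1) ≤ (n : ℤ) - 1 := by omega
      exact_mod_cast this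
    have e2 : (0 : ℝ) ≤ ((m - 1 : ℤ) : ℝ) := by
      have : 0 ≤ m - 1 := by omega
      exact_mod_cast this
    have := nat_mul_angle hn
    rw [← had] at this
    exact Real.cos_pos_of_mem_Ioo ⟨by nlinarith [Real.pi_pos], by nlinarith⟩
  have hcb : Real.cos ((m + 1 : ℤ) * a) < 0 := by
    have e1 : (n : ℝ) + 1 ≤ 2 * ((m + 1 : ℤ) : ℝ) := by
      have : (n : ℤ) + 1 ≤ 2 * (m + 1) := by omega
      exact_mod_cast this
    have e2 : ((m + 1 : ℤ) : ℝ) ≤ n := by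
      have : m + 1 ≤ (n : ℤ) := by omega
      exact_mod_cast this
    have := nat_mul_angle hn
    rw [← had] at this
    exact Real.cos_neg_of_pi_div_two_lt_of_lt (by nlinarith) (by nlinarith)
  have hsm : 0 < Real.sin (m * a) := sin_pos_of_lt hn (by omega) (by omega)
  have hτa : 0 ≤ Real.sin ((1 - τ) * a) ∧ Real.sin ((1 - τ) * a) ≤ Real.sin (m * a) := by
    rcases hτ with h | h
    · rw [h]
      simp only [Int.cast_zero, sub_zero, one_mul]
      refine ⟨(sin_angle_pos hn).le, ?_⟩
      have e2 : ((m + 1 : ℤ) : ℝ) ≤ n := by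
        have : m + 1 ≤ (n : ℤ) := by omega
        exact_mod_cast this
      have e3 : (1 : ℝ) ≤ m := by
        have : 1 ≤ m := by omega
        exact_mod_cast this
      push_cast at e2
      have hna := nat_mul_angle hn
      rw [← had] at hna
      rw [← Real.cos_sub_pi_div_two, ← Real.cos_sub_pi_div_two (m * a), ← Real.cos_abs,
        ← Real.cos_abs (m * a - Real.pi / 2)]
      refine Real.cos_le_cos_of_nonneg_of_le_pi (abs_nonneg _) ?_ ?_
      · rw [abs_le]; constructor <;> nlinarith [Real.pi_pos, angle_le hn]
      · have : a ≤ Real.pi / 2 := by linarith [angle_le hn]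
        rw [abs_of_nonpos (a := a - Real.pi / 2) (by linarith), abs_le]
        constructor <;> nlinarith
    · rw [h]; simp [hsm.le]
  have hlat : ∀ (c : Bool) (x : ℝ), sgn c * dot (τ * a + Real.pi / 2)
      (unitVec (τ * a + sgn c * x)) = Real.sin x := by
    intro c x
    rw [dot_unitVec, show τ * a + sgn c * x - (τ * a + Real.pi / 2) =
      sgn c * x - Real.pi / 2 by ring, Real.cos_sub_pi_div_two]
    cases c <;> simp [sgn]
  have hlatvtx : ∀ k : ℤ, dot (τ * a + Real.pi / 2) (vtx n k) =
      circumradius n * Real.sin ((2 * k - τ) * a) := by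
    intro k
    rw [vtx, map_smul, dot_unitVec, smul_eq_mul, ← Real.cos_sub_pi_div_two]
    congr 2; ring
  have htip : ∀ c : Bool, sgn c * dot (τ * a + Real.pi / 2)
      (vtx n (cond c (1 - μ) (μ - 1 + τ))) = -(circumradius n * Real.sin (m * a)) := by
    intro c
    rw [hlatvtx]
    cases c
    · simp only [cond_false, sgn_false, hm]; push_cast; ring_nf
    · simp only [cond_true, sgn_true, hm]
      rw [show (2 * ((1 - μ : ℤ) : ℝ) - τ) * a = -(((2 * μ - 2 + τ : ℤ) : ℝ) * a) by
        push_cast; ring, Real.sin_neg]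
      ring
  have hside : ∀ c : Bool, (2 * ((cond c 0 (τ - 1) : ℤ) : ℝ) + 1) * a =
      τ * a + sgn c * ((1 - τ) * a) := by
    intro c
    cases c <;> simp only [cond_false, cond_true, sgn_false, sgn_true] <;> push_cast <;> ring
  have hnrmE : ∀ (c : Bool) (k : ℤ) (x : ℝ), (2 * (k : ℝ) + 1) * a = τ * a + sgn c * x →
      nrm n k (unitVec (τ * a)) = Real.cos x := by
    intro c k x h
    rw [nrm, ← had, h, dot_unitVec, show τ * a - (τ * a + sgn c * x) = -(sgn c * x) by ring,
      Real.cos_neg]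
    cases c <;> simp [sgn]
  have habove : ∀ c : Bool, (2 * ((cond c (1 - μ) (μ - 2 + τ) : ℤ) : ℝ) + 1) * a =
      τ * a + sgn c * -(((m - 1 : ℤ) : ℝ) * a) := by
    intro c
    cases c <;> simp only [cond_false, cond_true, sgn_false, sgn_true, hm] <;> push_cast <;> ring
  have hbelow : ∀ c : Bool, (2 * ((cond c (-μ) (μ - 1 + τ) : ℤ) : ℝ) + 1) * a =
      τ * a + sgn c * -(((m + 1 : ℤ) : ℝ) * a) := by
    intro c
    cases c <;> simp only [cond_false, cond_true, sgn_false, sgn_true, hm] <;> push_cast <;> ring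
  refine ⟨{
    angle := τ * a
    top := top
    bot := bot
    slope := Real.cos ((m - 1 : ℤ) * a)
    side := fun c => cond c 0 (τ - 1)
    tip := fun c => cond c (1 - μ) (μ - 1 + τ)
    above := fun c => cond c (1 - μ) (μ - 2 + τ)
    below := fun c => cond c (-μ) (μ - 1 + τ)
    top_pos := top_pos
    bot_pos := bot_pos
    slope_pos := hca
    bot_le := bot_le
    le_top := le_top
    top_mem := top_mem
    neg_bot_le := neg_bot_le
    bot_mem := bot_mem
    side_tip := ?_
    side_top := ?_
    above_tip := ?_
    below_tip := ?_
    above_axis := ?_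
    lateral := ?_
    sector := ?_
    lateral_tip := ?_
    foot := ?_ }⟩
  · rintro (_ | _)
    · have := nrm_vtx_right (n := n) (τ - 1)
      rwa [show τ - 1 + halfCount n = μ - 1 + τ by ring] at this
    · have := nrm_vtx_left (n := n) 0
      rwa [zero_add] at this
  · intro c
    rw [hnrmE c _ _ (hside c), side_top]
  · rintro (_ | _)
    · have := nrm_vtx_succ (n := n) (μ - 2 + τ)
      rwa [show μ - 2 + τ + 1 = μ - 1 + τ by ring] at this
    · exact nrm_vtx_self _
  · rintro (_ | _)
    · exact nrm_vtx_self _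
    · have := nrm_vtx_succ (n := n) (-μ)
      rwa [show -μ + 1 = 1 - μ by ring] at this
  · intro c
    rw [hnrmE c _ _ (habove c), Real.cos_neg]
  · intro c
    -- Coefficients of the direction across the axis in terms of the two normals adjacent to the
    -- tip, which enclose the angle `2 * a`.
    refine ⟨-Real.cos ((m + 1 : ℤ) * a) / Real.sin (2 * a), by
      apply div_pos <;> linarith, Real.cos ((m - 1 : ℤ) * a) / Real.sin (2 * a),
      div_pos hca hs2, fun z => ?_⟩
    have key := sin_mul_dot ((2 * ((cond c (1 - μ) (μ - 2 + τ) : ℤ) : ℝ) + 1) * a)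
      ((2 * ((cond c (-μ) (μ - 1 + τ) : ℤ) : ℝ) + 1) * a) (τ * a + Real.pi / 2) z
    have e1 : Real.sin ((2 * ((cond c (-μ) (μ - 1 + τ) : ℤ) : ℝ) + 1) * a -
        (2 * ((cond c (1 - μ) (μ - 2 + τ) : ℤ) : ℝ) + 1) * a) =
        -(sgn c * Real.sin (2 * a)) := by
      rw [habove, hbelow]
      push_cast
      rw [show τ * a + sgn c * -((m + 1) * a) - (τ * a + sgn c * -((m - 1) * a)) =
        -(sgn c * (2 * a)) by ring, Real.sin_neg]
      cases c <;> simp [sgn]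
    have e2 : Real.sin ((2 * ((cond c (-μ) (μ - 1 + τ) : ℤ) : ℝ) + 1) * a -
        (τ * a + Real.pi / 2)) = -Real.cos ((m + 1 : ℤ) * a) := by
      rw [hbelow, show τ * a + sgn c * -(((m + 1 : ℤ) : ℝ) * a) - (τ * a + Real.pi / 2) =
        sgn c * -(((m + 1 : ℤ) : ℝ) * a) - Real.pi / 2 by ring, Real.sin_sub_pi_div_two]
      cases c <;> simp [sgn]
    have e3 : Real.sin (τ * a + Real.pi / 2 -
        (2 * ((cond c (1 - μ) (μ - 2 + τ) : ℤ) : ℝ) + 1) * a) =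
        Real.cos ((m - 1 : ℤ) * a) := by
      rw [habove, show τ * a + Real.pi / 2 - (τ * a + sgn c * -(((m - 1 : ℤ) : ℝ) * a)) =
        sgn c * (((m - 1 : ℤ) : ℝ) * a) + Real.pi / 2 by ring, Real.sin_add_pi_div_two]
      cases c <;> simp [sgn]
    rw [e1, e2, e3] at key
    simp only [nrm, ← had]
    generalize dot ((2 * ((cond c (1 - μ) (μ - 2 + τ) : ℤ) : ℝ) + 1) * a) z = A at key ⊢
    generalize dot ((2 * ((cond c (-μ) (μ - 1 + τ) : ℤ) : ℝ) + 1) * a) z = B at key ⊢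
    generalize dot (τ * a + Real.pi / 2) z = T at key ⊢
    generalize Real.cos ((m + 1 : ℤ) * a) = p at key ⊢
    generalize Real.cos ((m - 1 : ℤ) * a) = q at key ⊢
    generalize Real.sin (2 * a) = S at key hs2 ⊢
    field_simp
    linear_combination -key
  · intro c x hx
    obtain ⟨s, t, rfl⟩ := exists_basis hn x (cond c 0 (τ - 1))
    rcases hτ with h | h
    · have hR2 := mul_pos hR hs2
      rw [map_add, map_smul, map_smul, hlatvtx, hlatvtx, h] at hx
      rw [top_eq, if_pos h]
      refine ⟨max (-s) (-t), fun r hr => ?_⟩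
      cases c
      · have hs : 0 ≤ s := by
          have e1 : (2 * ((cond false 0 ((0 : ℤ) - 1) : ℤ) : ℝ) - ((0 : ℤ) : ℝ)) * a =
              -(2 * a) := by simp
          have e2 : (2 * ((cond false 0 ((0 : ℤ) - 1) + 1 : ℤ) : ℝ) - ((0 : ℤ) : ℝ)) * a =
              0 := by simp
          rw [e1, e2, Real.sin_neg, Real.sin_zero, sgn_false, smul_eq_mul, smul_eq_mul] at hx
          nlinarith
        refine ⟨s, t + r, hs, ?_, ?_⟩
        · linarith [le_max_right (-s) (-t)]
        · simp only [cond_false, h, zero_sub, Int.reduceNeg, neg_add_cancel]; module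
      · have ht : 0 ≤ t := by
          have e1 : (2 * ((cond true 0 ((0 : ℤ) - 1) : ℤ) : ℝ) - ((0 : ℤ) : ℝ)) * a =
              0 := by simp
          have e2 : (2 * ((cond true 0 ((0 : ℤ) - 1) + 1 : ℤ) : ℝ) - ((0 : ℤ) : ℝ)) * a =
              2 * a := by simp
          rw [e1, e2, Real.sin_zero, sgn_true, smul_eq_mul, smul_eq_mul] at hx
          nlinarith
        refine ⟨s + r, t, ?_, ht, ?_⟩
        · linarith [le_max_left (-s) (-t)]
        · simp only [cond_true]; module
    · rw [top_eq, if_neg (by omega)]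
      refine ⟨2 * max (-s) (-t), fun r hr => ⟨s + r / 2, t + r / 2, ?_, ?_, ?_⟩⟩
      · linarith [le_max_left (-s) (-t)]
      · linarith [le_max_right (-s) (-t)]
      · have e : (cond c 0 (τ - 1) : ℤ) = 0 := by rw [h]; cases c <;> rfl
        rw [e, zero_add]; module
  · intro c
    rw [htip]
    have := mul_pos hR hsm
    linarith
  · intro c b s hb hbs
    rw [map_sub, map_neg, map_smul, map_smul, smul_eq_mul, smul_eq_mul, ← had, hside c]
    have e1 := htip c
    have e2 := hlat c ((1 - τ) * a)
    have e3 := depth_le hn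
    have e4 := depth_pos hn
    have h3 : b * (depth n * Real.sin ((1 - τ) * a)) ≤ s * (circumradius n * Real.sin (m * a)) :=
      mul_le_mul hbs (mul_le_mul e3 hτa.2 hτa.1 hR.le) (mul_nonneg e4.le hτa.1) (hb.trans hbs)
    linear_combination h3 + s * e1 + (b * depth n) * e2

/-- For `n ≡ 2` modulo 4 the axis joins the midpoints of opposite sides; otherwise its top is a
corner and its bottom is a corner for even `n`, the midpoint of a side for odd `n`. These choices
satisfy the two inequalities required by `exists_axis_of`. -/
theorem exists_axis (hn : 3 ≤ n) : Nonempty (Axis n) := by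
  have hR := circumradius_pos hn
  have hρ := inradius_pos hn
  have hna := nat_mul_angle hn
  have hbotside : ∀ (k : ℤ) (x : ℝ), (2 * (k : ℝ) + 1) * (Real.pi / n) = x + Real.pi →
      (∀ z ∈ regularPolygon n, -inradius n ≤ dot x z) ∧
        -inradius n • unitVec x ∈ regularPolygon n := by
    intro k x h
    constructor
    · intro z hz
      have h1 := nrm_le_of_mem hn hz k
      rw [nrm, h, dot_apply, Real.cos_add_pi, Real.sin_add_pi] at h1
      rw [dot_apply]; linarith
    · have h1 := inradius_smul_mem hn k
      rw [h] at h1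
      convert h1 using 1
      apply Complex.ext <;> simp [unitVec, Real.cos_add_pi, Real.sin_add_pi]
  by_cases h4 : n % 4 = 2
  · obtain ⟨j, hj⟩ : ∃ j : ℕ, n = 2 * j := ⟨n / 2, by omega⟩
    have e : (2 * ((0 : ℤ) : ℝ) + 1) * (Real.pi / n) = ((1 : ℤ) : ℝ) * (Real.pi / n) := by
      push_cast; ring
    have hb := hbotside j (((1 : ℤ) : ℝ) * (Real.pi / n)) (by
      have : (n : ℝ) = 2 * j := by exact_mod_cast hj
      push_cast
      linear_combination hna - (Real.pi / n) * this)
    refine exists_axis_of hn 1 (Or.inr rfl) (by unfold halfCount; omega)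
      (by unfold halfCount; omega) hρ hρ (inradius_le hn) ?_ ?_ hb.1 hb.2 ?_ ?_
    · intro x hx
      have := nrm_le_of_mem hn hx 0
      rwa [nrm, e] at this
    · rw [← e]; exact inradius_smul_mem hn 0
    · simp
    · rw [if_neg one_ne_zero, ← e, inradius_smul_eq, zero_add]
  · have e0 : ((0 : ℤ) : ℝ) * (Real.pi / n) = 0 := by simp
    have htop : circumradius n • unitVec (((0 : ℤ) : ℝ) * (Real.pi / n)) = vtx n 0 := by
      rw [vtx]; simp
    have hst : circumradius n * Real.cos ((1 - ((0 : ℤ) : ℝ)) * (Real.pi / n)) = inradius n := by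
      rw [inradius]; simp
    have hlt : ∀ x ∈ regularPolygon n, dot (((0 : ℤ) : ℝ) * (Real.pi / n)) x ≤ circumradius n :=
      fun x hx => (dot_le_norm _ _).trans (norm_le_circumradius hn hx)
    rcases Nat.even_or_odd' n with ⟨j, hj | hj⟩
    · refine exists_axis_of hn 0 (Or.inl rfl) (by unfold halfCount; omega)
        (by unfold halfCount; omega) hR hR le_rfl hlt (htop ▸ vtx_mem hn 0) ?_ ?_ hst htop
      · intro x hx
        rw [neg_le, ← map_neg]
        exact (dot_le_norm _ _).trans (by rw [norm_neg]; exact norm_le_circumradius hn hx)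
      · have h1 := vtx_mem hn (j : ℤ)
        have : 2 * ((j : ℤ) : ℝ) * (Real.pi / n) = Real.pi := by
          have : (n : ℝ) = 2 * j := by exact_mod_cast hj
          push_cast
          linear_combination hna - (Real.pi / n) * this
        rw [vtx, this] at h1
        rw [e0]
        convert h1 using 1
        apply Complex.ext <;> simp [unitVec]
    · have hb := hbotside j (((0 : ℤ) : ℝ) * (Real.pi / n)) (by
        have : (n : ℝ) = 2 * j + 1 := by exact_mod_cast hj
        push_cast
        linear_combination hna - (Real.pi / n) * this)
      exact exists_axis_of hn 0 (Or.inl rfl) (by unfold halfCount; omega)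
        (by unfold halfCount; omega) hR hρ (inradius_le hn) hlt (htop ▸ vtx_mem hn 0)
        hb.1 hb.2 hst htop

/-! ### Towers and their freeness -/

/-- The centre of a tower member on the given hand of the axis. -/
noncomputable def Axis.armCenter (A : Axis n) (gap s : ℝ) (c : Bool) : ℂ :=
  -((gap * s) • unitVec A.angle) - s • vtx n (A.tip c)

/-- The parameters of a tower: below two touching shapes on the axis there are `k` pairs of
shapes, each pair touching on the axis inside the lower one of the two. -/
structure Tower (A : Axis n) (k : ℕ) (α : ℝ) where
  gap : ℝ
  size : Fin k → ℝ
  big : ℝ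
  gap_pos : 0 < gap
  size_pos : ∀ i, 0 < size i
  -- `base` keeps the arms away from the upper shape, `sep` keeps different pairs apart, and `reach`
  -- puts the joints strictly between the centre and the top of the low shape.
  base : ∀ i, 2 * circumradius n < gap * size i * A.slope
  sep : ∀ i j, i < j → (gap + 2 * circumradius n) * size i < gap * size j * A.slope
  big_pos : 0 < big
  reach : ∀ i, gap * size i < big * A.top
  arm_area : ∀ c, α ≤ area (regularPolygon n ∩ {z | chordLevel n + gap < nrm n (A.side c) z})
  big_area : α * big ^ 2 + (1 + ∑ p : Fin k × Bool, size p.1 ^ 2) ≤ big ^ 2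
  -- The strict inequality `b < size i` ensures that the contact point is not the joint of the pair.
  contact : ∀ i c, ∃ a b : ℝ, 0 < a ∧ a ≤ big ∧ 0 < b ∧ b < size i ∧
    let P := polygonCopy n (-((big * A.top) • unitVec A.angle)) a
    let Q := polygonCopy n (A.armCenter gap (size i) c) b
    let L := segment ℝ (-((big * A.top) • unitVec A.angle)) (A.armCenter gap (size i) c)
    (P ∩ Q).Nonempty ∧ area (P ∩ Q) = 0 ∧
      ∃ p, (p ∈ L ∩ (P ∩ Q) ∨ (L ∩ (P ∩ Q) = ∅ ∧ P ∩ Q = {p}))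

theorem Axis.dot_axis (A : Axis n) : dot A.angle (unitVec A.angle) = 1 := by
  rw [dot_unitVec, sub_self, Real.cos_zero]

theorem Axis.lateral_axis (A : Axis n) : dot (A.angle + Real.pi / 2) (unitVec A.angle) = 0 := by
  rw [dot_unitVec, show A.angle - (A.angle + Real.pi / 2) = -(Real.pi / 2) by ring, Real.cos_neg,
    Real.cos_pi_div_two]

namespace Tower

variable {A : Axis n} {k : ℕ} {α : ℝ} (T : Tower A k α)

/-- The vertices: the lower one (`true`) and the upper one (`false`) of the two touching shapes,
and the pairs. -/
abbrev Index (k : ℕ) : Type := Bool ⊕ (Fin k × Bool)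

/-- The collection of shapes of a tower. -/
noncomputable def family : PolygonFamily (Index k) where
  center := Sum.elim
    (fun c => cond c (-((T.big * A.top) • unitVec A.angle)) (A.bot • unitVec A.angle))
    (fun p => A.armCenter T.gap (T.size p.1) p.2)
  scale := Sum.elim (fun c => cond c T.big 1) (fun p => T.size p.1)
  scale_pos := by
    rintro ((_ | _) | p)
    exacts [one_pos, T.big_pos, T.size_pos _]

/-- The common point of a pair. -/
noncomputable def joint (i : Fin k) : ℂ := -((T.gap * T.size i) • unitVec A.angle)

theorem shape_arm (i : Fin k) (c : Bool) : T.family.shape n (Sum.inr (i, c)) =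
    polygonCopy n (A.armCenter T.gap (T.size i) c) (T.size i) := rfl

theorem zero_mem_low : (0 : ℂ) ∈ T.family.shape n (Sum.inl true) :=
  ⟨_, A.top_mem, by
    change -((T.big * A.top) • unitVec A.angle) + T.big • A.top • unitVec A.angle = 0
    rw [smul_smul, neg_add_cancel]⟩

theorem zero_mem_high : (0 : ℂ) ∈ T.family.shape n (Sum.inl false) :=
  ⟨_, A.bot_mem, by
    change A.bot • unitVec A.angle + (1 : ℝ) • -A.bot • unitVec A.angle = 0
    module⟩

theorem joint_mem_low (hn : 3 ≤ n) (i : Fin k) :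
    T.joint i ∈ T.family.shape n (Sum.inl true) := by
  have hc : Convex ℝ (T.family.shape n (Sum.inl true)) := convex_polygonCopy n _ _
  have hrt := mul_pos T.big_pos A.top_pos
  have h := hc (center_mem hn _ _) T.zero_mem_low (a := T.gap * T.size i / (T.big * A.top))
    (b := 1 - T.gap * T.size i / (T.big * A.top))
    (div_nonneg (mul_pos T.gap_pos (T.size_pos i)).le hrt.le)
    (by rw [sub_nonneg, div_le_one hrt]; exact (T.reach i).le) (by ring)
  convert h using 1
  rw [joint, smul_zero, add_zero]
  change _ = _ • -((T.big * A.top) • unitVec A.angle)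
  rw [smul_neg, smul_smul, div_mul_cancel₀ _ hrt.ne']

theorem joint_mem_arm (hn : 3 ≤ n) (i : Fin k) (c : Bool) :
    T.joint i ∈ T.family.shape n (Sum.inr (i, c)) :=
  ⟨_, vtx_mem hn (A.tip c), by
    change A.armCenter _ _ _ + T.size i • _ = _
    rw [Axis.armCenter, joint, sub_add_cancel]⟩

theorem dot_nonpos_of_mem_low {z : ℂ} (hz : z ∈ T.family.shape n (Sum.inl true)) :
    dot A.angle z ≤ 0 := by
  obtain ⟨x, hx, rfl⟩ := hz
  change dot A.angle (-((T.big * A.top) • unitVec A.angle) + T.big • x) ≤ 0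
  rw [map_add, map_neg, map_smul, map_smul, A.dot_axis, smul_eq_mul, smul_eq_mul]
  linarith [mul_le_mul_of_nonneg_left (A.le_top x hx) T.big_pos.le]

theorem nrm_nonpos_of_mem_low (hn : 3 ≤ n) {z : ℂ}
    (hz : z ∈ T.family.shape n (Sum.inl true)) (c : Bool) : nrm n (A.side c) z ≤ 0 := by
  obtain ⟨x, hx, rfl⟩ := hz
  change nrm n (A.side c) (-((T.big * A.top) • unitVec A.angle) + T.big • x) ≤ 0
  rw [map_add, map_neg, map_smul, map_smul, smul_eq_mul, smul_eq_mul, mul_assoc, A.side_top]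
  linarith [mul_le_mul_of_nonneg_left (nrm_le_of_mem hn hx (A.side c)) T.big_pos.le]

theorem dot_nonneg_of_mem_high {z : ℂ} (hz : z ∈ T.family.shape n (Sum.inl false)) :
    0 ≤ dot A.angle z := by
  obtain ⟨x, hx, rfl⟩ := hz
  change 0 ≤ dot A.angle (A.bot • unitVec A.angle + (1 : ℝ) • x)
  rw [map_add, map_smul, A.dot_axis, one_smul, smul_eq_mul]
  linarith [A.neg_bot_le x hx]

theorem norm_le_of_mem_high (hn : 3 ≤ n) {z : ℂ} (hz : z ∈ T.family.shape n (Sum.inl false)) :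
    ‖z‖ ≤ 2 * circumradius n := by
  obtain ⟨x, hx, rfl⟩ := hz
  change ‖A.bot • unitVec A.angle + (1 : ℝ) • x‖ ≤ _
  rw [one_smul]
  refine (norm_add_le _ _).trans ?_
  rw [norm_smul, norm_unitVec, Real.norm_of_nonneg A.bot_pos.le]
  linarith [A.bot_le, norm_le_circumradius hn hx]

theorem norm_le_of_mem_arm (hn : 3 ≤ n) {z : ℂ} {i : Fin k} {c : Bool}
    (hz : z ∈ T.family.shape n (Sum.inr (i, c))) :
    ‖z‖ ≤ (T.gap + 2 * circumradius n) * T.size i := by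
  obtain ⟨x, hx, rfl⟩ := hz
  change ‖-((T.gap * T.size i) • unitVec A.angle) - T.size i • vtx n (A.tip c) + T.size i • x‖ ≤ _
  have hs := T.size_pos i
  refine (norm_add_le _ _).trans ((add_le_add_left (norm_sub_le _ _) _).trans ?_)
  rw [norm_neg, norm_smul, norm_smul, norm_smul, norm_unitVec, Real.norm_of_nonneg hs.le,
    Real.norm_of_nonneg (mul_pos T.gap_pos hs).le]
  have h1 := mul_le_mul_of_nonneg_left (norm_le_circumradius hn hx) hs.le
  have h2 := mul_le_mul_of_nonneg_left (norm_le_circumradius hn (vtx_mem hn (A.tip c))) hs.le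
  linarith

theorem nrm_arm_nonpos (hn : 3 ≤ n) {z : ℂ} {i : Fin k} {c : Bool} {j : ℤ}
    (hj : nrm n j (vtx n (A.tip c)) = inradius n)
    (hz : z ∈ T.family.shape n (Sum.inr (i, c))) : nrm n j (z - T.joint i) ≤ 0 := by
  rw [shape_arm, mem_polygonCopy hn (T.size_pos i)] at hz
  have h := hz j
  rw [show z - A.armCenter T.gap (T.size i) c = (z - T.joint i) + T.size i • vtx n (A.tip c) by
    rw [Axis.armCenter, joint]; abel, map_add, map_smul, hj, smul_eq_mul] at h
  linarith

theorem lateral_sub_joint (z : ℂ) (i : Fin k) :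
    dot (A.angle + Real.pi / 2) (z - T.joint i) = dot (A.angle + Real.pi / 2) z := by
  rw [map_sub, joint, map_neg, map_smul, A.lateral_axis]; simp

theorem lateral_nonneg (hn : 3 ≤ n) {z : ℂ} {i : Fin k} {c : Bool}
    (hz : z ∈ T.family.shape n (Sum.inr (i, c))) :
    0 ≤ sgn c * dot (A.angle + Real.pi / 2) z := by
  obtain ⟨p, hp, q, hq, h⟩ := A.lateral c
  have h1 := T.nrm_arm_nonpos hn (A.above_tip c) hz
  have h2 := T.nrm_arm_nonpos hn (A.below_tip c) hz
  rw [← T.lateral_sub_joint z i, h]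
  nlinarith

/-- The arm lies beyond the line of its side `above` through the joint, and this line has distance
`gap * size i * slope` from `0`. -/
theorem le_norm_of_mem_arm (hn : 3 ≤ n) {z : ℂ} {i : Fin k} {c : Bool}
    (hz : z ∈ T.family.shape n (Sum.inr (i, c))) : T.gap * T.size i * A.slope ≤ ‖z‖ := by
  have h1 := T.nrm_arm_nonpos hn (A.above_tip c) hz
  rw [map_sub, joint, map_neg, map_smul, A.above_axis, smul_eq_mul] at h1
  have h2 := dot_le_norm ((2 * A.above c + 1) * (Real.pi / n)) (-z)
  rw [norm_neg, map_neg] at h2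
  rw [nrm] at h1
  linarith

/-- A common point of both arms lies on the axis, so both summands in `Axis.lateral` vanish. On the
axis the positive `slope` leaves only the joint. -/
theorem eq_joint (hn : 3 ≤ n) {z : ℂ} {i : Fin k} {c : Bool}
    (hz : z ∈ T.family.shape n (Sum.inr (i, c)))
    (hz' : z ∈ T.family.shape n (Sum.inr (i, !c))) : z = T.joint i := by
  have h1 := T.lateral_nonneg hn hz
  have h2 := T.lateral_nonneg hn hz'
  have h0 : dot (A.angle + Real.pi / 2) z = 0 := by
    cases c <;> simp only [Bool.not_true, Bool.not_false, sgn_true, sgn_false] at h1 h2 <;>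
      linarith
  rw [← T.lateral_sub_joint z i] at h0
  obtain ⟨p, hp, q, hq, h⟩ := A.lateral c
  have h3 := T.nrm_arm_nonpos hn (A.above_tip c) hz
  have h4 := T.nrm_arm_nonpos hn (A.below_tip c) hz
  have h5 := h (z - T.joint i)
  rw [h0, mul_zero] at h5
  have h6 : nrm n (A.above c) (z - T.joint i) = 0 := by
    have : p * nrm n (A.above c) (z - T.joint i) = 0 := by nlinarith
    exact (mul_eq_zero.1 this).resolve_left hp.ne'
  have h7 : z - T.joint i = dot A.angle (z - T.joint i) • unitVec A.angle := by
    apply dot_ext (x := A.angle)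
    · rw [map_smul, A.dot_axis, smul_eq_mul, mul_one]
    · rw [map_smul, A.lateral_axis, h0, smul_zero]
  rw [h7, map_smul, A.above_axis, smul_eq_mul] at h6
  have h8 := (mul_eq_zero.1 h6).resolve_right A.slope_pos.ne'
  rwa [h8, zero_smul, sub_eq_zero] at h7

/-- The upper shape and the pairs lie in disjoint rings about `0`, by the bounds on norms together
with `base` and `sep`. -/
theorem eq_joint_of_mem (hn : 3 ≤ n) {z : ℂ} {x y : Index k} (hxy : x ≠ y)
    (hx : x ≠ Sum.inl true) (hy : y ≠ Sum.inl true) (hzx : z ∈ T.family.shape n x)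
    (hzy : z ∈ T.family.shape n y) :
    ∃ i c, x = Sum.inr (i, c) ∧ y = Sum.inr (i, !c) ∧ z = T.joint i := by
  rcases x with (_ | _) | ⟨i, c⟩
  · rcases y with (_ | _) | ⟨j, d⟩
    · exact absurd rfl hxy
    · exact absurd rfl hy
    · linarith [T.norm_le_of_mem_high hn hzx, T.le_norm_of_mem_arm hn hzy, T.base j]
  · exact absurd rfl hx
  · rcases y with (_ | _) | ⟨j, d⟩
    · linarith [T.norm_le_of_mem_high hn hzy, T.le_norm_of_mem_arm hn hzx, T.base i]
    · exact absurd rfl hy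
    · rcases lt_trichotomy i j with h | rfl | h
      · linarith [T.norm_le_of_mem_arm hn hzx, T.le_norm_of_mem_arm hn hzy, T.sep i j h]
      · have hd : d = !c := by
          cases c <;> cases d <;> simp_all
        subst hd
        exact ⟨i, c, rfl, rfl, T.eq_joint hn hzx hzy⟩
      · linarith [T.norm_le_of_mem_arm hn hzy, T.le_norm_of_mem_arm hn hzx, T.sep j i h]

theorem joint_ne_zero (i : Fin k) : T.joint i ≠ 0 := by
  intro h
  have h1 := congrArg (dot A.angle) h
  rw [joint, map_neg, map_smul, A.dot_axis, map_zero, smul_eq_mul] at h1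
  linarith [mul_pos T.gap_pos (T.size_pos i)]

/-- In the coordinates of the arm, the line bounding the low shape has level at most `chordLevel n +
T.gap`, since lowering the joint by `gap` raises this level by `gap` times a cosine. -/
theorem notMem_low_of_lt (hn : 3 ≤ n) {x : ℂ} {i : Fin k} {c : Bool}
    (hx : chordLevel n + T.gap < nrm n (A.side c) x) :
    A.armCenter T.gap (T.size i) c + T.size i • x ∉ T.family.shape n (Sum.inl true) := by
  intro h
  have h1 := T.nrm_nonpos_of_mem_low hn h c
  have hs := T.size_pos i
  rw [Axis.armCenter, map_add, map_sub, map_neg, map_smul, map_smul, map_smul, A.side_tip,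
    smul_eq_mul, smul_eq_mul, smul_eq_mul] at h1
  have h2 : nrm n (A.side c) (unitVec A.angle) ≤ 1 :=
    (dot_le_norm _ _).trans (norm_unitVec _).le
  have h3 := mul_lt_mul_of_pos_left hx hs
  have h4 := mul_le_mul_of_nonneg_left h2 (mul_pos T.gap_pos hs).le
  linarith

/-- The upper shape meets the others only in a null set, the low shape loses at most the total area
of the others, and an arm keeps its cap above level `chordLevel n + T.gap`. -/
theorem isFree (hn : 3 ≤ n) (hα : α ≤ 1) : T.family.IsFree n α := by
  have hfin : ∀ x, volume (T.family.shape n x) ≠ ⊤ := fun x => volume_polygonCopy_ne_top hn _ _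
  have hfin' : ∀ x (B : Set ℂ), volume (T.family.shape n x \ B) ≠ ⊤ := fun x B =>
    ((measure_mono Set.sdiff_subset).trans_lt (hfin x).lt_top).ne
  have harea : ∀ x, area (T.family.shape n x) = T.family.scale x ^ 2 := fun x =>
    area_polygonCopy hn _ _
  rintro ((_ | _) | ⟨i, c⟩)
  · have h1 : T.family.shape n (Sum.inl false) ⊆
        (T.family.shape n (Sum.inl false) \
          ⋃ u ∈ {u | u ≠ Sum.inl false}, T.family.shape n u) ∪ {z | dot A.angle z = 0} := by
      intro z hz
      by_cases h : z ∈ ⋃ u ∈ {u | u ≠ Sum.inl false}, T.family.shape n u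
      · right
        simp only [Set.mem_iUnion] at h
        obtain ⟨u, hu, hzu⟩ := h
        by_cases hu' : u = Sum.inl true
        · subst hu'
          exact le_antisymm (T.dot_nonpos_of_mem_low hzu) (T.dot_nonneg_of_mem_high hz)
        · obtain ⟨i, c, h, -⟩ := T.eq_joint_of_mem hn (Ne.symm hu) (by simp) hu' hz hzu
          simp at h
      · exact Or.inl ⟨hz, h⟩
    have h2 : area (T.family.shape n (Sum.inl false)) ≤ area (T.family.shape n (Sum.inl false) \
        ⋃ u ∈ {u | u ≠ Sum.inl false}, T.family.shape n u) := by
      refine ENNReal.toReal_mono (hfin' _ _) ((measure_mono h1).trans ((measure_union_le _ _).trans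
        ?_))
      rw [volume_dot_eq, add_zero]
    refine le_trans ?_ h2
    exact mul_le_of_le_one_left (area_nonneg _) hα
  · have h1 : T.family.shape n (Sum.inl true) ⊆ (T.family.shape n (Sum.inl true) \
        ⋃ u ∈ {u | u ≠ Sum.inl true}, T.family.shape n u) ∪
        (T.family.shape n (Sum.inl false) ∪
          ⋃ p : Fin k × Bool, T.family.shape n (Sum.inr p)) := by
      intro z hz
      by_cases h : z ∈ ⋃ u ∈ {u | u ≠ Sum.inl true}, T.family.shape n u
      · right
        simp only [Set.mem_iUnion] at h
        obtain ⟨(_ | _) | p, hu, hzu⟩ := h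
        · exact Or.inl hzu
        · exact absurd rfl hu
        · exact Or.inr (Set.mem_iUnion_of_mem p hzu)
      · exact Or.inl ⟨hz, h⟩
    have h2 : volume (⋃ p : Fin k × Bool, T.family.shape n (Sum.inr p)) ≠ ⊤ :=
      ((measure_iUnion_fintype_le _ _).trans_lt
        (ENNReal.sum_lt_top.2 fun p _ => (hfin _).lt_top)).ne
    have h3 : area (T.family.shape n (Sum.inl true)) ≤ area (T.family.shape n (Sum.inl true) \
        ⋃ u ∈ {u | u ≠ Sum.inl true}, T.family.shape n u) +
        (area (T.family.shape n (Sum.inl false)) +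
          ∑ p : Fin k × Bool, area (T.family.shape n (Sum.inr p))) := by
      refine (area_mono h1 ?_).trans ((measureReal_union_le _ _).trans (add_le_add_right
        ((measureReal_union_le _ _).trans (add_le_add_right
          (measureReal_iUnion_fintype_le _) _)) _))
      exact (measure_union_lt_top (hfin' _ _).lt_top
        (measure_union_lt_top (hfin _).lt_top h2.lt_top)).ne
    simp only [harea] at h3 ⊢
    have h4 := T.big_area
    have e1 : T.family.scale (Sum.inl true) = T.big := rfl
    have e2 : T.family.scale (Sum.inl false) = 1 := rfl
    have e3 : ∀ p, T.family.scale (Sum.inr p) = T.size p.1 := fun _ => rfl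
    simp only [e1, e2, e3, one_pow] at h3 ⊢
    linarith
  · have h1 : (fun z => A.armCenter T.gap (T.size i) c + T.size i • z) ''
        (regularPolygon n ∩ {z | chordLevel n + T.gap < nrm n (A.side c) z}) ⊆
        T.family.shape n (Sum.inr (i, c)) \
          ⋃ u ∈ {u | u ≠ Sum.inr (i, c)}, T.family.shape n u := by
      rintro _ ⟨x, ⟨hxK, hx⟩, rfl⟩
      have hx1 := T.notMem_low_of_lt hn (i := i) hx
      have hx2 : A.armCenter T.gap (T.size i) c + T.size i • x ∈
        T.family.shape n (Sum.inr (i, c)) := ⟨x, hxK, rfl⟩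
      refine ⟨hx2, fun h => ?_⟩
      simp only [Set.mem_iUnion] at h
      obtain ⟨u, hu, hzu⟩ := h
      have hu' : u ≠ Sum.inl true := by
        rintro rfl
        exact hx1 hzu
      obtain ⟨j, d, -, -, h⟩ := T.eq_joint_of_mem hn (Ne.symm hu) (by simp) hu' hx2 hzu
      exact hx1 (h ▸ T.joint_mem_low hn j)
    refine le_trans ?_ (area_mono h1 (hfin' _ _))
    rw [area_homothety, harea, mul_comm]
    exact mul_le_mul_of_nonneg_left (T.arm_area c) (sq_nonneg _)

end Tower

/-! ### Canonical drawings of towers -/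

theorem ball_subset_polygonCopy (hn : 3 ≤ n) {c : ℂ} {a ε : ℝ} (ha : 0 < a)
    (h : ε ≤ a * inradius n) : Metric.ball c ε ⊆ polygonCopy n c a := by
  intro z hz
  rw [mem_polygonCopy hn ha]
  intro j
  rw [Metric.mem_ball, dist_eq_norm] at hz
  exact (dot_le_norm _ _).trans (hz.le.trans h)

theorem mem_of_isContactPoint {V : Type} {C : PolygonFamily V} (hn : 3 ≤ n) {ε : ℝ} {u v : V}
    {p : ℂ} (h : C.IsContactPoint n ε u v p) : p ∈ C.shape n u ∩ C.shape n v := by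
  obtain ⟨a, b, ha, ha', hb, hb', -, -, -, -, h⟩ := h
  have h1 : p ∈ polygonCopy n (C.center u) a ∩ polygonCopy n (C.center v) b := by
    rcases h with h | h
    · exact h.2
    · rw [h.2]; rfl
  exact ⟨polygonCopy_mono hn ha ha' h1.1, polygonCopy_mono hn hb hb' h1.2⟩

theorem isContactPoint_symm {V : Type} {C : PolygonFamily V} {ε : ℝ} {u v : V} {p : ℂ}
    (h : C.IsContactPoint n ε u v p) : C.IsContactPoint n ε v u p := by
  obtain ⟨a, b, ha, ha', hb, hb', h1, h2, h3, h4, h5⟩ := h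
  refine ⟨b, a, hb, hb', ha, ha', h2, h1, ?_, ?_, ?_⟩
  · rwa [Set.inter_comm]
  · rwa [Set.inter_comm]
  · rwa [segment_symm, Set.inter_comm (polygonCopy n (C.center v) b)]

namespace Tower

variable {A : Axis n} {k : ℕ} {α : ℝ} (T : Tower A k α)

theorem zero_mem_segment : (0 : ℂ) ∈ segment ℝ (-((T.big * A.top) • unitVec A.angle))
    (A.bot • unitVec A.angle) := by
  have h1 := mul_pos T.big_pos A.top_pos
  have h2 := A.bot_pos
  refine ⟨A.bot / (A.bot + T.big * A.top), T.big * A.top / (A.bot + T.big * A.top),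
    by positivity, by positivity, by field_simp, ?_⟩
  rw [smul_neg, smul_smul, smul_smul, neg_add_eq_zero]
  congr 1
  ring

/-- The two shapes lie on different sides of a line through `0`, so shrinking either one separates
them. At full size the segment between the centres meets this line only in `0`. -/
theorem eq_zero_of_isContactPoint (hn : 3 ≤ n) {ε : ℝ} {p : ℂ}
    (h : T.family.IsContactPoint n ε (Sum.inl true) (Sum.inl false) p) : p = 0 := by
  have hp := mem_of_isContactPoint hn h
  have hd : dot A.angle p = 0 :=
    le_antisymm (T.dot_nonpos_of_mem_low hp.1) (T.dot_nonneg_of_mem_high hp.2)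
  obtain ⟨a, b, ha, ha', hb, hb', -, -, -, -, h⟩ := h
  change a ≤ T.big at ha'
  change b ≤ 1 at hb'
  have hp' : p ∈ polygonCopy n (T.family.center (Sum.inl true)) a ∩
      polygonCopy n (T.family.center (Sum.inl false)) b := by
    rcases h with h | h
    · exact h.2
    · rw [h.2]; rfl
  have ha1 : a = T.big := by
    obtain ⟨x, hx, rfl⟩ := hp'.1
    change dot A.angle (-((T.big * A.top) • unitVec A.angle) + a • x) = 0 at hd
    rw [map_add, map_neg, map_smul, map_smul, A.dot_axis, smul_eq_mul, smul_eq_mul] at hd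
    have h1 := mul_le_mul_of_nonneg_left (A.le_top x hx) ha.le
    have h2 : T.big * A.top ≤ a * A.top := by linarith
    exact le_antisymm ha' (le_of_mul_le_mul_right h2 A.top_pos)
  have hb1 : b = 1 := by
    obtain ⟨x, hx, rfl⟩ := hp'.2
    change dot A.angle (A.bot • unitVec A.angle + b • x) = 0 at hd
    rw [map_add, map_smul, map_smul, A.dot_axis, smul_eq_mul, smul_eq_mul] at hd
    have h1 := mul_le_mul_of_nonneg_left (A.neg_bot_le x hx) hb.le
    have h2 : 1 * A.bot ≤ b * A.bot := by linarith
    exact le_antisymm hb' (le_of_mul_le_mul_right h2 A.bot_pos)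
  subst ha1 hb1
  have h0 : (0 : ℂ) ∈ segment ℝ (T.family.center (Sum.inl true)) (T.family.center (Sum.inl false)) ∩
      (polygonCopy n (T.family.center (Sum.inl true)) T.big ∩
        polygonCopy n (T.family.center (Sum.inl false)) 1) :=
    ⟨T.zero_mem_segment, T.zero_mem_low, T.zero_mem_high⟩
  rcases h with h | h
  · obtain ⟨s, t, -, -, -, rfl⟩ := h.1
    change dot A.angle (s • -((T.big * A.top) • unitVec A.angle) +
      t • A.bot • unitVec A.angle) = 0 at hd
    change s • -((T.big * A.top) • unitVec A.angle) + t • A.bot • unitVec A.angle = 0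
    have e : s • -((T.big * A.top) • unitVec A.angle) + t • A.bot • unitVec A.angle =
        (t * A.bot - s * (T.big * A.top)) • unitVec A.angle := by module
    rw [e] at hd ⊢
    rw [map_smul, A.dot_axis, smul_eq_mul, mul_one] at hd
    rw [hd, zero_smul]
  · rw [h.1] at h0
    exact absurd h0 (Set.notMem_empty _)

theorem adj_low_high :
    (T.family.intersectionGraph n).Adj (Sum.inl true) (Sum.inl false) :=
  ⟨by simp, 0, T.zero_mem_low, T.zero_mem_high⟩

theorem adj_pair (hn : 3 ≤ n) (i : Fin k) :
    (T.family.intersectionGraph n).Adj (Sum.inr (i, true)) (Sum.inr (i, false)) :=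
  ⟨by simp, T.joint i, T.joint_mem_arm hn i _, T.joint_mem_arm hn i _⟩

theorem eventually_ball_subset (hn : 3 ≤ n) (c : ℂ) {a : ℝ} (ha : 0 < a) :
    ∀ᶠ ε in 𝓝[>] (0 : ℝ), Metric.ball c ε ⊆ polygonCopy n c a := by
  filter_upwards [Ioo_mem_nhdsGT (mul_pos ha (inradius_pos hn))] with ε hε
  exact ball_subset_polygonCopy hn ha hε.2.le

theorem exists_isContactPoint_low_high (hn : 3 ≤ n) : ∀ᶠ ε in 𝓝[>] (0 : ℝ),
    T.family.IsContactPoint n ε (Sum.inl true) (Sum.inl false) 0 := by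
  filter_upwards [eventually_ball_subset hn (T.family.center (Sum.inl true)) T.big_pos,
    eventually_ball_subset hn (T.family.center (Sum.inl false)) one_pos] with ε h1 h2
  refine ⟨T.big, 1, T.big_pos, le_rfl, one_pos, le_rfl, h1, h2,
    ⟨0, T.zero_mem_low, T.zero_mem_high⟩, ?_,
    Or.inl ⟨T.zero_mem_segment, T.zero_mem_low, T.zero_mem_high⟩⟩
  have : T.family.shape n (Sum.inl true) ∩ T.family.shape n (Sum.inl false) ⊆
      {z | dot A.angle z = 0} := fun z hz =>
    le_antisymm (T.dot_nonpos_of_mem_low hz.1) (T.dot_nonneg_of_mem_high hz.2)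
  exact (congrArg ENNReal.toReal (measure_mono_null this (volume_dot_eq _ _))).trans
    ENNReal.toReal_zero

theorem exists_isContactPoint_pair (hn : 3 ≤ n) (i : Fin k) : ∀ᶠ ε in 𝓝[>] (0 : ℝ),
    T.family.IsContactPoint n ε (Sum.inr (i, true)) (Sum.inr (i, false)) (T.joint i) := by
  filter_upwards [eventually_ball_subset hn (T.family.center (Sum.inr (i, true))) (T.size_pos i),
    eventually_ball_subset hn (T.family.center (Sum.inr (i, false))) (T.size_pos i)] with ε h1 h2
  have hmem : T.joint i ∈ T.family.shape n (Sum.inr (i, true)) ∩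
      T.family.shape n (Sum.inr (i, false)) := ⟨T.joint_mem_arm hn i _, T.joint_mem_arm hn i _⟩
  have hsing : T.family.shape n (Sum.inr (i, true)) ∩ T.family.shape n (Sum.inr (i, false)) =
      {T.joint i} :=
    subset_antisymm (fun z hz => T.eq_joint hn hz.1 hz.2) (Set.singleton_subset_iff.2 hmem)
  refine ⟨T.size i, T.size i, T.size_pos i, le_rfl, T.size_pos i, le_rfl, h1, h2,
    ⟨_, hmem⟩, ?_, ?_⟩
  · change area (T.family.shape n (Sum.inr (i, true)) ∩ T.family.shape n (Sum.inr (i, false))) = 0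
    rw [hsing, area, measure_singleton, ENNReal.toReal_zero]
  · by_cases hL : T.joint i ∈ segment ℝ (T.family.center (Sum.inr (i, true)))
        (T.family.center (Sum.inr (i, false)))
    · exact Or.inl ⟨hL, hmem⟩
    · refine Or.inr ⟨?_, hsing⟩
      rw [Set.eq_empty_iff_forall_notMem]
      rintro z ⟨hz, hz'⟩
      rw [T.eq_joint hn (c := true) hz'.1 hz'.2] at hz
      exact hL hz

/-- The joint is a corner of the arm, hence outside every copy of the arm shrunk at its centre. -/
theorem exists_isContactPoint_low_arm (hn : 3 ≤ n) (i : Fin k) (c : Bool) :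
    ∀ᶠ ε in 𝓝[>] (0 : ℝ), ∃ p, T.family.IsContactPoint n ε (Sum.inl true) (Sum.inr (i, c)) p ∧
      p ≠ T.joint i := by
  obtain ⟨a, b, ha, ha', hb, hb', h1, h2, p, h3⟩ := T.contact i c
  filter_upwards [eventually_ball_subset hn (T.family.center (Sum.inl true)) ha,
    eventually_ball_subset hn (T.family.center (Sum.inr (i, c))) hb] with ε h4 h5
  refine ⟨p, ⟨a, b, ha, ha', hb, hb'.le, h4, h5, h1, h2, h3⟩, ?_⟩
  rintro rfl
  have hp : T.joint i ∈ polygonCopy n (A.armCenter T.gap (T.size i) c) b := by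
    rcases h3 with h | h
    · exact h.2.2
    · have : T.joint i ∈ ({T.joint i} : Set ℂ) := rfl
      rw [← h.2] at this
      exact this.2
  have h6 := (mem_polygonCopy hn hb).1 hp (A.above c)
  rw [show T.joint i - A.armCenter T.gap (T.size i) c = T.size i • vtx n (A.tip c) by
    rw [joint, Axis.armCenter]; abel, map_smul, A.above_tip, smul_eq_mul] at h6
  exact hb'.not_ge (le_of_mul_le_mul_right h6 (inradius_pos hn))

theorem eventually_exists_isContactPoint (hn : 3 ≤ n) (x y : Index k)
    (h : (T.family.intersectionGraph n).Adj x y) : ∀ᶠ ε in 𝓝[>] (0 : ℝ),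
      ∃ p, T.family.IsContactPoint n ε x y p ∧
        (x = Sum.inl true ∨ y = Sum.inl true → ∀ i, p ≠ T.joint i) := by
  have hlow : ∀ y, (T.family.intersectionGraph n).Adj (Sum.inl true) y → ∀ᶠ ε in 𝓝[>] (0 : ℝ),
      ∃ p, T.family.IsContactPoint n ε (Sum.inl true) y p ∧ ∀ i, p ≠ T.joint i := by
    rintro ((_ | _) | ⟨i, c⟩) h
    · filter_upwards [T.exists_isContactPoint_low_high hn] with ε hε
      exact ⟨0, hε, fun i => (T.joint_ne_zero i).symm⟩
    · exact absurd rfl h.1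
    · filter_upwards [T.exists_isContactPoint_low_arm hn i c] with ε hε
      obtain ⟨p, hp, hpi⟩ := hε
      refine ⟨p, hp, fun j hj => ?_⟩
      have h1 := (mem_of_isContactPoint hn hp).2
      subst hj
      have h2 := T.joint_mem_arm hn j (!c)
      obtain ⟨l, d, hl, -, hjl⟩ := T.eq_joint_of_mem hn (by simp) (by simp) (by simp) h1 h2
      simp only [Sum.inr.injEq, Prod.mk.injEq] at hl
      rw [← hl.1] at hjl
      exact hpi hjl
  by_cases hx : x = Sum.inl true
  · subst hx
    filter_upwards [hlow y h] with ε ⟨p, hp, hpi⟩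
    exact ⟨p, hp, fun _ => hpi⟩
  by_cases hy : y = Sum.inl true
  · subst hy
    filter_upwards [hlow x h.symm] with ε ⟨p, hp, hpi⟩
    exact ⟨p, isContactPoint_symm hp, fun _ => hpi⟩
  obtain ⟨hne, z, hzx, hzy⟩ := h
  obtain ⟨i, c, rfl, rfl, -⟩ := T.eq_joint_of_mem hn hne hx hy hzx hzy
  filter_upwards [T.exists_isContactPoint_pair hn i] with ε hε
  refine ⟨T.joint i, ?_, fun h => by simp at h⟩
  cases c
  · exact isContactPoint_symm hε
  · exact hε

/-- Two edges with a common endpoint and a common contact point would give a point in three shapes.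
As contact points of the low shape avoid the joints, the condition on such edges in a canonical
drawing is vacuous. -/
theorem eq_joint_of_mem_three (hn : 3 ≤ n) {z : ℂ} {x y w : Index k} (hxy : x ≠ y) (hxw : x ≠ w)
    (hyw : y ≠ w) (hx : z ∈ T.family.shape n x) (hy : z ∈ T.family.shape n y)
    (hw : z ∈ T.family.shape n w) : (∃ i, z = T.joint i) ∧
      (x = Sum.inl true ∨ y = Sum.inl true ∨ w = Sum.inl true) := by
  by_cases h1 : x = Sum.inl true
  · subst h1
    obtain ⟨i, c, -, -, h⟩ := T.eq_joint_of_mem hn hyw hxy.symm hxw.symm hy hw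
    exact ⟨⟨i, h⟩, Or.inl rfl⟩
  by_cases h2 : y = Sum.inl true
  · subst h2
    obtain ⟨i, c, -, -, h⟩ := T.eq_joint_of_mem hn hxw h1 hyw.symm hx hw
    exact ⟨⟨i, h⟩, Or.inr (Or.inl rfl)⟩
  obtain ⟨i, c, rfl, rfl, h⟩ := T.eq_joint_of_mem hn hxy h1 h2 hx hy
  refine ⟨⟨i, h⟩, Or.inr (Or.inr ?_)⟩
  by_contra h3
  obtain ⟨j, d, h4, rfl, -⟩ := T.eq_joint_of_mem hn hxw h1 h3 hx hw
  simp only [Sum.inr.injEq, Prod.mk.injEq] at h4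
  rw [h4.1, h4.2] at hyw
  exact hyw rfl

theorem eventually_exists_isCanonicalDrawing (hn : 3 ≤ n) : ∀ᶠ ε in 𝓝[>] (0 : ℝ),
    ∃ D : OneBendDrawing (Index k), T.family.IsCanonicalDrawing n ε D := by
  classical
  have h1 : ∀ᶠ ε in 𝓝[>] (0 : ℝ), ∀ x y, (T.family.intersectionGraph n).Adj x y →
      ∃ p, T.family.IsContactPoint n ε x y p ∧
        (x = Sum.inl true ∨ y = Sum.inl true → ∀ i, p ≠ T.joint i) := by
    rw [eventually_all]
    intro x
    rw [eventually_all]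
    intro y
    by_cases h : (T.family.intersectionGraph n).Adj x y
    · filter_upwards [T.eventually_exists_isContactPoint hn x y h] with ε hε _ using hε
    · exact Eventually.of_forall fun ε h' => absurd h' h
  filter_upwards [h1, self_mem_nhdsWithin] with ε hε hε0
  have h2 : ∀ e : Sym2 (Index k), ∃ p, e ∈ (T.family.intersectionGraph n).edgeSet →
      (∀ x y, e = s(x, y) → T.family.IsContactPoint n ε x y p) ∧
        (Sum.inl true ∈ e → ∀ i, p ≠ T.joint i) := by
    intro e
    induction e using Sym2.ind with
    | _ x y =>
      by_cases h : (T.family.intersectionGraph n).Adj x y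
      · obtain ⟨p, hp, hpi⟩ := hε x y h
        refine ⟨p, fun _ => ⟨fun x' y' hxy => ?_, fun hm => hpi ?_⟩⟩
        · rcases Sym2.eq_iff.1 hxy with ⟨rfl, rfl⟩ | ⟨rfl, rfl⟩
          exacts [hp, isContactPoint_symm hp]
        · rcases Sym2.mem_iff.1 hm with h | h
          exacts [Or.inl h.symm, Or.inr h.symm]
      · exact ⟨0, fun h' => absurd h' h⟩
  choose p hp using h2
  obtain ⟨q, hq, hqi, hqc⟩ := exists_generalPosition
    (Sum.elim T.family.center fun e : (T.family.intersectionGraph n).edgeSet => p e)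
    (Set.mem_Ioi.1 hε0)
  let D : OneBendDrawing (Index k) :=
    { pos := fun v => q (Sum.inl v)
      bend := fun e => if h : e ∈ (T.family.intersectionGraph n).edgeSet then q (Sum.inr ⟨e, h⟩)
        else 0 }
  have hD : Sum.elim D.pos (fun e : (T.family.intersectionGraph n).edgeSet => D.bend e) = q := by
    funext x
    rcases x with v | ⟨e, he⟩
    · rfl
    · exact dif_pos he
  refine ⟨D, fun v => hq (Sum.inl v), ?_, p, fun x y h => ?_, fun e he f hf hef hpe hc => ?_⟩
  · unfold OneBendDrawing.GeneralPosition
    rw [hD]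
    exact ⟨hqi, hqc⟩
  · refine ⟨(hp s(x, y) h).1 x y rfl, ?_⟩
    have h3 : D.bend s(x, y) = q (Sum.inr ⟨s(x, y), h⟩) := dif_pos h
    rw [h3]
    exact hq (Sum.inr ⟨s(x, y), h⟩)
  · obtain ⟨v, hve, hvf⟩ := hef
    obtain ⟨x, rfl⟩ := Sym2.mem_iff_exists.1 hve
    obtain ⟨y, rfl⟩ := Sym2.mem_iff_exists.1 hvf
    have hxy : x ≠ y := by
      rintro rfl
      exact hc.1 rfl
    have hx := mem_of_isContactPoint hn ((hp _ he).1 v x rfl)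
    have hy := mem_of_isContactPoint hn ((hp _ hf).1 v y rfl)
    rw [← hpe] at hy
    have hvx : (T.family.intersectionGraph n).Adj v x := he
    have hvy : (T.family.intersectionGraph n).Adj v y := hf
    obtain ⟨⟨i, hi⟩, h3⟩ := T.eq_joint_of_mem_three hn hvx.1 hvy.1 hxy hx.1 hx.2 hy.2
    rcases h3 with h | h | h
    · exact (hp _ he).2 (by rw [h]; simp) i hi
    · exact (hp _ he).2 (by rw [h]; simp) i hi
    · exact (hp _ hf).2 (by rw [h]; simp) i (hpe ▸ hi)

/-- In the limit the long edge follows the axis down from `0`; the joint is strictly between its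
ends, and the centres of the arms are strictly on the two hands. -/
theorem exists_pair_crossing (i : Fin k) : ∃ η > 0, ∀ U B W Z X : ℂ,
    dist U (T.family.center (Sum.inl true)) < η → dist B 0 < η →
    dist W (T.family.center (Sum.inr (i, true))) < η → dist Z (T.joint i) < η →
    dist X (T.family.center (Sum.inr (i, false))) < η →
      (segment ℝ U B ∩ (segment ℝ W Z ∪ segment ℝ X Z)).Nonempty := by
  have hs := T.size_pos i
  have hh := mul_pos T.gap_pos hs
  have hr := T.reach i
  have hrt := mul_pos T.big_pos A.top_pos
  have hDU : dot A.angle (T.family.center (Sum.inl true)) = -(T.big * A.top) := by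
    change dot A.angle (-((T.big * A.top) • unitVec A.angle)) = _
    rw [map_neg, map_smul, A.dot_axis, smul_eq_mul, mul_one]
  have hTU : dot (A.angle + Real.pi / 2) (T.family.center (Sum.inl true)) = 0 := by
    change dot (A.angle + Real.pi / 2) (-((T.big * A.top) • unitVec A.angle)) = _
    rw [map_neg, map_smul, A.lateral_axis, smul_zero, neg_zero]
  have hDZ : dot A.angle (T.joint i) = -(T.gap * T.size i) := by
    rw [joint, map_neg, map_smul, A.dot_axis, smul_eq_mul, mul_one]
  have hTZ : dot (A.angle + Real.pi / 2) (T.joint i) = 0 := by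
    rw [joint, map_neg, map_smul, A.lateral_axis, smul_zero, neg_zero]
  have hTc : ∀ c, dot (A.angle + Real.pi / 2) (T.family.center (Sum.inr (i, c))) =
      -(T.size i * dot (A.angle + Real.pi / 2) (vtx n (A.tip c))) := by
    intro c
    change dot (A.angle + Real.pi / 2) (A.armCenter T.gap (T.size i) c) = _
    rw [Axis.armCenter, map_sub, map_neg, map_smul, map_smul, A.lateral_axis, smul_zero, neg_zero,
      zero_sub, smul_eq_mul]
  have hTW : 0 < dot (A.angle + Real.pi / 2) (T.family.center (Sum.inr (i, true))) := by
    have := A.lateral_tip true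
    rw [sgn_true, one_mul] at this
    rw [hTc]
    nlinarith
  have hTX : dot (A.angle + Real.pi / 2) (T.family.center (Sum.inr (i, false))) < 0 := by
    have := A.lateral_tip false
    rw [sgn_false] at this
    rw [hTc]
    nlinarith
  apply exists_stable_crossing <;> rw [orient_eq A.angle] <;> simp only [map_sub, map_zero, hDU,
    hTU, hDZ, hTZ] <;> nlinarith

/-- The contact points of the long edge and of the pairs are forced, so in these edges every
canonical drawing is a small perturbation of the limit configuration. -/
theorem exists_isIndependentCrossingSet (hn : 3 ≤ n) : ∀ᶠ ε in 𝓝[>] (0 : ℝ),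
    ∀ D : OneBendDrawing (Index k), T.family.IsCanonicalDrawing n ε D →
      ∃ M : Finset (Sym2 (Index k)), M.card = k ∧
        D.IsIndependentCrossingSet (T.family.intersectionGraph n)
          s(Sum.inl true, Sum.inl false) M := by
  classical
  have h1 : ∀ᶠ ε in 𝓝[>] (0 : ℝ), ∀ i, ∀ U B W Z X : ℂ,
      dist U (T.family.center (Sum.inl true)) < ε → dist B 0 < ε →
      dist W (T.family.center (Sum.inr (i, true))) < ε → dist Z (T.joint i) < ε →
      dist X (T.family.center (Sum.inr (i, false))) < ε →
        (segment ℝ U B ∩ (segment ℝ W Z ∪ segment ℝ X Z)).Nonempty := by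
    rw [eventually_all]
    intro i
    obtain ⟨η, hη, h⟩ := T.exists_pair_crossing i
    filter_upwards [Ioo_mem_nhdsGT hη] with ε hε U B W Z X hU hB hW hZ hX
    exact h U B W Z X (hU.trans hε.2) (hB.trans hε.2) (hW.trans hε.2) (hZ.trans hε.2)
      (hX.trans hε.2)
  filter_upwards [h1] with ε hε D hD
  obtain ⟨hpos, -, p, hp, -⟩ := hD
  have hinj : Function.Injective
      fun i : Fin k => (s(Sum.inr (i, true), Sum.inr (i, false)) : Sym2 (Index k)) := by
    intro i j h
    rcases Sym2.eq_iff.1 h with ⟨h, -⟩ | ⟨h, -⟩ <;> simp_all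
  refine ⟨Finset.univ.image fun i => s(Sum.inr (i, true), Sum.inr (i, false)), ?_, ?_, ?_⟩
  · rw [Finset.card_image_of_injective _ hinj, Finset.card_univ, Fintype.card_fin]
  · intro f hf
    obtain ⟨i, -, rfl⟩ := Finset.mem_image.1 hf
    have h0 := hp _ _ T.adj_low_high
    have hi := hp _ _ (T.adj_pair hn i)
    have hmi := mem_of_isContactPoint hn hi.1
    refine ⟨T.adj_pair hn i, by simp, ?_⟩
    have h2 := h0.2
    have h3 := hi.2
    rw [T.eq_zero_of_isContactPoint hn h0.1] at h2
    rw [T.eq_joint hn (c := true) hmi.1 hmi.2] at h3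
    obtain ⟨z, hz, hz'⟩ := hε i _ _ _ _ _ (hpos _) h2 (hpos _) h3 (hpos _)
    refine ⟨z, ⟨⟨_, by simp, hz⟩, ?_⟩, ?_⟩
    · rcases hz' with hz' | hz'
      exacts [⟨_, by simp, hz'⟩, ⟨_, by simp, hz'⟩]
    · rintro ⟨v, hv, hv', -⟩
      rcases Sym2.mem_iff.1 hv with rfl | rfl <;> simp at hv'
  · intro f hf g hg hfg v hv
    obtain ⟨i, -, rfl⟩ := Finset.mem_image.1 hf
    obtain ⟨j, -, rfl⟩ := Finset.mem_image.1 hg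
    have hij : i ≠ j := by
      rintro rfl
      exact hfg rfl
    rcases Sym2.mem_iff.1 hv.1 with rfl | rfl <;> simp [hij] at hv

end Tower

/-! ### Existence of towers below the threshold -/

/-- The contact condition of a tower holds as soon as the low shape is big enough. -/
theorem Axis.eventually_contact (hn : 3 ≤ n) (A : Axis n) {gap s : ℝ} (hg : 0 < gap)
    (hg' : gap ≤ inradius n) (hs : 0 < s) (c : Bool) :
    ∀ᶠ r in atTop, ∃ a b : ℝ, 0 < a ∧ a ≤ r ∧ 0 < b ∧ b < s ∧
      let P := polygonCopy n (-((r * A.top) • unitVec A.angle)) a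
      let Q := polygonCopy n (A.armCenter gap s c) b
      let L := segment ℝ (-((r * A.top) • unitVec A.angle)) (A.armCenter gap s c)
      (P ∩ Q).Nonempty ∧ area (P ∩ Q) = 0 ∧
        ∃ p, (p ∈ L ∩ (P ∩ Q) ∨ (L ∩ (P ∩ Q) = ∅ ∧ P ∩ Q = {p})) := by
  have hρ := inradius_pos hn
  have hd := depth_pos hn
  have hρd : inradius n ≤ depth n := by
    unfold depth
    split_ifs
    exacts [le_rfl, inradius_le hn]
  set e := nrm n (A.side c) (unitVec A.angle) with he
  have he1 : e ≤ 1 := (dot_le_norm _ _).trans (norm_unitVec _).le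
  have he0 : 0 < e := by
    have h := A.side_top c
    exact pos_of_mul_pos_right (h ▸ hρ) A.top_pos.le
  -- At full size the arm reaches at least `gap * s * e` below the line bounding the low shape. This
  -- amount of shrinking keeps at least half of that, so the low shape never has to grow.
  set b := s - gap * s * e / (2 * depth n) with hb
  have hgs := mul_pos hg hs
  have hbs : b < s := by
    have : 0 < gap * s * e / (2 * depth n) := by positivity
    linarith
  have hbd : b * depth n = s * depth n - gap * s * e / 2 := by
    rw [hb]; field_simp
  have hb0 : 0 < b := by
    have h1 : gap * e ≤ depth n * 1 := mul_le_mul (hg'.trans hρd) he1 he0.le hd.le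
    have h2 : 0 < b * depth n := by
      rw [hbd]
      nlinarith [mul_le_mul_of_nonneg_left h1 hs.le, mul_pos hs hd]
    exact pos_of_mul_pos_left h2 hd.le
  set w := A.armCenter gap s c with hw
  have hwlat : 0 ≤ sgn c * dot (A.angle + Real.pi / 2) w := by
    have := A.lateral_tip c
    rw [hw, armCenter, map_sub, map_neg, map_smul, map_smul, A.lateral_axis, smul_zero, neg_zero,
      zero_sub, smul_eq_mul]
    nlinarith
  have hwlat' : 0 ≤ sgn c * dot (A.angle + Real.pi / 2)
      (w - (b * depth n) • unitVec ((2 * A.side c + 1) * (Real.pi / n))) := by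
    have h := A.foot c b s hb0.le hbs.le
    rw [map_sub] at h ⊢
    have e1 : dot (A.angle + Real.pi / 2) w =
        dot (A.angle + Real.pi / 2) (-(s • vtx n (A.tip c))) := by
      rw [hw, armCenter, map_sub, map_neg, map_smul, A.lateral_axis, smul_zero, neg_zero, zero_sub,
        map_neg]
    rwa [e1]
  obtain ⟨r₁, h1⟩ := A.sector c _ hwlat
  obtain ⟨r₂, h2⟩ := A.sector c _ hwlat'
  have hnw : nrm n (A.side c) w = -(gap * s * e) - s * chordLevel n := by
    rw [hw, armCenter, map_sub, map_neg, map_smul, map_smul, A.side_tip, smul_eq_mul, smul_eq_mul]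
  have hlam : -depth n ≤ chordLevel n := by
    rw [← A.side_tip c]
    exact neg_depth_le hn (vtx_mem hn _) _
  filter_upwards [eventually_ge_atTop r₁, eventually_ge_atTop r₂,
    eventually_gt_atTop ((b * depth n - nrm n (A.side c) w) / inradius n)] with r hr1 hr2 hr3
  have hsub : w - -((r * A.top) • unitVec A.angle) = w + r • (A.top • unitVec A.angle) := by
    rw [sub_neg_eq_add, smul_smul]
  obtain ⟨s₁, t₁, hs₁, ht₁, hst₁⟩ := h1 r hr1
  obtain ⟨s₂, t₂, hs₂, ht₂, hst₂⟩ := h2 r hr2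
  -- The scale at which the side of the low shape just reaches the level `b * depth n` below the
  -- centre of the shrunken arm.
  refine ⟨r - (b * depth n - nrm n (A.side c) w) / inradius n, b, by linarith, ?_, hb0, hbs, ?_⟩
  · have h3 : 0 ≤ (b * depth n - nrm n (A.side c) w) / inradius n := by
      refine div_nonneg ?_ hρ.le
      rw [hnw, hbd]
      nlinarith [mul_pos hgs he0, mul_le_mul_of_nonneg_left hlam hs.le]
    linarith
  · refine exists_contact hn (k := A.side c) (by linarith) hb0 ?_ hs₁ ht₁ (hsub.trans hst₁) hs₂ ht₂
      ?_
    · rw [hsub, map_add, map_smul, map_smul, smul_eq_mul, smul_eq_mul, A.side_top]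
      field_simp
      ring
    · rw [hsub, ← hst₂]
      abel

theorem exists_tower (hn : 3 ≤ n) (A : Axis n) (k : ℕ) {α : ℝ} (hα : α < threshold n) :
    Nonempty (Tower A k α) := by
  have hR := circumradius_pos hn
  have hρ := inradius_pos hn
  have hκ := A.slope_pos
  have hα1 : α < 1 := hα.trans_le (threshold_le_one hn)
  choose gap hgap hgapα using fun c => exists_le_area_inter hn (A.side c) hα
  set δ := min (min (gap true) (gap false)) (inradius n) with hδd
  have hδ : 0 < δ := lt_min (lt_min (hgap _) (hgap _)) hρ
  have hδc : ∀ c, δ ≤ gap c := by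
    rintro (_ | _)
    exacts [(min_le_left _ _).trans (min_le_right _ _), (min_le_left _ _).trans (min_le_left _ _)]
  -- The quotient is the ratio of outer to inner radius of the ring containing a pair; the summand
  -- `1` makes the separation strict and gives `l ≥ 1`. The sizes start at `l`, not at `1`, to leave
  -- room for the upper shape.
  set l := (δ + 2 * circumradius n) / (δ * A.slope) + 1 with hl
  have hδκ := mul_pos hδ hκ
  have hl0 : 0 < (δ + 2 * circumradius n) / (δ * A.slope) := by positivity
  have hl1 : 1 ≤ l := by linarith
  have hlb : δ + 2 * circumradius n < l * (δ * A.slope) := by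
    rw [hl, add_mul, div_mul_cancel₀ _ hδκ.ne']; linarith
  set size : Fin k → ℝ := fun i => l ^ ((i : ℕ) + 1) with hsize
  have hsize0 : ∀ i, 0 < size i := fun i => pow_pos (by linarith) _
  have e1 : ∀ᶠ r : ℝ in atTop, ∀ i, δ * size i < r * A.top := eventually_all.2 fun i =>
    (tendsto_id.atTop_mul_const A.top_pos).eventually_gt_atTop _
  have e2 : ∀ᶠ r : ℝ in atTop, 1 + ∑ p : Fin k × Bool, size p.1 ^ 2 ≤ (1 - α) * r ^ 2 :=
    ((tendsto_pow_atTop two_ne_zero).const_mul_atTop (by linarith)).eventually_ge_atTop _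
  have e3 := eventually_all.2 fun i => eventually_all.2 fun c =>
    A.eventually_contact hn hδ (min_le_right _ _) (hsize0 i) c
  obtain ⟨r, h1, h2, h3, h4⟩ := (e1.and (e2.and (e3.and (eventually_gt_atTop 0)))).exists
  exact ⟨{
    gap := δ
    size := size
    big := r
    gap_pos := hδ
    size_pos := hsize0
    base := fun i => by
      have : l ≤ size i := le_self_pow₀ hl1 (by omega)
      nlinarith [mul_le_mul_of_nonneg_right this hδκ.le]
    sep := fun i j hij => by
      have h5 : l * size i ≤ size j := by
        rw [hsize]
        simp only
        rw [← pow_succ']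
        exact pow_le_pow_right₀ hl1 (by have : (i : ℕ) < j := hij; omega)
      have := mul_le_mul_of_nonneg_right h5 hδκ.le
      have := mul_lt_mul_of_pos_right hlb (hsize0 i)
      linarith
    big_pos := h4
    reach := h1
    arm_area := fun c => (hgapα c).trans (area_mono (fun z hz => ⟨hz.1, by
      have h5 : chordLevel n + gap c < nrm n (A.side c) z := hz.2
      rw [Set.mem_ofPred_eq]
      linarith [hδc c]⟩) (volume_ne_top hn Set.inter_subset_left))
    big_area := by linarith
    contact := h3 }⟩

/-- Below the threshold, edges can be crossed by arbitrarily many independent edges. -/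
theorem exists_independent_crossings (hn : 3 ≤ n) {α : ℝ} (hα : α < threshold n) (k : ℕ) :
    ∃ (V : Type) (_ : Finite V) (C : PolygonFamily V) (u v : V),
      C.IsFree n α ∧ (C.intersectionGraph n).Adj u v ∧
      ∀ᶠ ε in 𝓝[>] (0 : ℝ),
        (∃ D : OneBendDrawing V, C.IsCanonicalDrawing n ε D) ∧
        ∀ D : OneBendDrawing V, C.IsCanonicalDrawing n ε D →
          ∃ M : Finset (Sym2 V), M.card = k ∧
            D.IsIndependentCrossingSet (C.intersectionGraph n) s(u, v) M := by
  obtain ⟨A⟩ := exists_axis hn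
  obtain ⟨T⟩ := exists_tower hn A k hα
  exact ⟨Tower.Index k, inferInstance, T.family, Sum.inl true, Sum.inl false,
    T.isFree hn (hα.le.trans (threshold_le_one hn)), T.adj_low_high,
    (T.eventually_exists_isCanonicalDrawing hn).and (T.exists_isIndependentCrossingSet hn)⟩

end RegularPolygon

theorem mainTheorem5 (n : ℕ) (hn : 3 ≤ n) (α : ℝ) (hα0 : 0 ≤ α) (hα1 : α ≤ 1) :
    ((∃ k : ℕ, CanonicalDrawingsIndependentCrossing n α k) ↔ threshold n ≤ α) ∧
    (threshold n ≤ α → CanonicalDrawingsIndependentCrossing n α (26 * (n + 1))) ∧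
    (α < threshold n → ∀ k : ℕ,
      ∃ (V : Type) (_ : Finite V) (C : PolygonFamily V) (u v : V),
        C.IsFree n α ∧ (C.intersectionGraph n).Adj u v ∧
        ∀ᶠ ε in 𝓝[>] (0 : ℝ),
          (∃ D : OneBendDrawing V, C.IsCanonicalDrawing n ε D) ∧
          ∀ D : OneBendDrawing V, C.IsCanonicalDrawing n ε D →
            ∃ M : Finset (Sym2 V), M.card = k ∧
              D.IsIndependentCrossingSet (C.intersectionGraph n) s(u, v) M) := by
  have h2 := RegularPolygon.canonicalDrawingsIndependentCrossing_of_threshold_le (α := α) hn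
  refine ⟨⟨?_, fun h => ⟨_, h2 h⟩⟩, h2, fun h => RegularPolygon.exists_independent_crossings hn h⟩
  rintro ⟨k, hk⟩
  by_contra! hα
  obtain ⟨V, hV, C, u, v, hfree, huv, hε⟩ :=
    RegularPolygon.exists_independent_crossings hn hα (k + 1)
  -- The existence of a canonical drawing matters here: without one, the bound `k` would hold
  -- vacuously.
  obtain ⟨ε, hkε, ⟨D, hD⟩, hM⟩ := ((hk V C hfree).and hε).exists
  obtain ⟨M, hcard, hcross⟩ := hM D hD
  have := hkε D hD s(u, v) huv M hcross
  omega
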